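/- **Model.** There are $M\ge 1$ operators. For each $m\in\{1,\dots,M\}$ the base stations (BSs) of operator $m$ form a homogeneous Poisson point process $\{\mathbf d^{(m)}_i\}_{i\in\mathbb N}$ in $\mathbb R^2$ with density $\lambda_m>0$. Operator $m$ has transmit power $P_m>0$, bandwidth $W_m>0$ and coordination set size $K_m\ge 0$, with $K_1\ge 1$. Given the positions, each link from a BS at $\mathbf d$ to the user at the origin is independently LoS with probability $p(\|\mathbf d\|)$, where $p(r)=e^{-r/\mu}$ and $\mu>0$, and NLoS otherwise. A link of length $r$ in state $s\in\{\mathrm L,\mathrm N\}$ has link power $C_s r^{-\alpha_s}$, with $C_s,\alpha_s>0$. BS $i$ of operator $m$ has fading power $H^{(m)}_i\sim\mathrm{Exp}(1)$ and an angle $\theta^{(m)}_i$, relative to its beam, that is uniform on $(-\pi,\pi]$. Fading powers and angles are all independent of each other and of positions and link states, and different operators are independent. With $N\ge 1$ antennas and $\epsilon\ge 0$, the antenna gain $G(\theta)$ is $G=\frac{2\pi-(2\pi-2\pi/N)\epsilon}{2\pi/N}>0$ if $|\theta|\le \pi/N$ and $g=\epsilon$ otherwise. Let $t^{(m)}_i$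 be the link power of BS $i$ of operator $m$. Let $\mathcal A_m$ be the set of the $K_m$ BSs of operator $m$ with the largest link powers, let $i_a$ be the strongest BS of operator $1$, and let $T_k$ be the $k$-th largest link power of operator $1$. Put $$I_m=\sum_{i\notin\mathcal A_m}P_mG(\theta^{(m)}_i)H^{(m)}_i t^{(m)}_i\in[0,\infty],\qquad \mathrm{SINR}=\frac{P_1\,pG\,H^{(1)}_{i_a}t^{(1)}_{i_a}}{\sigma^2+\sum_{m}I_m},$$ where $0<p\le 1$ is the relative beamforming gain (a number, not the function $p(\cdot)$), $\sigma^2=N_0\sum_mW_m$ and $N_0>0$. Let $$R_{\rm cov}(\gamma)=\mathbb P\Big[\big(\textstyle\sum_mW_m\big)\log_2(1+\mathrm{SINR})>\gamma\Big].$$ **Explicit functions.** For $t>0$ and $\lambda>0$ put $$\Lambda_{\rm L}(t)=2\pi\lambda\int_0^{(C_{\rm L}/t)^{1/\alpha_{\rm L}}}p(x)x\,dx,\qquad \Lambda_{\rm N}(t)=2\pi\lambda\int_0^{(C_{\rm N}/t)^{1/\alpha_{\rm N}}}(1-p(x))x\,dx,\qquad \Lambda=\Lambda_{\rm L}+\Lambda_{\rm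 N}.$$ For $K\ge 1$ let $$f_{T_K}(t)=e^{-\Lambda(t)}(-\Lambda'(t))\frac{\Lambda(t)^{K-1}}{(K-1)!}\qquad(t>0),$$ and for $K\ge 2$ let $$f_{T_1,T_K}(t_1,t_K)=\Lambda'(t_K)\Lambda'(t_1)\,e^{-\Lambda(t_K)}\frac{(\Lambda(t_K)-\Lambda(t_1))^{K-2}}{(K-2)!}\qquad(0<t_K<t_1);$$ both vanish elsewhere. Write $f^{(m)}$ and $f^{(m)}_{\rm Joint}$ for these functions with $\lambda=\lambda_m$, $K=K_m$. With $\lambda=\lambda_m$, $-\Lambda'(t)$ equals $$\ell_m(t)=\tfrac{2\pi\lambda_m}{\alpha_{\rm L}C_{\rm L}}\,p\big((\tfrac{C_{\rm L}}t)^{1/\alpha_{\rm L}}\big)(\tfrac{C_{\rm L}}t)^{\frac2{\alpha_{\rm L}}+1}+\tfrac{2\pi\lambda_m}{\alpha_{\rm N}C_{\rm N}}\Big(1-p\big((\tfrac{C_{\rm N}}t)^{1/\alpha_{\rm N}}\big)\Big)(\tfrac{C_{\rm N}}t)^{\frac2{\alpha_{\rm N}}+1}.$$ For $s>0$ and $T\in(0,\infty]$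 let $$\mathcal E_m(s,T)=\exp\Big(-\Big[\int_0^T\frac{sP_mGt}{1+sP_mGt}\,\frac{\ell_m(t)}N\,dt+\int_0^T\frac{sP_mgt}{1+sP_mgt}\Big(1-\frac1N\Big)\ell_m(t)\,dt\Big]\Big),$$ with $\exp(-\infty)=0$. Put $\mathcal L_{I_1|T_{K_1}}(s)=\mathcal E_1(s,T_{K_1})$. For $m\neq1$ put $\mathcal L_{I_m}(s)=\int_0^\infty\mathcal E_m(s,T)f^{(m)}(T)\,dT$ if $K_m\ge1$, and $\mathcal L_{I_m}(s)=\mathcal E_m(s,\infty)$ if $K_m=0$. **Theorem.** Let $\gamma>0$ and $\tilde\gamma=2^{\gamma/\sum_mW_m}-1$. 1. If $K_1>1$, then $(T_1,T_{K_1})$ has joint density $f^{(1)}_{\rm Joint}$ and $$R_{\rm cov}(\gamma)=\int_0^\infty\!\!\int_0^{T_1}e^{-\frac{\tilde\gamma\sigma^2}{P_1pGT_1}}\,\mathcal L_{I_1|T_{K_1}}\Big(\frac{\tilde\gamma}{P_1pGT_1}\Big)\prod_{m\ne1}\mathcal L_{I_m}\Big(\frac{\tilde\gamma}{P_1pGT_1}\Big)f^{(1)}_{\rm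 Joint}(T_1,T_{K_1})\,dT_{K_1}\,dT_1 .$$ 2. If $K_1=1$, then $T_1$ has density $f^{(1)}$ and $$R_{\rm cov}(\gamma)=\int_0^\infty e^{-\frac{\tilde\gamma\sigma^2}{P_1pGT_1}}\,\mathcal L_{I_1|T_1}\Big(\frac{\tilde\gamma}{P_1pGT_1}\Big)\prod_{m\ne1}\mathcal L_{I_m}\Big(\frac{\tilde\gamma}{P_1pGT_1}\Big)f^{(1)}(T_1)\,dT_1 .$$ 3. For every $s>0$, $\mathcal L_{I_1|T_{K_1}}(s)$ is the conditional Laplace transform of $I_1$, i.e. $\mathbb E[e^{-sI_1}\mid T_1,T_{K_1}]=\mathcal E_1(s,T_{K_1})$ almost surely; and for every $m\ne1$, $\mathbb E[e^{-sI_m}]=\mathcal L_{I_m}(s)$. -/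

import Mathlib

open MeasureTheory ProbabilityTheory Set
open scoped ENNReal NNReal Nat

namespace SpectrumSharing

/-- The plane `ℝ²` with the Euclidean norm and Lebesgue measure. -/
abbrev Plane : Type := EuclideanSpace ℝ (Fin 2)

/-- `exp (-x)` for `x ∈ [0, ∞]`, with `exp (-∞) = 0`. -/
noncomputable def expNeg (x : ℝ≥0∞) : ℝ≥0∞ := EReal.exp (-(x : EReal))

/-- Main-lobe gain `G = (2π - (2π - 2π/N) ε) / (2π/N)` of the sectored antenna model with `N`
antennas and side-lobe gain `ε`. -/
noncomputable def mainLobeGain (N : ℕ) (ε : ℝ) : ℝ :=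
  (2 * Real.pi - (2 * Real.pi - 2 * Real.pi / N) * ε) / (2 * Real.pi / N)

/-- Deterministic parameters of a network of `M` operators. Operator `1`, which serves the user, is the index
`0 : Fin M`. -/
structure Params (M : ℕ) [NeZero M] where
  /-- base station densities `λ_m` -/
  density : Fin M → ℝ
  /-- transmit powers `P_m` -/
  power : Fin M → ℝ
  /-- bandwidths `W_m` -/
  bandwidth : Fin M → ℝ
  /-- sizes `K_m` of the coordination sets -/
  K : Fin M → ℕ
  /-- average line-of-sight length `μ` -/
  μ : ℝ
  /-- path-loss intercept of line-of-sight links -/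
  CL : ℝ
  /-- path-loss intercept of non-line-of-sight links -/
  CN : ℝ
  /-- path-loss exponent of line-of-sight links -/
  αL : ℝ
  /-- path-loss exponent of non-line-of-sight links -/
  αN : ℝ
  /-- number of antennas of a base station -/
  N : ℕ
  /-- side-lobe gain `g = ε` -/
  ε : ℝ
  /-- relative beamforming gain `p` of the served user -/
  p : ℝ
  /-- noise spectral density `N₀` -/
  N₀ : ℝ
  density_pos : ∀ m, 0 < density m
  power_pos : ∀ m, 0 < power m
  bandwidth_pos : ∀ m, 0 < bandwidth m
  one_le_K : 1 ≤ K 0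
  μ_pos : 0 < μ
  CL_pos : 0 < CL
  CN_pos : 0 < CN
  αL_pos : 0 < αL
  αN_pos : 0 < αN
  one_le_N : 1 ≤ N
  ε_nonneg : 0 ≤ ε
  mainLobeGain_pos : 0 < mainLobeGain N ε
  p_pos : 0 < p
  p_le_one : p ≤ 1
  N₀_pos : 0 < N₀

namespace Params

variable {M : ℕ} [NeZero M] (a : Params M)

/-- The main-lobe gain `G`. -/
noncomputable def G : ℝ := mainLobeGain a.N a.ε

/-- The side-lobe gain `g`. -/
def g : ℝ := a.ε

/-- Probability that a link of length `r` is line-of-sight. -/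
noncomputable def losProb (r : ℝ) : ℝ := Real.exp (-r / a.μ)

/-- Path loss `C_s r ^ (-α_s)` of a link of length `r`; `true` means line-of-sight. -/
noncomputable def pathLoss (s : Bool) (r : ℝ) : ℝ :=
  if s then a.CL * r ^ (-a.αL) else a.CN * r ^ (-a.αN)

/-- Sectored antenna gain in direction `θ`, an angle in `(-π, π]` relative to the beam. -/
noncomputable def sectorGain (θ : ℝ) : ℝ := if |θ| ≤ Real.pi / a.N then a.G else a.g

/-- Total (shared) bandwidth. -/
noncomputable def totalBandwidth : ℝ := ∑ m, a.bandwidth m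

/-- Noise power `σ² = N₀ ∑ W_m`. -/
noncomputable def noisePower : ℝ := a.N₀ * a.totalBandwidth

/-- `γ̃ = 2 ^ (γ / ∑ W_m) - 1`. -/
noncomputable def sinrThreshold (γ : ℝ) : ℝ := (2 : ℝ) ^ (γ / a.totalBandwidth) - 1

/-! ### The explicit formulas -/

/-- `Λ_L(t)` for a network of density `lam`. -/
noncomputable def intensityL (lam t : ℝ) : ℝ :=
  2 * Real.pi * lam * ∫ x in (0 : ℝ)..(a.CL / t) ^ (1 / a.αL), a.losProb x * x

/-- `Λ_N(t)` for a network of density `lam`. -/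
noncomputable def intensityN (lam t : ℝ) : ℝ :=
  2 * Real.pi * lam * ∫ x in (0 : ℝ)..(a.CN / t) ^ (1 / a.αN), (1 - a.losProb x) * x

/-- The density `f_{T_K}` of the `K`-th strongest link power, for `1 ≤ K`. -/
noncomputable def kthPdf (lam : ℝ) (K : ℕ) (t : ℝ) : ℝ :=
  if 0 < t then
    Real.exp (-a.intensityL lam t) * Real.exp (-a.intensityN lam t) *
      (-deriv (a.intensityL lam) t - deriv (a.intensityN lam) t) *
      ((a.intensityL lam t + a.intensityN lam t) ^ (K - 1) / ((K - 1)! : ℝ))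
  else 0

/-- The joint density `f_{T_1, T_K}` of the strongest and the `K`-th strongest link powers, for
`2 ≤ K`. -/
noncomputable def jointPdf (lam : ℝ) (K : ℕ) (t₁ tK : ℝ) : ℝ :=
  if 0 < tK ∧ tK < t₁ then
    (deriv (a.intensityL lam) tK * deriv (a.intensityL lam) t₁ +
        deriv (a.intensityL lam) tK * deriv (a.intensityN lam) t₁ +
        deriv (a.intensityN lam) tK * deriv (a.intensityL lam) t₁ +
        deriv (a.intensityN lam) tK * deriv (a.intensityN lam) t₁) *
      (Real.exp (-a.intensityL lam tK) * Real.exp (-a.intensityN lam tK)) *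
      (((a.intensityL lam tK - a.intensityL lam t₁) +
          (a.intensityN lam tK - a.intensityN lam t₁)) ^ (K - 2) / ((K - 2)! : ℝ))
  else 0

/-- Density of the measure `-Λ^{(m)}(dt)` on `(0, ∞)`, where `Λ^{(m)}(t)`, decreasing in `t`, is
the mean number of base stations of operator `m` with link power above `t`. -/
noncomputable def linkDensity (m : Fin M) (t : ℝ) : ℝ :=
  2 * Real.pi * a.density m / (a.αL * a.CL) * a.losProb ((a.CL / t) ^ (1 / a.αL)) *
      (a.CL / t) ^ (2 / a.αL + 1) +
    2 * Real.pi * a.density m / (a.αN * a.CN) * (1 - a.losProb ((a.CN / t) ^ (1 / a.αN))) *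
      (a.CN / t) ^ (2 / a.αN + 1)

/-- Laplace transform at `s` of the interference from the base stations of operator `m` whose link
power lies in `R`. For `R = (0, T)` the exponent is the bracket
`∫_T^0 (s P G t / (1 + s P G t)) Λ̃(dt) + ∫_T^0 (s P g t / (1 + s P g t)) Λ̃̃(dt)` with
`Λ̃(dt) = (1 / N) Λ(dt)`, `Λ̃̃(dt) = (1 - 1 / N) Λ(dt)`: the sign of `Λ(dt)` is used to orient both
integrals from `0` to `T`. -/
noncomputable def regionLaplace (m : Fin M) (R : Set ℝ) (s : ℝ) : ℝ≥0∞ :=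
  expNeg
    ((∫⁻ t in R, ENNReal.ofReal (s * a.power m * a.G * t / (1 + s * a.power m * a.G * t) *
        (1 / a.N * a.linkDensity m t))) +
      ∫⁻ t in R, ENNReal.ofReal (s * a.power m * a.g * t / (1 + s * a.power m * a.g * t) *
        ((1 - 1 / a.N) * a.linkDensity m t)))

/-- The conditional Laplace transform `L_{I_1 | T_{K_1} = T}(s)`. -/
noncomputable def condLaplace (s T : ℝ) : ℝ≥0∞ := a.regionLaplace 0 (Ioo 0 T) s

/-- The Laplace transform `L_{I_m}(s)`. If operator `m` is not coordinated (`K_m = 0`), its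
interference comes from link powers in all of `(0, ∞)`. -/
noncomputable def laplace (m : Fin M) (s : ℝ) : ℝ≥0∞ :=
  if a.K m = 0 then a.regionLaplace m (Ioi 0) s
  else ∫⁻ T in Ioi (0 : ℝ),
    a.regionLaplace m (Ioo 0 T) s * ENNReal.ofReal (a.kthPdf (a.density m) (a.K m) T)

/-- The argument `γ̃ / (P_1 p G T)` of the Laplace transforms. -/
noncomputable def laplaceArg (γ T : ℝ) : ℝ :=
  a.sinrThreshold γ / (a.power 0 * (a.p * a.G) * T)

/-- The noise term, times the conditional Laplace transform of the interference of operator `1`,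
times the Laplace transforms of the interferences of the other operators. -/
noncomputable def integrand (γ T₁ TK : ℝ) : ℝ≥0∞ :=
  ENNReal.ofReal
      (Real.exp (-(a.sinrThreshold γ * a.noisePower / (a.power 0 * (a.p * a.G) * T₁)))) *
    a.condLaplace (a.laplaceArg γ T₁) TK *
    ∏ m ∈ Finset.univ.erase (0 : Fin M), a.laplace m (a.laplaceArg γ T₁)

end Params

/-! ### The random network -/

/-- `X 0, X 1, …` enumerate a homogeneous Poisson point process of density `lam` in the plane: the
numbers of points in finitely many disjoint bounded Borel sets are independent Poisson variables
with means `lam` times the areas. -/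
structure IsPoissonProcess {Ω : Type*} [MeasurableSpace Ω] (X : ℕ → Ω → Plane) (lam : ℝ)
    (Pr : Measure Ω) : Prop where
  measurable : ∀ i, Measurable (X i)
  counts : ∀ (n : ℕ) (B : Fin n → Set Plane), (∀ j, MeasurableSet (B j)) →
    (∀ j, Bornology.IsBounded (B j)) → Pairwise (fun j j' => Disjoint (B j) (B j')) →
    ∀ k : Fin n → ℕ,
      Pr {ω | ∀ j, {i : ℕ | X i ω ∈ B j}.encard = (k j : ℕ∞)} =
        ∏ j, poissonMeasure (lam.toNNReal * (volume (B j)).toNNReal) {k j}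

/-- The random quantities of the network: positions `d_i^{(m)}`, link states (`true` is
line-of-sight) of the links to the user at the origin, fading powers `H_i^{(m)} = |β_i^{(m)}|²`
and angles of departure `θ_i^{(m)}` relative to the beam of the base station. -/
structure Network {M : ℕ} [NeZero M] (a : Params M) {Ω : Type*} [MeasurableSpace Ω]
    (Pr : Measure Ω) where
  pos : Fin M → ℕ → Ω → Plane
  los : Fin M → ℕ → Ω → Bool
  fading : Fin M → ℕ → Ω → ℝ
  angle : Fin M → ℕ → Ω → ℝ
  poisson : ∀ m, IsPoissonProcess (pos m) (a.density m) Pr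
  los_measurable : ∀ m i, Measurable (los m i)
  fading_measurable : ∀ m i, Measurable (fading m i)
  angle_measurable : ∀ m i, Measurable (angle m i)
  /-- Given all positions of operator `m`, its links are independently line-of-sight, a link of
  length `r` with probability `losProb r`. -/
  los_law : ∀ (m : Fin M) (B : Set (ℕ → Plane)), MeasurableSet B → ∀ S : Finset ℕ,
    Pr {ω | (fun i => pos m i ω) ∈ B ∧ ∀ i ∈ S, los m i ω = true} =
      ∫⁻ ω in {ω | (fun i => pos m i ω) ∈ B},
        ∏ i ∈ S, ENNReal.ofReal (a.losProb ‖pos m i ω‖) ∂Pr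
  /-- Rayleigh fading. -/
  fading_law : ∀ m i, HasLaw (fading m i) (expMeasure 1) Pr
  angle_law : ∀ m i, HasLaw (angle m i) (cond volume (Ioc (-Real.pi) Real.pi)) Pr
  fading_indep : ∀ m, iIndepFun (fading m) Pr
  angle_indep : ∀ m, iIndepFun (angle m) Pr
  fading_angle_indep : ∀ m,
    IndepFun (fun ω i => fading m i ω) (fun ω i => angle m i ω) Pr
  marks_indep : ∀ m,
    IndepFun (fun ω => ((fun i => pos m i ω), (fun i => los m i ω)))
      (fun ω => ((fun i => fading m i ω), (fun i => angle m i ω))) Pr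
  /-- Different operators are independent. -/
  operators_indep :
    iIndepFun (fun m ω => ((fun i => pos m i ω), (fun i => los m i ω),
      (fun i => fading m i ω), (fun i => angle m i ω))) Pr

/-- `A` consists of `k` indices with the largest values of `x`. -/
def IsStrongestSet (x : ℕ → ℝ) (k : ℕ) (A : Finset ℕ) : Prop :=
  A.card = k ∧ ∀ i ∈ A, ∀ j ∉ A, x j ≤ x i

/-- A set of `k` indices with the largest values of `x` (for the link powers of an operator, such a
set almost surely exists and is unique). -/
noncomputable def strongestSet (x : ℕ → ℝ) (k : ℕ) : Finset ℕ :=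
  Classical.epsilon (IsStrongestSet x k)

/-- The index of a largest value of `x`. -/
noncomputable def argmax (x : ℕ → ℝ) : ℕ := Classical.epsilon fun i => ∀ j, x j ≤ x i

/-- The `k`-th largest value of `x`, for `1 ≤ k`. -/
noncomputable def kthLargest (x : ℕ → ℝ) (k : ℕ) : ℝ := sInf (x '' (strongestSet x k : Set ℕ))

namespace Network

variable {M : ℕ} [NeZero M] {a : Params M} {Ω : Type*} [MeasurableSpace Ω] {Pr : Measure Ω}
  (net : Network a Pr)

/-- Link powers `C_s ‖d_i^{(m)}‖ ^ (-α_s)`. -/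
noncomputable def linkPower (m : Fin M) (ω : Ω) (i : ℕ) : ℝ :=
  a.pathLoss (net.los m i ω) ‖net.pos m i ω‖

/-- The coordination set `𝓐_m`. -/
noncomputable def coordinationSet (m : Fin M) (ω : Ω) : Finset ℕ :=
  strongestSet (net.linkPower m ω) (a.K m)

/-- The index `i_a` of the base station of operator `1` that serves the user. -/
noncomputable def servingBS (ω : Ω) : ℕ := argmax (net.linkPower 0 ω)

/-- The `k`-th strongest link power `T_k` of operator `1`. -/
noncomputable def T (k : ℕ) (ω : Ω) : ℝ := kthLargest (net.linkPower 0 ω) k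

/-- The interference `I_m` of operator `m`, from all its base stations outside `𝓐_m`. -/
noncomputable def interference (m : Fin M) (ω : Ω) : ℝ≥0∞ :=
  ∑' i : {i : ℕ // i ∉ net.coordinationSet m ω}, ENNReal.ofReal
    (a.power m * a.sectorGain (net.angle m i ω) * net.fading m i ω * net.linkPower m ω i)

/-- The instantaneous SINR of the user (zero if the interference is infinite). -/
noncomputable def sinr (ω : Ω) : ℝ≥0∞ :=
  ENNReal.ofReal (a.power 0 * (a.p * a.G) * net.fading 0 (net.servingBS ω) ω *
      net.linkPower 0 ω (net.servingBS ω)) /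
    (ENNReal.ofReal a.noisePower + ∑ m, net.interference m ω)

/-- The rate coverage probability at threshold `γ`. The SINR is finite as the noise is positive. -/
noncomputable def rateCoverage (γ : ℝ) : ℝ≥0∞ :=
  Pr {ω | γ < a.totalBandwidth * Real.logb 2 (1 + (net.sinr ω).toReal)}

end Network

end SpectrumSharing

/-!
Everything is computed through Laplace functionals `E exp (-∑ᵢ f (tᵢ))` of the link powers `tᵢ`,
for measurable `f` with values in `[0, ∞]`; with `expNeg ∞ = 0`, infinite interference needs no
separate treatment.

*The link powers are a Poisson process.* The joint law of the counts of the base stations in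
disjoint bounded sets determines the Laplace functional of their positions
(`IsPoissonProcess.hasPoissonLaplace`). Independent line-of-sight marks preserve its form
(`HasIndependentMarks.hasPoissonLaplace`), and polar coordinates followed by the substitution
`r = (C / t) ^ (1 / α)` identify the intensity measure of the link powers: it has density
`linkDensity` on `(0, ∞)` and tail `Λ` (`Network.linkPower_hasPoissonLaplace`, `Params.hasTail`).

*Ordering the points.* A power series with nonnegative coefficients is determined by its values on
`(0, 1)`. Hence the Laplace functional yields that the counts in disjoint sets are Poisson variables
independent of each other and of the points elsewhere (`HasPoissonLaplace.setLIntegral_counts`). So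
the points are almost surely distinct with finitely many above each positive level, that is, they
can be listed in decreasing order. The event that the `K`-th largest point exceeds `y` is the event
that at least `K` points lie in `(y, ∞)`, and the fundamental theorem of calculus turns the
resulting Poisson probabilities into the densities of `T_K` and of `(T₁, T_K)`
(`HasPoissonLaplace.map_orderedTerm`, `HasPoissonLaplace.map_orderedTerm_pair`). When `T_K` is
replaced by the dyadic number just below it, the same independence splits the expectation over the
countably many values of that number. In the limit, the points below `T_K` are, given `(T₁, T_K)`,
a Poisson process with the original intensity restricted to `(0, T_K)`
(`HasPoissonLaplace.lintegral_below`).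

*Interference.* Given the links, averaging over the fading powers and angles replaces the
interference in the exponent by a sum over the link powers (`Network.lintegral_expNeg_marks`), so
that the two preceding facts give the conditional and unconditional Laplace transforms of the
interference (`Network.lintegral_interf_of_coordinated`, `Network.lintegral_interf`). In the
coverage probability the argument of the transform depends on `T₁`; approximating it by functions
with countably many values reduces this to constant arguments (`Network.lintegral_interf_comp`).

*Coverage.* The serving base station belongs to the coordination set, as `K₁ ≥ 1`. Its fading power
is therefore independent of the interference, and being exponential it exceeds an independent `Z`
with probability `E exp (-Z)` (`Network.lintegral_signal_gt`). Here `Z` is a multiple of the noise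
plus the interferences, which are independent over the operators (`Network.lintegral_otherInterf`).
What remains is an expectation over `(T₁, T_K)` (`Network.rateCoverage_eq_lintegral`), which is
integrated against the law found above.

The functions `strongestSet`, `kthLargest` and `argmax` involve choice and need not be
measurable. All computations use the measurable functions `orderedTerm`, `Params.interf` and
`Params.signal`, defined through the numbers of stronger links, which agree with them almost surely.
-/

namespace SpectrumSharing

open Filter Topology

/-! ### The function `exp (-x)` on `[0, ∞]` -/

@[simp] lemma expNeg_zero : expNeg 0 = 1 := by simp [expNeg]

@[simp] lemma expNeg_top : expNeg ∞ = 0 := by simp [expNeg]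

lemma expNeg_ofReal {x : ℝ} (hx : 0 ≤ x) :
    expNeg (ENNReal.ofReal x) = ENNReal.ofReal (Real.exp (-x)) := by
  rw [expNeg, EReal.coe_ennreal_ofReal, max_eq_left hx, ← EReal.coe_neg, EReal.exp_coe]

lemma expNeg_coe (x : ℝ≥0) : expNeg x = ENNReal.ofReal (Real.exp (-x)) := by
  rw [← ENNReal.ofReal_coe_nnreal, expNeg_ofReal (NNReal.coe_nonneg x)]

lemma expNeg_add (x y : ℝ≥0∞) : expNeg (x + y) = expNeg x * expNeg y := by
  rw [expNeg, expNeg, expNeg, ← EReal.exp_add, EReal.coe_ennreal_add, EReal.neg_add, sub_eq_add_neg]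
  · left; simp
  · right; simp

lemma expNeg_antitone : Antitone expNeg := fun x y h => by
  rw [expNeg, expNeg, EReal.exp_le_exp_iff, EReal.neg_le_neg_iff]
  exact_mod_cast h

lemma expNeg_le_one (x : ℝ≥0∞) : expNeg x ≤ 1 := by
  rw [← expNeg_zero]; exact expNeg_antitone bot_le

lemma expNeg_ne_top (x : ℝ≥0∞) : expNeg x ≠ ∞ :=
  ((expNeg_le_one x).trans_lt ENNReal.one_lt_top).ne

lemma continuous_expNeg : Continuous expNeg :=
  ENNReal.continuous_exp.comp (continuous_neg.comp continuous_coe_ennreal_ereal)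

lemma measurable_expNeg : Measurable expNeg := continuous_expNeg.measurable

@[fun_prop] lemma measurable_expNeg_comp {α : Type*} [MeasurableSpace α] {f : α → ℝ≥0∞}
    (hf : Measurable f) : Measurable fun x => expNeg (f x) := measurable_expNeg.comp hf

lemma expNeg_sum {ι : Type*} (s : Finset ι) (f : ι → ℝ≥0∞) :
    expNeg (∑ i ∈ s, f i) = ∏ i ∈ s, expNeg (f i) := by
  classical
  induction s using Finset.induction_on with
  | empty => simp
  | insert i s hi ih => rw [Finset.sum_insert hi, Finset.prod_insert hi, expNeg_add, ih]

lemma expNeg_mul_natCast (c : ℝ≥0∞) (k : ℕ) : expNeg (c * k) = expNeg c ^ k := by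
  rw [← nsmul_eq_mul', ← Finset.card_range k, ← Finset.sum_const, expNeg_sum]
  simp

/-- `-log y`, the inverse of `expNeg` on `[0, 1]`. -/
noncomputable def negLog (y : ℝ≥0∞) : ℝ≥0∞ := (-ENNReal.log y).toENNReal

lemma measurable_negLog : Measurable negLog := by
  unfold negLog
  exact (continuous_neg.measurable.comp ENNReal.measurable_log).ereal_toENNReal

lemma expNeg_negLog {y : ℝ≥0∞} (hy : y ≤ 1) : expNeg (negLog y) = y := by
  have h : 0 ≤ -ENNReal.log y := by
    rw [EReal.neg_nonneg]
    simpa using ENNReal.log_monotone hy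
  rw [expNeg, negLog, EReal.coe_toENNReal h, neg_neg, ENNReal.exp_log]

lemma tendsto_expNeg_sum_range (f : ℕ → ℝ≥0∞) :
    Tendsto (fun n => ∏ i ∈ Finset.range n, expNeg (f i)) atTop (𝓝 (expNeg (∑' i, f i))) := by
  simp_rw [← expNeg_sum]
  exact (continuous_expNeg.tendsto _).comp ENNReal.summable.hasSum.tendsto_sum_nat

/-- The expectation of an infinite product is the limit of the expectations of the finite ones. -/
lemma tendsto_lintegral_prod_expNeg {Ω : Type*} [MeasurableSpace Ω] (μ : Measure Ω)
    [IsFiniteMeasure μ] {f : ℕ → Ω → ℝ≥0∞} (hf : ∀ i, Measurable (f i)) :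
    Tendsto (fun n => ∫⁻ ω, ∏ i ∈ Finset.range n, expNeg (f i ω) ∂μ) atTop
      (𝓝 (∫⁻ ω, expNeg (∑' i, f i ω) ∂μ)) := by
  refine tendsto_lintegral_of_dominated_convergence (fun _ => 1) (fun n => ?_) (fun n => ?_) ?_ ?_
  · exact Finset.measurable_fun_prod _ fun i _ => measurable_expNeg.comp (hf i)
  · exact ae_of_all _ fun ω => Finset.prod_le_one' fun i _ => expNeg_le_one _
  · simp
  · exact ae_of_all _ fun ω => tendsto_expNeg_sum_range _

/-- If the finite products have expectations `∏ cᵢ`, the infinite product has `exp (-∑ -log cᵢ)`. -/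
lemma lintegral_expNeg_tsum_of_prod {Ω : Type*} [MeasurableSpace Ω] (μ : Measure Ω)
    [IsFiniteMeasure μ] {f : ℕ → Ω → ℝ≥0∞} (hf : ∀ i, Measurable (f i)) {c : ℕ → ℝ≥0∞}
    (hc : ∀ i, c i ≤ 1)
    (h : ∀ n, ∫⁻ ω, ∏ i ∈ Finset.range n, expNeg (f i ω) ∂μ = ∏ i ∈ Finset.range n, c i) :
    ∫⁻ ω, expNeg (∑' i, f i ω) ∂μ = expNeg (∑' i, negLog (c i)) := by
  refine tendsto_nhds_unique (tendsto_lintegral_prod_expNeg μ hf) ?_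
  simp_rw [h]
  convert tendsto_expNeg_sum_range (fun i => negLog (c i)) using 4 with n i
  exact (expNeg_negLog (hc _)).symm

/-! ### Counting the terms of a sequence in a set -/

/-- The number of indices `i` with `x i ∈ B`. -/
noncomputable def cnt {S : Type*} (x : ℕ → S) (B : Set S) : ℝ≥0∞ := ∑' i, B.indicator 1 (x i)

lemma cnt_eq_encard {S : Type*} (x : ℕ → S) (B : Set S) :
    cnt x B = ({i | x i ∈ B}.encard : ℝ≥0∞) := by
  rw [← ENNReal.tsum_set_one, tsum_subtype {i | x i ∈ B} (fun _ => (1 : ℝ≥0∞))]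
  rfl

lemma measurable_cnt {α S : Type*} [MeasurableSpace α] [MeasurableSpace S] {x : ℕ → α → S}
    (hx : ∀ i, Measurable (x i)) {B : Set S} (hB : MeasurableSet B) :
    Measurable fun ω => cnt (fun i => x i ω) B :=
  Measurable.tsum fun i => (measurable_one.indicator hB).comp (hx i)

lemma cnt_eq_natCast {S : Type*} (x : ℕ → S) (B : Set S) (k : ℕ) :
    cnt x B = k ↔ {i | x i ∈ B}.encard = k := by
  rw [cnt_eq_encard, ← ENat.toENNReal_coe, ENat.toENNReal_inj]

lemma cnt_mono {S : Type*} (x : ℕ → S) {B C : Set S} (h : B ⊆ C) : cnt x B ≤ cnt x C :=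
  ENNReal.tsum_le_tsum fun _ => indicator_le_indicator_of_subset h (fun _ => zero_le) _

lemma cnt_union {S : Type*} (x : ℕ → S) {B C : Set S} (h : Disjoint B C) :
    cnt x (B ∪ C) = cnt x B + cnt x C := by
  rw [cnt, cnt, cnt, ← ENNReal.tsum_add]
  exact tsum_congr fun i => by rw [indicator_union_of_disjoint h]

lemma cnt_eq_top_or_natCast {S : Type*} (x : ℕ → S) (B : Set S) :
    cnt x B = ∞ ∨ ∃ k : ℕ, cnt x B = k := by
  rw [cnt_eq_encard]
  rcases eq_or_ne {i | x i ∈ B}.encard ⊤ with h | h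
  · left; simp [h]
  · right
    obtain ⟨k, hk⟩ := ENat.ne_top_iff_exists.1 h
    exact ⟨k, by rw [← hk]; simp⟩

/-! ### Ordering the terms of a sequence by size -/

/-- The sequences whose terms can be listed in decreasing order: distinct positive terms, finitely
many above each positive level. Almost every realization of the link powers is of this kind. -/
def DecreasinglyOrderable (x : ℕ → ℝ) : Prop :=
  (∀ i, 0 < x i) ∧ Function.Injective x ∧ ∀ n : ℕ, cnt x (Ioi (1 / ((n : ℝ) + 1))) ≠ ∞

namespace DecreasinglyOrderable

variable {x : ℕ → ℝ} (hx : DecreasinglyOrderable x)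
include hx

lemma finite_above {d : ℝ} (hd : 0 < d) : {i | x i ∈ Ioi d}.Finite := by
  obtain ⟨n, hn⟩ := exists_nat_one_div_lt hd
  have h := hx.2.2 n
  rw [cnt_eq_encard, Ne, ENat.toENNReal_eq_top, Set.encard_eq_top_iff, Set.not_infinite] at h
  exact h.subset fun i hi => lt_trans hn hi

lemma cnt_ne_top {d : ℝ} (hd : 0 < d) : cnt x (Ioi d) ≠ ∞ := by
  rw [cnt_eq_encard, Ne, ENat.toENNReal_eq_top, Set.encard_eq_top_iff, Set.not_infinite]
  exact hx.finite_above hd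

lemma exists_isStrongestSet (K : ℕ) : ∃ A, IsStrongestSet x K A := by
  classical
  induction K with
  | zero => exact ⟨∅, rfl, by simp⟩
  | succ K ih =>
    obtain ⟨A, hA, hA'⟩ := ih
    obtain ⟨j₀, hj₀⟩ := Infinite.exists_notMem_finset A
    have hfin : {j | j ∉ A ∧ x j₀ ≤ x j}.Finite :=
      (hx.finite_above (half_pos (hx.1 j₀))).subset fun j hj =>
        (half_lt_self (hx.1 j₀)).trans_le hj.2
    obtain ⟨b, hb, hbmax⟩ := hfin.exists_maximalFor x _ ⟨j₀, hj₀, le_rfl⟩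
    have hb' : ∀ j ∉ A, x j ≤ x b := fun j hj => by
      by_contra! h
      exact absurd (hbmax ⟨hj, hb.2.trans h.le⟩ h.le) (not_le.2 h)
    refine ⟨insert b A, by rw [Finset.card_insert_of_notMem hb.1, hA], fun i hi j hj => ?_⟩
    rw [Finset.mem_insert, not_or] at hj
    rcases Finset.mem_insert.1 hi with rfl | hi
    · exact hb' j hj.2
    · exact hA' i hi j hj.2

lemma isStrongestSet (K : ℕ) : IsStrongestSet x K (strongestSet x K) :=
  Classical.epsilon_spec (hx.exists_isStrongestSet K)

lemma card_strongestSet (K : ℕ) : (strongestSet x K).card = K := (hx.isStrongestSet K).1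

lemma lt_of_mem_of_notMem {K i j : ℕ} (hi : i ∈ strongestSet x K) (hj : j ∉ strongestSet x K) :
    x j < x i :=
  ((hx.isStrongestSet K).2 i hi j hj).lt_of_ne fun h => hj (hx.2.1 h ▸ hi)

/-- A term belongs to the `K` strongest ones if fewer than `K` terms exceed it. Unlike the choice of
`strongestSet`, this criterion is measurable. -/
lemma mem_strongestSet {K i : ℕ} : i ∈ strongestSet x K ↔ cnt x (Ioi (x i)) < K := by
  classical
  have hcard := hx.card_strongestSet K
  rw [cnt_eq_encard, ← ENat.toENNReal_coe, ENat.toENNReal_lt]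
  constructor
  · intro hi
    have hsub : {j | x j ∈ Ioi (x i)} ⊆ ((strongestSet x K).erase i : Set ℕ) := fun j hj => by
      rw [Finset.mem_coe, Finset.mem_erase]
      refine ⟨fun h => (lt_irrefl _ (h ▸ hj : x i < x i)), ?_⟩
      by_contra h
      exact absurd (hx.lt_of_mem_of_notMem hi h) (not_lt.2 (le_of_lt hj))
    refine (Set.encard_le_encard hsub).trans_lt ?_
    rw [Set.encard_coe_eq_coe_finsetCard, Finset.card_erase_of_mem hi, hcard]
    have := Finset.card_pos.2 ⟨i, hi⟩
    exact_mod_cast (by omega : K - 1 < K)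
  · intro h
    by_contra hi
    have hsub : (strongestSet x K : Set ℕ) ⊆ {j | x j ∈ Ioi (x i)} := fun j hj =>
      hx.lt_of_mem_of_notMem hj hi
    have := Set.encard_le_encard hsub
    rw [Set.encard_coe_eq_coe_finsetCard, hcard] at this
    exact absurd h (not_lt.2 this)

lemma exists_eq_kthLargest {K : ℕ} (hK : 1 ≤ K) :
    ∃ i ∈ strongestSet x K, x i = kthLargest x K ∧ ∀ j ∈ strongestSet x K, x i ≤ x j := by
  have hne : (strongestSet x K).Nonempty := by
    rw [← Finset.card_pos, hx.card_strongestSet]; exact hK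
  obtain ⟨i, hi, hmin⟩ := Finset.exists_min_image _ x hne
  refine ⟨i, hi, ?_, hmin⟩
  refine (IsLeast.csInf_eq (s := x '' (strongestSet x K : Set ℕ)) ⟨⟨i, hi, rfl⟩, ?_⟩).symm
  rintro _ ⟨j, hj, rfl⟩
  exact hmin j hj

lemma kthLargest_pos {K : ℕ} (hK : 1 ≤ K) : 0 < kthLargest x K := by
  obtain ⟨i, -, hi, -⟩ := hx.exists_eq_kthLargest hK
  exact hi ▸ hx.1 i

/-- Passage from order statistics to counts. -/
lemma lt_kthLargest_iff {K : ℕ} (hK : 1 ≤ K) {d : ℝ} :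
    d < kthLargest x K ↔ (K : ℝ≥0∞) ≤ cnt x (Ioi d) := by
  obtain ⟨i, hiA, hi, hmin⟩ := hx.exists_eq_kthLargest hK
  constructor
  · intro h
    have hsub : (strongestSet x K : Set ℕ) ⊆ {j | x j ∈ Ioi d} := fun j hj =>
      (hi ▸ h).trans_le (hmin j hj)
    have := Set.encard_le_encard hsub
    rw [Set.encard_coe_eq_coe_finsetCard, hx.card_strongestSet] at this
    rw [cnt_eq_encard]
    exact_mod_cast this
  · intro h
    by_contra! hd
    have h1 := hx.mem_strongestSet.1 hiA
    exact absurd (h.trans (cnt_mono x (Ioi_subset_Ioi (hi ▸ hd)))) (not_le.2 h1)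

lemma le_argmax (j : ℕ) : x j ≤ x (argmax x) := by
  have h : ∃ i, ∀ j, x j ≤ x i := by
    obtain ⟨i, hi, -, hmin⟩ := hx.exists_eq_kthLargest le_rfl
    obtain ⟨a, ha⟩ := Finset.card_eq_one.1 (hx.card_strongestSet 1)
    refine ⟨i, fun j => ?_⟩
    by_cases hj : j ∈ strongestSet x 1
    · rw [ha, Finset.mem_singleton] at hi hj
      rw [hi, hj]
    · exact (hx.lt_of_mem_of_notMem hi hj).le
  exact Classical.epsilon_spec (p := fun i => ∀ j, x j ≤ x i) h j

lemma cnt_Ioi_eq_zero_iff {i : ℕ} : cnt x (Ioi (x i)) = 0 ↔ i = argmax x := by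
  rw [cnt, ENNReal.tsum_eq_zero]
  constructor
  · intro h
    by_contra hne
    have h1 := h (argmax x)
    have h2 : x i < x (argmax x) := (hx.le_argmax i).lt_of_ne fun h => hne (hx.2.1 h)
    simp [h2] at h1
  · rintro rfl j
    simp [hx.le_argmax j]

lemma argmax_mem_strongestSet {K : ℕ} (hK : 1 ≤ K) : argmax x ∈ strongestSet x K := by
  rw [hx.mem_strongestSet, hx.cnt_Ioi_eq_zero_iff.2 rfl]
  exact_mod_cast hK

lemma kthLargest_one : kthLargest x 1 = x (argmax x) := by
  obtain ⟨i, hi, hix, -⟩ := hx.exists_eq_kthLargest le_rfl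
  obtain ⟨a, ha⟩ := Finset.card_eq_one.1 (hx.card_strongestSet 1)
  have h := hx.argmax_mem_strongestSet le_rfl
  rw [ha, Finset.mem_singleton] at hi h
  rw [← hix, hi, h]

lemma kthLargest_le_one {K : ℕ} (hK : 1 ≤ K) : kthLargest x K ≤ kthLargest x 1 := by
  obtain ⟨i, -, hix, -⟩ := hx.exists_eq_kthLargest hK
  rw [← hix, hx.kthLargest_one]
  exact hx.le_argmax i

end DecreasinglyOrderable

lemma measurable_cnt_Ioi_self (i : ℕ) : Measurable fun x : ℕ → ℝ => cnt x (Ioi (x i)) := by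
  refine Measurable.tsum fun j => ?_
  have : (fun x : ℕ → ℝ => (Ioi (x i)).indicator (1 : ℝ → ℝ≥0∞) (x j)) =
      {x : ℕ → ℝ | x i < x j}.indicator 1 := by
    ext x; simp [indicator_apply]
  rw [this]
  exact measurable_one.indicator (measurableSet_lt (measurable_pi_apply i) (measurable_pi_apply j))

lemma measurable_cnt_apply {B : Set ℝ} (hB : MeasurableSet B) :
    Measurable fun x : ℕ → ℝ => cnt x B := measurable_cnt (fun i => measurable_pi_apply i) hB

lemma measurableSet_decreasinglyOrderable : MeasurableSet {x | DecreasinglyOrderable x} := by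
  have h : {x | DecreasinglyOrderable x} = (⋂ i, {x : ℕ → ℝ | 0 < x i}) ∩
      ((⋂ i, ⋂ j, {x | x i = x j → i = j}) ∩
        ⋂ n : ℕ, {x : ℕ → ℝ | cnt x (Ioi (1 / ((n : ℝ) + 1))) ≠ ∞}) := by
    ext x
    simp [DecreasinglyOrderable, Function.Injective]
  rw [h]
  refine (MeasurableSet.iInter fun i => measurableSet_lt measurable_const
    (measurable_pi_apply i)).inter ((MeasurableSet.iInter fun i => MeasurableSet.iInter fun j =>
      ?_).inter (MeasurableSet.iInter fun n => ?_))
  · by_cases h : i = j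
    · simp [h]
    · have := (measurableSet_eq_fun (f := fun x : ℕ → ℝ => x i) (g := fun x => x j)
        (by fun_prop) (by fun_prop)).compl
      simp only [h, imp_false]
      exact this
  · exact (measurableSet_eq_fun (measurable_cnt_apply measurableSet_Ioi) measurable_const).compl

/-- The `K`-th largest term, set to zero where the terms cannot be listed in decreasing order, so
as to be measurable. -/
noncomputable def orderedTerm (K : ℕ) : (ℕ → ℝ) → ℝ :=
  {x | DecreasinglyOrderable x}.indicator fun x => kthLargest x K

lemma DecreasinglyOrderable.orderedTerm_eq {x : ℕ → ℝ} (hx : DecreasinglyOrderable x) (K : ℕ) :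
    orderedTerm K x = kthLargest x K := indicator_of_mem (s := {x | DecreasinglyOrderable x}) hx _

lemma measurable_orderedTerm {K : ℕ} (hK : 1 ≤ K) : Measurable (orderedTerm K) := by
  refine measurable_of_Ioi fun d => ?_
  have : orderedTerm K ⁻¹' Ioi d =
      ({x | DecreasinglyOrderable x} ∩ {x | (K : ℝ≥0∞) ≤ cnt x (Ioi d)}) ∪
        ({x | DecreasinglyOrderable x}ᶜ ∩ {_x | d < 0}) := by
    ext x
    by_cases hx : DecreasinglyOrderable x
    · simp [hx, hx.orderedTerm_eq, hx.lt_kthLargest_iff hK]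
    · simp [hx, orderedTerm]
  rw [this]
  exact (measurableSet_decreasinglyOrderable.inter (measurableSet_le measurable_const
    (measurable_cnt_apply measurableSet_Ioi))).union
    (measurableSet_decreasinglyOrderable.compl.inter (MeasurableSet.const _))

/-! ### The Laplace functional of a Poisson process -/

/-- The random points `Y 0, Y 1, …` have the Laplace functional of a Poisson point process with
intensity measure `ν`. -/
structure HasPoissonLaplace {Ω S : Type*} [MeasurableSpace Ω] [MeasurableSpace S]
    (Y : ℕ → Ω → S) (ν : Measure S) (Pr : Measure Ω) : Prop where
  measurable : ∀ i, Measurable (Y i)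
  laplace : ∀ f : S → ℝ≥0∞, Measurable f →
    ∫⁻ ω, expNeg (∑' i, f (Y i ω)) ∂Pr = expNeg (∫⁻ s, (1 - expNeg (f s)) ∂ν)

/-- The Laplace transform of the Poisson distribution. -/
lemma lintegral_expNeg_poissonMeasure (r : ℝ≥0) (c : ℝ≥0∞) :
    ∫⁻ k : ℕ, expNeg (c * k) ∂poissonMeasure r = expNeg ((1 - expNeg c) * r) := by
  obtain ⟨z, hz⟩ : ∃ z : ℝ≥0, expNeg c = z := ⟨_, (ENNReal.coe_toNNReal (expNeg_ne_top c)).symm⟩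
  have hz1 : z ≤ 1 := by exact_mod_cast hz ▸ expNeg_le_one c
  have hpow : ∀ k : ℕ, expNeg (c * k) = (z : ℝ≥0∞) ^ k := fun k => by
    rw [expNeg_mul_natCast, hz]
  rw [lintegral_countable']
  have hterm : ∀ k : ℕ, expNeg (c * k) * poissonMeasure r {k} =
      ENNReal.ofReal (Real.exp (-r) * ((r * z : ℝ) ^ k / (k)!)) := fun k => by
    rw [hpow, poissonMeasure_singleton, ← ENNReal.ofReal_coe_nnreal,
      ← ENNReal.ofReal_pow (NNReal.coe_nonneg z),
      ← ENNReal.ofReal_mul (by positivity)]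
    congr 1
    rw [mul_pow]; ring
  simp_rw [hterm]
  have hs : HasSum (fun k : ℕ => Real.exp (-r) * ((r * z : ℝ) ^ k / (k)!))
      (Real.exp (-r) * Real.exp (r * z)) := by
    rw [Real.exp_eq_exp_ℝ]
    exact (NormedSpace.expSeries_div_hasSum_exp (r * z : ℝ)).mul_left _
  rw [← ENNReal.ofReal_tsum_of_nonneg (fun k => by positivity) hs.summable, hs.tsum_eq, hz,
    ← ENNReal.coe_one, ← ENNReal.coe_sub, ← ENNReal.coe_mul, expNeg_coe, ← Real.exp_add]
  push_cast [NNReal.coe_sub hz1]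
  congr 2; ring

namespace IsPoissonProcess

variable {Ω : Type*} [MeasurableSpace Ω] {X : ℕ → Ω → Plane} {lam : ℝ} {Pr : Measure Ω}

/-- The Laplace functional on step functions. The defining property of the process only concerns
finite counts; as their probabilities add up to one, the counts are almost surely finite. -/
lemma lintegral_expNeg_counts [IsProbabilityMeasure Pr] (hX : IsPoissonProcess X lam Pr)
    {n : ℕ} (B : Fin n → Set Plane) (hB : ∀ j, MeasurableSet (B j))
    (hbd : ∀ j, Bornology.IsBounded (B j)) (hdisj : Pairwise fun j j' => Disjoint (B j) (B j'))
    (c : Fin n → ℝ≥0∞) :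
    ∫⁻ ω, expNeg (∑ j, c j * cnt (fun i => X i ω) (B j)) ∂Pr =
      expNeg (∑ j, (1 - expNeg (c j)) * (ENNReal.ofReal lam * volume (B j))) := by
  set π := Measure.pi fun j => poissonMeasure (lam.toNNReal * (volume (B j)).toNNReal) with hπ
  set N : Ω → Fin n → ℝ≥0∞ := fun ω j => cnt (fun i => X i ω) (B j) with hN
  set V : Ω → Fin n → ℕ := fun ω j => ⌊(N ω j).toReal⌋₊ with hV
  have hNm : ∀ j, Measurable fun ω => N ω j := fun j => measurable_cnt hX.measurable (hB j)
  have hVm : Measurable V := measurable_pi_lambda _ fun j => (hNm j).ennreal_toReal.nat_floor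
  have hE : ∀ k : Fin n → ℕ, Pr {ω | ∀ j, N ω j = k j} = π {k} := fun k => by
    rw [hπ, Measure.pi_singleton, ← hX.counts n B hB hbd hdisj k]
    simp only [hN, cnt_eq_natCast]
  have hEm : ∀ k : Fin n → ℕ, MeasurableSet {ω | ∀ j, N ω j = k j} := fun k => by
    rw [ofPred_forall]
    exact MeasurableSet.iInter fun j => measurableSet_eq_fun (hNm j) measurable_const
  have hfin : ∀ᵐ ω ∂Pr, ∀ j, N ω j = V ω j := by
    have hU : MeasurableSet (⋃ k : Fin n → ℕ, {ω | ∀ j, N ω j = k j}) := MeasurableSet.iUnion hEm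
    have h1 : Pr (⋃ k : Fin n → ℕ, {ω | ∀ j, N ω j = k j}) = 1 := by
      rw [measure_iUnion _ hEm]
      · simp_rw [hE]
        have := lintegral_countable' (μ := π) fun _ => 1
        simpa using this.symm
      · intro k k' hkk'
        refine disjoint_left.2 fun ω h h' => hkk' (funext fun j => ?_)
        exact_mod_cast (h j).symm.trans (h' j)
    have h2 := (prob_compl_eq_zero_iff hU).2 h1
    filter_upwards [compl_mem_ae_iff.2 h2] with ω hω j
    rw [compl_compl, mem_iUnion] at hω
    obtain ⟨k, hk⟩ := hω
    simp [hV, hk j]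
  have hmap : Pr.map V = π := by
    refine Measure.ext_of_singleton fun k => ?_
    rw [Measure.map_apply hVm (measurableSet_singleton k), ← hE k]
    refine measure_congr ?_
    filter_upwards [hfin] with ω hω
    refine propext ⟨fun h j => ?_, fun h => ?_⟩
    · rw [hω j, show V ω = k from h]
    · refine funext fun j => ?_
      exact_mod_cast (hω j).symm.trans (h j)
  calc ∫⁻ ω, expNeg (∑ j, c j * N ω j) ∂Pr
      = ∫⁻ ω, ∏ j, expNeg (c j * (V ω j : ℝ≥0∞)) ∂Pr := by
        refine lintegral_congr_ae ?_
        filter_upwards [hfin] with ω hω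
        simp_rw [expNeg_sum, hω]
    _ = ∫⁻ k : Fin n → ℕ, ∏ j, expNeg (c j * (k j : ℝ≥0∞)) ∂π := by
        rw [← hmap, lintegral_map (.of_discrete) hVm]
    _ = ∏ j, ∫⁻ k : Fin n → ℕ, expNeg (c j * (k j : ℝ≥0∞)) ∂π :=
        lintegral_prod_eq_prod_lintegral_of_indepFun Finset.univ _
          (iIndepFun_pi (X := fun j (k : ℕ) => expNeg (c j * (k : ℝ≥0∞)))
            fun j => Measurable.of_discrete.aemeasurable) fun j => .of_discrete
    _ = ∏ j, expNeg ((1 - expNeg (c j)) * (ENNReal.ofReal lam * volume (B j))) := by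
        refine Finset.prod_congr rfl fun j _ => ?_
        rw [(measurePreserving_eval (fun j =>
            poissonMeasure (lam.toNNReal * (volume (B j)).toNNReal)) j).lintegral_comp
            (f := fun k : ℕ => expNeg (c j * (k : ℝ≥0∞))) .of_discrete,
          lintegral_expNeg_poissonMeasure, ENNReal.coe_mul,
          ENNReal.coe_toNNReal (hbd j).measure_lt_top.ne]
        rfl
    _ = _ := (expNeg_sum _ _).symm

end IsPoissonProcess

/-- Monotone limits pass through the sum over the points. -/
lemma tendsto_expNeg_tsum_of_monotone {g : ℕ → ℕ → ℝ≥0∞} {f : ℕ → ℝ≥0∞}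
    (hg : ∀ i, Monotone fun n => g n i) (h : ∀ i, Tendsto (fun n => g n i) atTop (𝓝 (f i))) :
    Tendsto (fun n => expNeg (∑' i, g n i)) atTop (𝓝 (expNeg (∑' i, f i))) := by
  refine (continuous_expNeg.tendsto _).comp ?_
  simp_rw [← lintegral_count]
  exact lintegral_tendsto_of_tendsto_of_monotone (fun n => Measurable.of_discrete.aemeasurable)
    (ae_of_all _ hg) (ae_of_all _ h)

/-- The identity of the Laplace functional passes to monotone limits of the test function. -/
lemma laplace_of_monotone_limit {Ω S : Type*} [MeasurableSpace Ω] [MeasurableSpace S]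
    {Y : ℕ → Ω → S} {ν : Measure S} {Pr : Measure Ω} [IsProbabilityMeasure Pr]
    (hY : ∀ i, Measurable (Y i)) {g : ℕ → S → ℝ≥0∞} {f : S → ℝ≥0∞} (hgm : ∀ n, Measurable (g n))
    (hg : ∀ s, Monotone fun n => g n s) (h : ∀ s, Tendsto (fun n => g n s) atTop (𝓝 (f s)))
    (hl : ∀ n, ∫⁻ ω, expNeg (∑' i, g n (Y i ω)) ∂Pr = expNeg (∫⁻ s, (1 - expNeg (g n s)) ∂ν)) :
    ∫⁻ ω, expNeg (∑' i, f (Y i ω)) ∂Pr = expNeg (∫⁻ s, (1 - expNeg (f s)) ∂ν) := by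
  have h1 : Tendsto (fun n => ∫⁻ ω, expNeg (∑' i, g n (Y i ω)) ∂Pr) atTop
      (𝓝 (∫⁻ ω, expNeg (∑' i, f (Y i ω)) ∂Pr)) := by
    refine tendsto_lintegral_of_dominated_convergence (fun _ => 1) (fun n => ?_) (fun n => ?_) ?_ ?_
    · exact measurable_expNeg.comp (Measurable.tsum fun i => (hgm n).comp (hY i))
    · exact ae_of_all _ fun ω => expNeg_le_one _
    · simp
    · exact ae_of_all _ fun ω => tendsto_expNeg_tsum_of_monotone (fun i => hg _) fun i => h _
  refine tendsto_nhds_unique h1 ?_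
  simp_rw [hl]
  refine (continuous_expNeg.tendsto _).comp ?_
  refine lintegral_tendsto_of_tendsto_of_monotone
    (fun n => (measurable_const.sub (measurable_expNeg.comp (hgm n))).aemeasurable)
    (ae_of_all _ fun s n m hnm => tsub_le_tsub_left (expNeg_antitone (hg s hnm)) _)
    (ae_of_all _ fun s => ?_)
  exact ENNReal.Tendsto.sub tendsto_const_nhds ((continuous_expNeg.tendsto _).comp (h s))
    (Or.inl ENNReal.one_ne_top)

/-- The Laplace functional of a Poisson process, from the joint law of its counts. -/
theorem IsPoissonProcess.hasPoissonLaplace {Ω : Type*} [MeasurableSpace Ω] {X : ℕ → Ω → Plane}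
    {lam : ℝ} {Pr : Measure Ω} [IsProbabilityMeasure Pr] (hX : IsPoissonProcess X lam Pr) :
    HasPoissonLaplace X (ENNReal.ofReal lam • volume) Pr := by
  classical
  refine ⟨hX.measurable, fun f hf => ?_⟩
  set g : ℕ → Plane → ℝ≥0∞ := fun n =>
    (Metric.ball 0 (n : ℝ)).indicator (SimpleFunc.eapprox f n) with hg
  refine laplace_of_monotone_limit (g := g) hX.measurable
    (fun n => (SimpleFunc.measurable _).indicator measurableSet_ball) (fun s n m hnm => ?_)
    (fun s => ?_) (fun n => ?_)
  · exact (indicator_le_indicator_of_subset (Metric.ball_subset_ball (by exact_mod_cast hnm))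
      (fun _ => zero_le) s).trans (indicator_le_indicator (SimpleFunc.monotone_eapprox f hnm s))
  · refine (SimpleFunc.tendsto_eapprox hf s).congr' ?_
    obtain ⟨n₀, hn₀⟩ := exists_nat_gt ‖s‖
    filter_upwards [eventually_ge_atTop n₀] with n hn
    have hs : s ∈ Metric.ball (0 : Plane) (n : ℝ) :=
      mem_ball_zero_iff.2 (hn₀.trans_le (by exact_mod_cast hn))
    exact (indicator_of_mem hs _).symm
  · set s := SimpleFunc.eapprox f n with hs
    set e := s.range.equivFin with he
    set B : Fin s.range.card → Set Plane := fun j =>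
      s ⁻¹' {((e.symm j : s.range) : ℝ≥0∞)} ∩ Metric.ball 0 (n : ℝ) with hB
    have hBm : ∀ j, MeasurableSet (B j) := fun j =>
      (s.measurableSet_preimage _).inter measurableSet_ball
    -- a function of `g n` that vanishes at zero is a step function on the sets `B j`
    have key : ∀ (F : ℝ≥0∞ → ℝ≥0∞), F 0 = 0 → ∀ x,
        F (g n x) = ∑ j, F (e.symm j : s.range) * (B j).indicator 1 x := fun F hF x => by
      by_cases hx : x ∈ Metric.ball (0 : Plane) (n : ℝ)
      · rw [Finset.sum_eq_single (e ⟨s x, s.mem_range_self x⟩)]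
        · simp [hg, hB, hx, ← hs]
        · intro j _ hj
          rw [indicator_of_notMem, mul_zero]
          rintro ⟨h, -⟩
          refine hj (e.symm_apply_eq.1 (Subtype.ext ?_))
          exact h.symm
        · simp
      · simp [hg, hB, hx, hF]
    have h1 : ∀ ω, ∑' i, g n (X i ω) =
        ∑ j, ((e.symm j : s.range) : ℝ≥0∞) * cnt (fun i => X i ω) (B j) := fun ω => by
      simp_rw [cnt, ← ENNReal.tsum_mul_left]
      rw [← Summable.tsum_finsetSum fun _ _ => ENNReal.summable]
      exact tsum_congr fun i => key id rfl _
    have h2 : ∫⁻ x, (1 - expNeg (g n x)) ∂(ENNReal.ofReal lam • volume : Measure Plane) =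
        ∑ j, (1 - expNeg ((e.symm j : s.range) : ℝ≥0∞)) *
          (ENNReal.ofReal lam * volume (B j)) := by
      have := key (fun y => 1 - expNeg y) (by simp)
      simp_rw [this]
      rw [lintegral_finsetSum' _ fun j _ =>
        ((measurable_one.indicator (hBm j)).const_mul _).aemeasurable]
      refine Finset.sum_congr rfl fun j _ => ?_
      rw [lintegral_const_mul _ (measurable_one.indicator (hBm j)), lintegral_indicator_one (hBm j),
        Measure.smul_apply, smul_eq_mul]
    simp_rw [h1]
    rw [h2]
    refine hX.lintegral_expNeg_counts B hBm
      (fun j => Metric.isBounded_ball.subset inter_subset_right)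
      (fun j j' hjj' => disjoint_left.2 fun x hx hx' => hjj' ?_) _
    apply e.symm.injective
    exact Subtype.ext (hx.1.symm.trans hx'.1)

/-! ### Independent two-valued marks -/

section Marking

variable {Ω E : Type*} [MeasurableSpace Ω] [MeasurableSpace E] {Pr : Measure Ω}
  {X : ℕ → Ω → E} {L : ℕ → Ω → Bool} {q : E → ℝ≥0∞}

/-- Given the points `X`, the marks `L` are independent, the mark of a point at `x` being `true`
with probability `q x`. -/
structure HasIndependentMarks (X : ℕ → Ω → E) (L : ℕ → Ω → Bool) (q : E → ℝ≥0∞)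
    (Pr : Measure Ω) : Prop where
  measurable_point : ∀ i, Measurable (X i)
  measurable_mark : ∀ i, Measurable (L i)
  measurable_prob : Measurable q
  prob_le_one : ∀ x, q x ≤ 1
  law : ∀ B : Set (ℕ → E), MeasurableSet B → ∀ S : Finset ℕ,
    Pr {ω | (fun i => X i ω) ∈ B ∧ ∀ i ∈ S, L i ω = true} =
      ∫⁻ ω in {ω | (fun i => X i ω) ∈ B}, ∏ i ∈ S, q (X i ω) ∂Pr

namespace HasIndependentMarks

variable (h : HasIndependentMarks X L q Pr)
include h

lemma measurable_points : Measurable fun ω i => X i ω :=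
  measurable_pi_lambda _ h.measurable_point

lemma measurableSet_pattern (S S' : Finset ℕ) :
    MeasurableSet {ω | (∀ i ∈ S, L i ω = true) ∧ ∀ i ∈ S', L i ω = false} := by
  have : {ω | (∀ i ∈ S, L i ω = true) ∧ ∀ i ∈ S', L i ω = false} =
      (⋂ i ∈ S, {ω | L i ω = true}) ∩ ⋂ i ∈ S', {ω | L i ω = false} := by
    ext ω; simp
  rw [this]
  exact (Finset.measurableSet_biInter _ fun i _ => h.measurable_mark i
    (measurableSet_singleton _)).inter
    (Finset.measurableSet_biInter _ fun i _ => h.measurable_mark i (measurableSet_singleton _))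

/-- The law of the points on the event that the marks on `S` are `true` and those on `S'` are
`false`. -/
lemma measure_pattern [IsFiniteMeasure Pr] {B : Set (ℕ → E)} (hB : MeasurableSet B)
    (S' : Finset ℕ) :
    ∀ S : Finset ℕ, Disjoint S S' →
    Pr {ω | (fun i => X i ω) ∈ B ∧ (∀ i ∈ S, L i ω = true) ∧ ∀ i ∈ S', L i ω = false} =
      ∫⁻ ω in {ω | (fun i => X i ω) ∈ B},
        (∏ i ∈ S, q (X i ω)) * ∏ i ∈ S', (1 - q (X i ω)) ∂Pr := by
  classical
  have hqX : ∀ i, Measurable fun ω => q (X i ω) := fun i =>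
    h.measurable_prob.comp (h.measurable_point i)
  induction S' using Finset.induction_on with
  | empty => intro S _; simpa using h.law B hB S
  | insert a S' ha ih =>
    intro S hS
    rw [Finset.disjoint_insert_right] at hS
    have hB' : MeasurableSet {ω | (fun i => X i ω) ∈ B} := h.measurable_points hB
    have h1 := ih S hS.2
    have h2 := ih (insert a S) (Finset.disjoint_insert_left.2 ⟨ha, hS.2⟩)
    have hfin : Pr {ω | (fun i => X i ω) ∈ B ∧ (∀ i ∈ insert a S, L i ω = true) ∧
        ∀ i ∈ S', L i ω = false} ≠ ∞ := measure_ne_top _ _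
    refine (ENNReal.add_left_inj hfin).1 ?_
    trans Pr {ω | (fun i => X i ω) ∈ B ∧ (∀ i ∈ S, L i ω = true) ∧ ∀ i ∈ S', L i ω = false}
    · rw [← measure_union]
      · congr 1
        ext ω
        simp only [Finset.mem_insert, forall_eq_or_imp, mem_union, mem_ofPred_eq]
        cases hL : L a ω <;> simp
      · refine disjoint_left.2 fun ω hω hω' => ?_
        have e1 := hω.2.2 a (Finset.mem_insert_self _ _)
        have e2 := hω'.2.1 a (Finset.mem_insert_self _ _)
        rw [e1] at e2
        exact absurd e2 (by simp)
      · exact hB'.inter (h.measurableSet_pattern _ _)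
    · rw [h1, h2, ← lintegral_add_left]
      · refine lintegral_congr fun ω => ?_
        rw [Finset.prod_insert ha, Finset.prod_insert hS.1]
        have : (1 - q (X a ω)) + q (X a ω) = 1 := tsub_add_cancel_of_le (h.prob_le_one _)
        calc _ = (∏ i ∈ S, q (X i ω)) * (∏ i ∈ S', (1 - q (X i ω))) *
              ((1 - q (X a ω)) + q (X a ω)) := by rw [this, mul_one]
          _ = _ := by ring
      · exact (Finset.measurable_fun_prod _ fun i _ => hqX i).mul
          (Finset.measurable_fun_prod _ fun i _ => measurable_const.sub (hqX i))

lemma setLIntegral_pattern [IsFiniteMeasure Pr] {F : (ℕ → E) → ℝ≥0∞} (hF : Measurable F)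
    {S S' : Finset ℕ}
    (hS : Disjoint S S') :
    ∫⁻ ω in {ω | (∀ i ∈ S, L i ω = true) ∧ ∀ i ∈ S', L i ω = false}, F (fun i => X i ω) ∂Pr =
      ∫⁻ ω, ((∏ i ∈ S, q (X i ω)) * ∏ i ∈ S', (1 - q (X i ω))) * F (fun i => X i ω) ∂Pr := by
  have hqX : ∀ i, Measurable fun ω => q (X i ω) := fun i =>
    h.measurable_prob.comp (h.measurable_point i)
  have hw : Measurable fun ω => (∏ i ∈ S, q (X i ω)) * ∏ i ∈ S', (1 - q (X i ω)) :=
    (Finset.measurable_fun_prod _ fun i _ => hqX i).mul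
      (Finset.measurable_fun_prod _ fun i _ => measurable_const.sub (hqX i))
  have hm : Measure.map (fun ω i => X i ω)
        (Pr.restrict {ω | (∀ i ∈ S, L i ω = true) ∧ ∀ i ∈ S', L i ω = false}) =
      Measure.map (fun ω i => X i ω)
        (Pr.withDensity fun ω => (∏ i ∈ S, q (X i ω)) * ∏ i ∈ S', (1 - q (X i ω))) := by
    ext B hB
    rw [Measure.map_apply h.measurable_points hB, Measure.map_apply h.measurable_points hB,
      withDensity_apply _ (h.measurable_points hB),
      Measure.restrict_apply (h.measurable_points hB)]
    exact h.measure_pattern hB S' S hS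
  rw [← lintegral_map hF h.measurable_points, hm, lintegral_map hF h.measurable_points,
    lintegral_withDensity_eq_lintegral_mul _ hw
      (g := fun ω => F fun i => X i ω) (hF.comp h.measurable_points)]
  rfl

/-- Conditional expectation of a product over the marked points, given the points. -/
lemma lintegral_prod [IsFiniteMeasure Pr] {F : E → Bool → ℝ≥0∞}
    (hF : ∀ l, Measurable fun x => F x l) (S : Finset ℕ) :
    ∫⁻ ω, ∏ i ∈ S, F (X i ω) (L i ω) ∂Pr =
      ∫⁻ ω, ∏ i ∈ S, (q (X i ω) * F (X i ω) true + (1 - q (X i ω)) * F (X i ω) false) ∂Pr := by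
  classical
  have hqX : ∀ i, Measurable fun ω => q (X i ω) := fun i =>
    h.measurable_prob.comp (h.measurable_point i)
  have hFX : ∀ i l, Measurable fun ω => F (X i ω) l := fun i l =>
    (hF l).comp (h.measurable_point i)
  have hFp : ∀ A : Finset ℕ, Measurable fun x : ℕ → E =>
      (∏ i ∈ A, F (x i) true) * ∏ i ∈ S \ A, F (x i) false := fun A =>
    (Finset.measurable_fun_prod _ fun i _ => (hF _).comp (measurable_pi_apply i)).mul
      (Finset.measurable_fun_prod _ fun i _ => (hF _).comp (measurable_pi_apply i))
  have e1 : ∀ ω, ∏ i ∈ S, F (X i ω) (L i ω) = ∑ A ∈ S.powerset,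
      {ω | (∀ i ∈ A, L i ω = true) ∧ ∀ i ∈ S \ A, L i ω = false}.indicator
        (fun ω => (∏ i ∈ A, F (X i ω) true) * ∏ i ∈ S \ A, F (X i ω) false) ω := fun ω => by
    have : ∀ i, F (X i ω) (L i ω) = (if L i ω = true then F (X i ω) true else 0) +
        (if L i ω = false then F (X i ω) false else 0) := fun i => by
      cases hL : L i ω <;> simp
    simp_rw [this, Finset.prod_add]
    refine Finset.sum_congr rfl fun A _ => ?_
    by_cases hA : (∀ i ∈ A, L i ω = true) ∧ ∀ i ∈ S \ A, L i ω = false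
    · rw [indicator_of_mem (by exact hA)]
      congr 1
      · exact Finset.prod_congr rfl fun i hi => if_pos (hA.1 i hi)
      · exact Finset.prod_congr rfl fun i hi => if_pos (hA.2 i hi)
    · rw [indicator_of_notMem (by exact hA)]
      rw [not_and_or] at hA
      rcases hA with hA | hA
      · push Not at hA
        obtain ⟨i, hi, hi'⟩ := hA
        rw [Finset.prod_eq_zero hi (if_neg hi'), zero_mul]
      · push Not at hA
        obtain ⟨i, hi, hi'⟩ := hA
        rw [mul_comm, Finset.prod_eq_zero hi (if_neg hi'), zero_mul]
  simp_rw [e1, Finset.prod_add]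
  rw [lintegral_finsetSum, lintegral_finsetSum]
  · refine Finset.sum_congr rfl fun A _ => ?_
    rw [lintegral_indicator (h.measurableSet_pattern _ _)]
    refine (h.setLIntegral_pattern (hFp A) Finset.disjoint_sdiff).trans
      (lintegral_congr fun ω => ?_)
    rw [Finset.prod_mul_distrib, Finset.prod_mul_distrib]
    ring
  · exact fun A _ => (Finset.measurable_fun_prod _ fun i _ => (hqX i).mul (hFX i _)).mul
      (Finset.measurable_fun_prod _ fun i _ => (measurable_const.sub (hqX i)).mul (hFX i _))
  · exact fun A _ => ((hFp A).comp h.measurable_points).indicator (h.measurableSet_pattern _ _)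

/-- Marking theorem: images `τ x l` of the independently marked points of a Poisson process. -/
theorem hasPoissonLaplace [IsFiniteMeasure Pr] {ν : Measure E} (hX : HasPoissonLaplace X ν Pr)
    {S : Type*}
    [MeasurableSpace S] {τ : Bool → E → S} (hτ : ∀ l, Measurable (τ l)) :
    HasPoissonLaplace (fun i ω => τ (L i ω) (X i ω))
      ((ν.withDensity q).map (τ true) + (ν.withDensity fun x => 1 - q x).map (τ false)) Pr := by
  have hm : ∀ i, Measurable fun ω => τ (L i ω) (X i ω) := fun i => by
    have : Measurable fun p : Bool × E => τ p.1 p.2 := measurable_from_prod_countable_right hτ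
    exact this.comp ((h.measurable_mark i).prodMk (h.measurable_point i))
  refine ⟨hm, fun f hf => ?_⟩
  set F : E → Bool → ℝ≥0∞ := fun x l => expNeg (f (τ l x)) with hFdef
  have hF : ∀ l, Measurable fun x => F x l := fun l => measurable_expNeg.comp (hf.comp (hτ l))
  set c : E → ℝ≥0∞ := fun x => q x * F x true + (1 - q x) * F x false with hc
  have hcm : Measurable c := (h.measurable_prob.mul (hF _)).add
    ((measurable_const.sub h.measurable_prob).mul (hF _))
  have hc1 : ∀ x, 1 - c x = q x * (1 - F x true) + (1 - q x) * (1 - F x false) ∧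
      c x ≤ 1 := fun x => by
    have hsum : c x + (q x * (1 - F x true) + (1 - q x) * (1 - F x false)) = 1 := by
      have e1 : F x true + (1 - F x true) = 1 := add_tsub_cancel_of_le (expNeg_le_one _)
      have e2 : F x false + (1 - F x false) = 1 := add_tsub_cancel_of_le (expNeg_le_one _)
      have e3 : q x + (1 - q x) = 1 := add_tsub_cancel_of_le (h.prob_le_one x)
      calc _ = q x * (F x true + (1 - F x true)) + (1 - q x) * (F x false + (1 - F x false)) := by
            rw [hc]; ring
        _ = 1 := by rw [e1, e2, mul_one, mul_one, e3]
    have hle : c x ≤ 1 := hsum ▸ le_self_add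
    refine ⟨?_, hle⟩
    exact ENNReal.sub_eq_of_eq_add_rev (hle.trans_lt ENNReal.one_lt_top).ne hsum.symm
  have e1 : ∫⁻ ω, expNeg (∑' i, f (τ (L i ω) (X i ω))) ∂Pr =
      ∫⁻ ω, expNeg (∑' i, negLog (c (X i ω))) ∂Pr := by
    refine tendsto_nhds_unique (tendsto_lintegral_prod_expNeg Pr fun i => hf.comp (hm i)) ?_
    refine (tendsto_lintegral_prod_expNeg Pr fun i =>
      (measurable_negLog.comp hcm).comp (h.measurable_point i)).congr fun n => ?_
    refine Eq.trans (lintegral_congr fun ω => Finset.prod_congr rfl fun i _ => ?_)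
      (h.lintegral_prod hF (Finset.range n)).symm
    exact expNeg_negLog (hc1 _).2
  rw [e1, hX.laplace (fun x => negLog (c x)) (measurable_negLog.comp hcm)]
  have hfm : ∀ l, Measurable fun x => 1 - expNeg (f (τ l x)) := fun l =>
    measurable_const.sub (hF l)
  have hfm' : Measurable fun s => 1 - expNeg (f s) :=
    measurable_const.sub (measurable_expNeg.comp hf)
  rw [lintegral_add_measure, lintegral_map hfm' (hτ _), lintegral_map hfm' (hτ _),
    lintegral_withDensity_eq_lintegral_mul _ h.measurable_prob (hfm true),
    lintegral_withDensity_eq_lintegral_mul _ (f := fun x => 1 - q x)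
      (measurable_const.sub h.measurable_prob)
      (hfm false), ← lintegral_add_left (h.measurable_prob.mul (hfm true))]
  congr 1
  refine lintegral_congr fun x => ?_
  rw [expNeg_negLog (hc1 x).2, (hc1 x).1]
  rfl

end HasIndependentMarks

end Marking

/-! ### The intensity of the link powers -/

/-- Polar coordinates for radial functions. -/
lemma lintegral_comp_norm_plane {G : ℝ → ℝ≥0∞} (hG : Measurable G) :
    ∫⁻ x : Plane, G ‖x‖ =
      ENNReal.ofReal (2 * Real.pi) * ∫⁻ r in Ioi (0 : ℝ), ENNReal.ofReal r * G r := by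
  have h1 : ∫⁻ x : Plane, G ‖x‖ = ∫⁻ z : ℂ, G ‖z‖ := by
    rw [← (Complex.orthonormalBasisOneI.measurePreserving_repr).lintegral_comp
      (f := fun x : Plane => G ‖x‖) (hG.comp measurable_norm)]
    exact lintegral_congr fun z => by rw [LinearIsometryEquiv.norm_map]
  rw [h1, ← Complex.lintegral_comp_polarCoord_symm]
  have h2 : ∫⁻ p in polarCoord.target, ENNReal.ofReal p.1 • G ‖Complex.polarCoord.symm p‖ =
      ∫⁻ p in Ioi (0 : ℝ) ×ˢ Ioo (-Real.pi) Real.pi, ENNReal.ofReal p.1 * G p.1 := by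
    rw [polarCoord_target]
    refine setLIntegral_congr_fun (measurableSet_Ioi.prod measurableSet_Ioo) fun p hp => ?_
    rw [Complex.norm_polarCoord_symm, abs_of_pos hp.1, smul_eq_mul]
  have hm : Measurable fun r : ℝ => ENNReal.ofReal r * G r := ENNReal.measurable_ofReal.mul hG
  rw [h2, Measure.volume_eq_prod, ← Measure.prod_restrict,
    lintegral_prod (fun p : ℝ × ℝ => ENNReal.ofReal p.1 * G p.1)
      (hm.comp measurable_fst).aemeasurable]
  simp only [lintegral_const, Measure.restrict_apply_univ, Real.volume_Ioo]
  rw [lintegral_mul_const _ hm, mul_comm]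
  congr 2; ring

/-- The length of a link of power `t`, for the path loss `C * r ^ (-α)`. -/
noncomputable def linkLength (C α t : ℝ) : ℝ := (C / t) ^ (1 / α)

/-- The mean number of points with link power above `t`, for the path loss `C * r ^ (-α)` and
points of density `lam * w r` at distance `r`. -/
noncomputable def radialIntensity (w : ℝ → ℝ) (lam C α t : ℝ) : ℝ :=
  2 * Real.pi * lam * ∫ x in (0 : ℝ)..linkLength C α t, w x * x

/-- The density of link powers, for the path loss `C * r ^ (-α)` and points of density `lam * w r`
at distance `r`. -/
noncomputable def radialDensity (w : ℝ → ℝ) (lam C α t : ℝ) : ℝ :=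
  2 * Real.pi * lam / (α * C) * w (linkLength C α t) * (C / t) ^ (2 / α + 1)

section Radial

variable {w : ℝ → ℝ} {lam C α : ℝ}

lemma linkLength_pos (hC : 0 < C) {t : ℝ} (ht : 0 < t) : 0 < linkLength C α t :=
  Real.rpow_pos_of_pos (div_pos hC ht) _

lemma hasDerivAt_linkLength (hC : 0 < C) {t : ℝ} (ht : 0 < t) :
    HasDerivAt (linkLength C α) (-(1 / (α * C) * (C / t) ^ (1 / α + 1))) t := by
  have h1 : HasDerivAt (fun t => C / t) (-C / t ^ 2) t := by
    convert! (hasDerivAt_const t C).div (hasDerivAt_id t) ht.ne' using 1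
    simp
  convert! h1.rpow_const (p := 1 / α) (Or.inl (div_pos hC ht).ne') using 1
  rw [show 1 / α + 1 = (1 / α - 1) + 2 by ring, Real.rpow_add (div_pos hC ht)]
  rw [show (2 : ℝ) = ((2 : ℕ) : ℝ) by norm_num, Real.rpow_natCast]
  by_cases hα : α = 0
  · simp [hα]
  · field_simp

lemma pathLoss_linkLength (hC : 0 < C) (hα : 0 < α) {t : ℝ} (ht : 0 < t) :
    C * linkLength C α t ^ (-α) = t := by
  rw [linkLength, ← Real.rpow_mul (div_pos hC ht).le,
    show 1 / α * -α = -1 by field_simp, Real.rpow_neg_one, inv_div]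
  field_simp

lemma linkLength_pathLoss (hC : 0 < C) (hα : 0 < α) {r : ℝ} (hr : 0 < r) :
    linkLength C α (C * r ^ (-α)) = r := by
  rw [linkLength, Real.rpow_neg hr.le, ← div_eq_mul_inv, div_div_cancel₀ hC.ne',
    ← Real.rpow_mul hr.le, mul_one_div_cancel hα.ne', Real.rpow_one]

lemma antitoneOn_linkLength (hC : 0 < C) (hα : 0 < α) : AntitoneOn (linkLength C α) (Ioi 0) :=
  fun s hs t ht hst => Real.rpow_le_rpow (div_pos hC ht).le
    (div_le_div_of_nonneg_left hC.le hs hst) (by positivity)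

lemma linkLength_image (hC : 0 < C) (hα : 0 < α) : linkLength C α '' Ioi 0 = Ioi 0 := by
  ext r
  constructor
  · rintro ⟨t, ht, rfl⟩
    exact linkLength_pos hC ht
  · exact fun hr => ⟨C * r ^ (-α), mul_pos hC (Real.rpow_pos_of_pos hr _),
      linkLength_pathLoss hC hα hr⟩

lemma lt_pathLoss_iff (hC : 0 < C) (hα : 0 < α) {t r : ℝ} (ht : 0 < t) (hr : 0 < r) :
    t < C * r ^ (-α) ↔ r < linkLength C α t := by
  have hp : 0 < C * r ^ (-α) := mul_pos hC (Real.rpow_pos_of_pos hr _)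
  constructor
  · intro h
    refine lt_of_le_of_ne ?_ ?_
    · rw [← linkLength_pathLoss hC hα hr]
      exact antitoneOn_linkLength hC hα ht hp h.le
    · intro h'
      rw [h', pathLoss_linkLength hC hα ht] at h
      exact lt_irrefl _ h
  · intro h
    by_contra! h'
    have := antitoneOn_linkLength hC hα hp ht h'
    rw [linkLength_pathLoss hC hα hr] at this
    exact absurd h (not_lt.2 this)

lemma radialDensity_nonneg (hw : ∀ r, 0 ≤ r → 0 ≤ w r) (hlam : 0 < lam) (hC : 0 < C) (hα : 0 < α)
    {t : ℝ} (ht : 0 < t) : 0 ≤ radialDensity w lam C α t := by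
  have h1 := hw _ (linkLength_pos (α := α) hC ht).le
  have h2 := Real.rpow_pos_of_pos (div_pos hC ht) (2 / α + 1)
  unfold radialDensity
  have := Real.pi_pos
  positivity

lemma continuousOn_radialDensity (hw : Continuous w) (hC : 0 < C) :
    ContinuousOn (radialDensity w lam C α) (Ioi 0) := by
  have h1 : ContinuousOn (fun t => C / t) (Ioi 0) :=
    continuousOn_const.div continuousOn_id fun t ht => ne_of_gt ht
  have h2 : ∀ p : ℝ, ContinuousOn (fun t => (C / t) ^ p) (Ioi 0) := fun p =>
    h1.rpow_const fun t ht => Or.inl (div_pos hC ht).ne'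
  exact (continuousOn_const.mul (hw.comp_continuousOn (h2 _))).mul (h2 _)

/-- Leibniz rule for the variable endpoint `linkLength C α t`. -/
lemma hasDerivAt_radialIntensity (hw : Continuous w) (hC : 0 < C) {t : ℝ} (ht : 0 < t) :
    HasDerivAt (radialIntensity w lam C α) (-radialDensity w lam C α t) t := by
  have hc : Continuous fun x => w x * x := hw.mul continuous_id
  have h1 := (intervalIntegral.integral_hasDerivAt_right (hc.intervalIntegrable 0 _)
    (hc.stronglyMeasurableAtFilter _ _) hc.continuousAt).comp t
    (hasDerivAt_linkLength (α := α) hC ht)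
  convert! h1.const_mul (2 * Real.pi * lam) using 1
  have h2 : (C / t) ^ (2 / α + 1) = linkLength C α t * (C / t) ^ (1 / α + 1) := by
    rw [linkLength, ← Real.rpow_add (div_pos hC ht)]
    congr 1; ring
  rw [radialDensity, h2]
  ring

/-- Integrals over the plane of functions of the path loss, in terms of the density of the link
powers. -/
lemma lintegral_pathLoss (hw : Measurable w) (hw0 : ∀ r, 0 ≤ r → 0 ≤ w r) (hlam : 0 < lam)
    (hC : 0 < C) (hα : 0 < α) {H : ℝ → ℝ≥0∞} (hH : Measurable H) :
    ENNReal.ofReal lam * ∫⁻ x : Plane, ENNReal.ofReal (w ‖x‖) * H (C * ‖x‖ ^ (-α)) =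
      ∫⁻ t in Ioi 0, ENNReal.ofReal (radialDensity w lam C α t) * H t := by
  have hG : Measurable fun r : ℝ => ENNReal.ofReal (w r) * H (C * r ^ (-α)) := by fun_prop
  rw [lintegral_comp_norm_plane hG, ← mul_assoc, ← ENNReal.ofReal_mul hlam.le,
    ← lintegral_const_mul _ (by fun_prop)]
  conv_lhs => rw [← linkLength_image hC hα]
  rw [lintegral_image_eq_lintegral_deriv_mul_of_antitoneOn measurableSet_Ioi
    (fun t ht => (hasDerivAt_linkLength hC ht).hasDerivWithinAt) (antitoneOn_linkLength hC hα)]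
  refine setLIntegral_congr_fun measurableSet_Ioi fun t ht => ?_
  have hl := linkLength_pos (α := α) hC ht
  have hw' := hw0 _ hl.le
  have h1 := Real.rpow_pos_of_pos (div_pos hC ht) (1 / α + 1)
  have hpi := Real.pi_pos
  rw [neg_neg, pathLoss_linkLength hC hα ht, ← mul_assoc, ← mul_assoc, ← mul_assoc,
    ← ENNReal.ofReal_mul (by positivity), ← ENNReal.ofReal_mul (by positivity),
    ← ENNReal.ofReal_mul (by positivity)]
  congr 2
  have h2 : (C / t) ^ (2 / α + 1) = linkLength C α t * (C / t) ^ (1 / α + 1) := by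
    rw [linkLength, ← Real.rpow_add (div_pos hC ht)]
    congr 1; ring
  rw [radialDensity, h2]
  ring

/-- The link power exceeds `t` exactly on the disc of radius `linkLength C α t`, over which polar
coordinates are used. -/
lemma lintegral_radialDensity_Ioi (hw : Continuous w) (hw0 : ∀ r, 0 ≤ r → 0 ≤ w r) (hlam : 0 < lam)
    (hC : 0 < C) (hα : 0 < α) {t : ℝ} (ht : 0 < t) :
    ∫⁻ u in Ioi t, ENNReal.ofReal (radialDensity w lam C α u) =
      ENNReal.ofReal (radialIntensity w lam C α t) := by
  have hl := linkLength_pos (α := α) hC ht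
  have hc : Continuous fun x => w x * x := hw.mul continuous_id
  have h1 := lintegral_pathLoss hw.measurable hw0 hlam hC hα
    (H := (Ioi t).indicator 1) (measurable_one.indicator measurableSet_Ioi)
  have h2 : ∫⁻ u in Ioi 0, ENNReal.ofReal (radialDensity w lam C α u) * (Ioi t).indicator 1 u =
      ∫⁻ u in Ioi t, ENNReal.ofReal (radialDensity w lam C α u) := by
    have : ∀ u, ENNReal.ofReal (radialDensity w lam C α u) * (Ioi t).indicator 1 u =
        (Ioi t).indicator (fun u => ENNReal.ofReal (radialDensity w lam C α u)) u := fun u => by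
      by_cases hu : u ∈ Ioi t <;> simp [hu]
    simp_rw [this]
    rw [lintegral_indicator measurableSet_Ioi, Measure.restrict_restrict measurableSet_Ioi,
      inter_eq_left.2 (Ioi_subset_Ioi ht.le)]
  have hG : Measurable fun r : ℝ =>
      ENNReal.ofReal (w r) * (Ioi t).indicator (1 : ℝ → ℝ≥0∞) (C * r ^ (-α)) :=
    (hw.measurable.ennreal_ofReal).mul ((measurable_one.indicator measurableSet_Ioi).comp
      (by fun_prop))
  rw [← h2, ← h1, lintegral_comp_norm_plane hG]
  have h3 : ∫⁻ r in Ioi 0, ENNReal.ofReal r * (ENNReal.ofReal (w r) *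
      (Ioi t).indicator 1 (C * r ^ (-α))) =
      ∫⁻ r in Ioo 0 (linkLength C α t), ENNReal.ofReal (w r * r) := by
    have e1 : ∀ r ∈ Ioi (0 : ℝ), ENNReal.ofReal r * (ENNReal.ofReal (w r) *
        (Ioi t).indicator 1 (C * r ^ (-α))) =
        (Iio (linkLength C α t)).indicator (fun r => ENNReal.ofReal (w r * r)) r := fun r hr => by
      have := lt_pathLoss_iff hC hα ht hr
      by_cases hrt : r < linkLength C α t
      · rw [indicator_of_mem (show _ ∈ Ioi t from this.2 hrt),
          indicator_of_mem (show r ∈ Iio _ from hrt), Pi.one_apply, mul_one,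
          ENNReal.ofReal_mul (hw0 r (le_of_lt hr)), mul_comm]
      · rw [indicator_of_notMem (show _ ∉ Ioi t from fun h => hrt (this.1 h)),
          indicator_of_notMem (show r ∉ Iio _ from hrt), mul_zero, mul_zero]
    rw [setLIntegral_congr_fun measurableSet_Ioi e1, lintegral_indicator measurableSet_Iio,
      Measure.restrict_restrict measurableSet_Iio, inter_comm, Ioi_inter_Iio]
  have hpi := Real.pi_pos
  rw [h3, ← mul_assoc, ← ENNReal.ofReal_mul hlam.le, radialIntensity,
    intervalIntegral.integral_of_le hl.le, integral_Ioc_eq_integral_Ioo,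
    ENNReal.ofReal_mul (p := 2 * Real.pi * lam) (by positivity),
    ofReal_integral_eq_lintegral_ofReal]
  · congr 2; ring
  · exact (hc.integrableOn_Icc (a := 0) (b := linkLength C α t)).mono_set Ioo_subset_Icc_self
  · exact (ae_restrict_mem measurableSet_Ioo).mono fun r hr => mul_nonneg (hw0 r hr.1.le) hr.1.le

end Radial

/-! ### Link powers as a Poisson process on the half-line -/

/-- A measure on `(0, ∞)` with a continuous density `ℓ`, bounded away from the origin, and with
finite tails `Λ t = ν (t, ∞)`. -/
structure HasTail (ν : Measure ℝ) (Λ ℓ : ℝ → ℝ) : Prop where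
  eq_withDensity : ν = (volume.restrict (Ioi 0)).withDensity fun t => ENNReal.ofReal (ℓ t)
  continuousOn : ContinuousOn ℓ (Ioi 0)
  nonneg : ∀ t, 0 < t → 0 ≤ ℓ t
  bounded : ∀ d, 0 < d → ∃ b, ∀ t, d ≤ t → ℓ t ≤ b
  hasDerivAt : ∀ t, 0 < t → HasDerivAt Λ (-ℓ t) t
  tail : ∀ t, 0 < t → ν (Ioi t) = ENNReal.ofReal (Λ t)
  tail_nonneg : ∀ t, 0 < t → 0 ≤ Λ t

namespace Params

variable {M : ℕ} [NeZero M] (a : Params M)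

lemma continuous_losProb : Continuous a.losProb := by
  unfold losProb; fun_prop

lemma losProb_nonneg (r : ℝ) : 0 ≤ a.losProb r := (Real.exp_pos _).le

lemma losProb_le_one {r : ℝ} (hr : 0 ≤ r) : a.losProb r ≤ 1 := by
  rw [losProb, Real.exp_le_one_iff]
  exact div_nonpos_of_nonpos_of_nonneg (neg_nonpos.2 hr) a.μ_pos.le

/-- The mean number `Λ(t)` of points with link power above `t`. -/
noncomputable def intensity (lam t : ℝ) : ℝ := a.intensityL lam t + a.intensityN lam t

/-- The intensity measure of the link powers of operator `m`. -/
noncomputable def linkMeasure (m : Fin M) : Measure ℝ :=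
  (volume.restrict (Ioi 0)).withDensity fun t => ENNReal.ofReal (a.linkDensity m t)

lemma intensityL_eq (lam : ℝ) : a.intensityL lam = radialIntensity a.losProb lam a.CL a.αL := rfl

lemma intensityN_eq (lam : ℝ) :
    a.intensityN lam = radialIntensity (fun r => 1 - a.losProb r) lam a.CN a.αN := rfl

lemma linkDensity_eq (m : Fin M) (t : ℝ) :
    a.linkDensity m t = radialDensity a.losProb (a.density m) a.CL a.αL t +
      radialDensity (fun r => 1 - a.losProb r) (a.density m) a.CN a.αN t := rfl

lemma hasDerivAt_intensityL (m : Fin M) {t : ℝ} (ht : 0 < t) :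
    HasDerivAt (a.intensityL (a.density m))
      (-radialDensity a.losProb (a.density m) a.CL a.αL t) t :=
  hasDerivAt_radialIntensity a.continuous_losProb a.CL_pos ht

lemma hasDerivAt_intensityN (m : Fin M) {t : ℝ} (ht : 0 < t) :
    HasDerivAt (a.intensityN (a.density m))
      (-radialDensity (fun r => 1 - a.losProb r) (a.density m) a.CN a.αN t) t :=
  hasDerivAt_radialIntensity (continuous_const.sub a.continuous_losProb) a.CN_pos ht

end Params

lemma radialDensity_le {w : ℝ → ℝ} {lam C α : ℝ} (hw : ∀ r, 0 ≤ r → w r ≤ 1)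
    (hlam : 0 < lam) (hC : 0 < C) (hα : 0 < α) {d t : ℝ} (hd : 0 < d) (hdt : d ≤ t) :
    radialDensity w lam C α t ≤ 2 * Real.pi * lam / (α * C) * 1 * (C / d) ^ (2 / α + 1) := by
  have ht := hd.trans_le hdt
  have h1 := hw _ (linkLength_pos (α := α) hC ht).le
  have hpi := Real.pi_pos
  have h2 : (C / t) ^ (2 / α + 1) ≤ (C / d) ^ (2 / α + 1) :=
    Real.rpow_le_rpow (div_pos hC ht).le (div_le_div_of_nonneg_left hC.le hd hdt) (by positivity)
  have h3 := Real.rpow_pos_of_pos (div_pos hC ht) (2 / α + 1)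
  unfold radialDensity
  gcongr

lemma measurable_radialDensity {w : ℝ → ℝ} (hw : Measurable w) (lam C α : ℝ) :
    Measurable (radialDensity w lam C α) := by
  unfold radialDensity linkLength
  fun_prop

namespace Params

variable {M : ℕ} [NeZero M] (a : Params M)

lemma measurable_linkDensity (m : Fin M) : Measurable (a.linkDensity m) :=
  (measurable_radialDensity a.continuous_losProb.measurable _ _ _).add
    (measurable_radialDensity (continuous_const.sub a.continuous_losProb).measurable _ _ _)

lemma linkDensity_nonneg (m : Fin M) {t : ℝ} (ht : 0 < t) : 0 ≤ a.linkDensity m t := by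
  rw [linkDensity_eq]
  exact add_nonneg (radialDensity_nonneg (fun r _ => a.losProb_nonneg r) (a.density_pos m)
      a.CL_pos a.αL_pos ht)
    (radialDensity_nonneg (fun r hr => sub_nonneg.2 (a.losProb_le_one hr)) (a.density_pos m)
      a.CN_pos a.αN_pos ht)

lemma lintegral_linkMeasure (m : Fin M) {f : ℝ → ℝ≥0∞} (hf : Measurable f) :
    ∫⁻ t, f t ∂a.linkMeasure m = ∫⁻ t in Ioi 0, ENNReal.ofReal (a.linkDensity m t) * f t := by
  rw [linkMeasure,
    lintegral_withDensity_eq_lintegral_mul _ (a.measurable_linkDensity m).ennreal_ofReal hf]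
  rfl

/-- The intensity measure of the link powers has tail `Λ`, with derivative `-linkDensity`. -/
lemma hasTail (m : Fin M) :
    HasTail (a.linkMeasure m) (a.intensity (a.density m)) (a.linkDensity m) := by
  have hN0 : ∀ r, 0 ≤ r → 0 ≤ 1 - a.losProb r := fun r hr => sub_nonneg.2 (a.losProb_le_one hr)
  have hNc : Continuous fun r => 1 - a.losProb r := continuous_const.sub a.continuous_losProb
  have hI : ∀ t, 0 < t → 0 ≤ a.intensityL (a.density m) t ∧ 0 ≤ a.intensityN (a.density m) t := by
    intro t ht
    have hpi := Real.pi_pos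
    have hd := a.density_pos m
    constructor
    · exact mul_nonneg (by positivity) (intervalIntegral.integral_nonneg
        (linkLength_pos a.CL_pos ht).le fun x hx => mul_nonneg (a.losProb_nonneg x) hx.1)
    · exact mul_nonneg (by positivity) (intervalIntegral.integral_nonneg
        (linkLength_pos a.CN_pos ht).le fun x hx => mul_nonneg (hN0 x hx.1) hx.1)
  refine ⟨rfl, ?_, fun t ht => a.linkDensity_nonneg m ht, fun d hd => ?_,
    fun t ht => ?_, fun t ht => ?_, fun t ht => add_nonneg (hI t ht).1 (hI t ht).2⟩
  · exact (continuousOn_radialDensity a.continuous_losProb a.CL_pos).add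
      (continuousOn_radialDensity hNc a.CN_pos)
  · exact ⟨_, fun t hdt => add_le_add (radialDensity_le (fun r hr => a.losProb_le_one hr)
      (a.density_pos m) a.CL_pos
      a.αL_pos hd hdt) (radialDensity_le (fun r _ => sub_le_self _ (a.losProb_nonneg r))
      (a.density_pos m) a.CN_pos a.αN_pos hd hdt)⟩
  · convert! (a.hasDerivAt_intensityL m ht).add (a.hasDerivAt_intensityN m ht) using 1
    rw [linkDensity_eq, neg_add]
  · rw [linkMeasure, withDensity_apply _ measurableSet_Ioi,
      Measure.restrict_restrict measurableSet_Ioi, inter_eq_left.2 (Ioi_subset_Ioi ht.le),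
      intensity, ENNReal.ofReal_add (hI t ht).1 (hI t ht).2, intensityL_eq, intensityN_eq,
      ← lintegral_radialDensity_Ioi a.continuous_losProb (fun r _ => a.losProb_nonneg r)
        (a.density_pos m) a.CL_pos a.αL_pos ht,
      ← lintegral_radialDensity_Ioi hNc hN0 (a.density_pos m) a.CN_pos a.αN_pos ht,
      ← lintegral_add_left (measurable_radialDensity
          a.continuous_losProb.measurable _ _ _).ennreal_ofReal]
    refine setLIntegral_congr_fun measurableSet_Ioi fun u hu => ?_
    have hu' : 0 < u := ht.trans hu
    rw [linkDensity_eq, ENNReal.ofReal_add (radialDensity_nonneg (fun r _ => a.losProb_nonneg r)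
      (a.density_pos m) a.CL_pos a.αL_pos hu') (radialDensity_nonneg hN0 (a.density_pos m)
      a.CN_pos a.αN_pos hu')]

end Params

namespace Network

variable {M : ℕ} [NeZero M] {a : Params M} {Ω : Type*} [MeasurableSpace Ω] {Pr : Measure Ω}
  (net : Network a Pr)

lemma hasIndependentMarks (m : Fin M) : HasIndependentMarks (net.pos m) (net.los m)
    (fun x => ENNReal.ofReal (a.losProb ‖x‖)) Pr where
  measurable_point := (net.poisson m).measurable
  measurable_mark := net.los_measurable m
  measurable_prob := (a.continuous_losProb.measurable.comp measurable_norm).ennreal_ofReal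
  prob_le_one x := by
    rw [ENNReal.ofReal_le_one]
    exact a.losProb_le_one (norm_nonneg x)
  law := net.los_law m

/-- The link powers of an operator form a Poisson process. -/
lemma linkPower_hasPoissonLaplace [IsProbabilityMeasure Pr] (m : Fin M) :
    HasPoissonLaplace (fun i ω => net.linkPower m ω i) (a.linkMeasure m) Pr := by
  have hτ : ∀ l, Measurable fun x : Plane => a.pathLoss l ‖x‖ := fun l => by
    unfold Params.pathLoss
    cases l <;> simp only [if_true, if_false, Bool.false_eq_true] <;> fun_prop
  have h := (net.hasIndependentMarks m).hasPoissonLaplace (net.poisson m).hasPoissonLaplace hτ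
  have hqm := (net.hasIndependentMarks m).measurable_prob
  convert! h using 1
  refine Measure.ext_of_lintegral _ fun f hf => ?_
  have hN0 : ∀ r, 0 ≤ r → 0 ≤ 1 - a.losProb r := fun r hr => sub_nonneg.2 (a.losProb_le_one hr)
  have hNc : Continuous fun r => 1 - a.losProb r := continuous_const.sub a.continuous_losProb
  have hLm := measurable_radialDensity a.continuous_losProb.measurable (a.density m) a.CL a.αL
  rw [a.lintegral_linkMeasure m hf, lintegral_add_measure, lintegral_map hf (hτ _),
    lintegral_map hf (hτ _),
    lintegral_withDensity_eq_lintegral_mul _ hqm (g := fun x => f (a.pathLoss true ‖x‖))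
      (hf.comp (hτ _)),
    lintegral_withDensity_eq_lintegral_mul _ (f := fun x => 1 - ENNReal.ofReal (a.losProb ‖x‖))
      (measurable_const.sub hqm) (g := fun x => f (a.pathLoss false ‖x‖)) (hf.comp (hτ _)),
    lintegral_smul_measure, lintegral_smul_measure]
  have e1 := lintegral_pathLoss a.continuous_losProb.measurable (fun r _ => a.losProb_nonneg r)
        (a.density_pos m) a.CL_pos a.αL_pos hf
  have e2 := lintegral_pathLoss hNc.measurable hN0 (a.density_pos m) a.CN_pos a.αN_pos hf
  have e3 : ∀ x : Plane, ENNReal.ofReal (1 - a.losProb ‖x‖) = 1 - ENNReal.ofReal (a.losProb ‖x‖) :=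
    fun x => by rw [ENNReal.ofReal_sub _ (a.losProb_nonneg _), ENNReal.ofReal_one]
  simp_rw [e3] at e2
  refine Eq.trans ?_ (congrArg₂ (· + ·) e1.symm e2.symm)
  rw [← lintegral_add_left (f := fun t => ENNReal.ofReal
    (radialDensity a.losProb (a.density m) a.CL a.αL t) * f t) (hLm.ennreal_ofReal.mul hf)]
  refine setLIntegral_congr_fun measurableSet_Ioi fun u hu => ?_
  rw [Params.linkDensity_eq, ENNReal.ofReal_add
    (radialDensity_nonneg (fun r _ => a.losProb_nonneg r)
      (a.density_pos m) a.CL_pos a.αL_pos hu) (radialDensity_nonneg hN0 (a.density_pos m)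
      a.CN_pos a.αN_pos hu), add_mul]

end Network

/-! ### Counts of a Poisson process from its Laplace functional -/

/-- Comparison of the first coefficients that may differ: cancel the common terms, divide by `z ^ k`
and let `z` tend to zero. -/
lemma powerSeries_coeff_le {p q : ℕ → ℝ≥0∞} {k : ℕ} (hp : ∑' i, p i ≠ ∞) (hq : ∑' i, q i ≠ ∞)
    (h : ∀ z : ℝ≥0∞, 0 < z → z < 1 → ∑' i, z ^ i * p i = ∑' i, z ^ i * q i)
    (hlt : ∀ i < k, p i = q i) : p k ≤ q k := by
  have hfin : ∀ i, p i ≠ ∞ := fun i => ENNReal.ne_top_of_tsum_ne_top hp i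
  have key : ∀ z : ℝ≥0∞, 0 < z → z < 1 → p k ≤ q k + z * ∑' i, q i := by
    intro z hz hz1
    have hzt : z ≠ ∞ := (hz1.trans ENNReal.one_lt_top).ne
    have h1 := h z hz hz1
    rw [← ENNReal.summable.sum_add_tsum_nat_add' (f := fun i => z ^ i * p i) (k := k),
      ← ENNReal.summable.sum_add_tsum_nat_add' (f := fun i => z ^ i * q i) (k := k),
      Finset.sum_congr rfl fun i hi => by rw [hlt i (Finset.mem_range.1 hi)],
      ENNReal.add_right_inj] at h1
    · simp_rw [pow_add, mul_comm _ (z ^ k), mul_assoc, ENNReal.tsum_mul_left] at h1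
      rw [ENNReal.mul_right_inj (pow_ne_zero _ hz.ne') (ENNReal.pow_ne_top hzt)] at h1
      calc p k ≤ ∑' i, z ^ i * p (i + k) := by
            simpa using ENNReal.le_tsum (f := fun i => z ^ i * p (i + k)) 0
        _ = ∑' i, z ^ i * q (i + k) := h1
        _ = q k + ∑' i, z ^ (i + 1) * q (i + 1 + k) := by
            rw [← ENNReal.summable.sum_add_tsum_nat_add' (f := fun i => z ^ i * q (i + k)) (k := 1)]
            simp
        _ ≤ q k + z * ∑' i, q i := by
            rw [← ENNReal.tsum_mul_left]
            refine add_le_add le_rfl ((ENNReal.tsum_le_tsum fun i => ?_).trans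
              (ENNReal.tsum_comp_le_tsum_of_injective
                (f := fun i => i + 1 + k) (fun i j hij => by simpa using hij) fun i => z * q i))
            rw [pow_succ, mul_comm (z ^ i)]
            gcongr
            exact mul_le_of_le_one_right' (pow_le_one' hz1.le i)
    · rw [ENNReal.sum_ne_top]
      intro i hi
      rw [← hlt i (Finset.mem_range.1 hi)]
      exact ENNReal.mul_ne_top (ENNReal.pow_ne_top hzt) (hfin i)
  have hlim : Tendsto (fun n : ℕ => q k + ((n : ℝ≥0∞) + 2)⁻¹ * ∑' i, q i) atTop
      (𝓝 (q k + 0 * ∑' i, q i)) := by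
    refine tendsto_const_nhds.add (ENNReal.Tendsto.mul_const ?_ (Or.inr hq))
    have := (tendsto_add_atTop_iff_nat 2).2 ENNReal.tendsto_inv_nat_nhds_zero
    simpa using this
  rw [zero_mul, add_zero] at hlim
  refine ge_of_tendsto' hlim fun n => key _ ?_ ?_
  · rw [ENNReal.inv_pos]; exact_mod_cast ENNReal.natCast_ne_top (n + 2)
  · rw [ENNReal.inv_lt_one]
    exact_mod_cast (by omega : 1 < n + 2)

/-- A power series with nonnegative coefficients is determined by its values on `(0, 1)`. -/
lemma powerSeries_ext {p q : ℕ → ℝ≥0∞} (hp : ∑' i, p i ≠ ∞) (hq : ∑' i, q i ≠ ∞)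
    (h : ∀ z : ℝ≥0∞, 0 < z → z < 1 → ∑' i, z ^ i * p i = ∑' i, z ^ i * q i) (k : ℕ) :
    p k = q k := by
  induction k using Nat.strong_induction_on with
  | _ k ih =>
    exact le_antisymm (powerSeries_coeff_le hp hq h ih)
      (powerSeries_coeff_le hq hp (fun z hz hz1 => (h z hz hz1).symm) fun i hi => (ih i hi).symm)

/-- Inversion of a Poisson generating function, in the presence of a weight `W`. -/
lemma lintegral_count_eq_of_generatingFunction {Ω : Type*} [MeasurableSpace Ω] {Pr : Measure Ω}
    [IsProbabilityMeasure Pr] {N W : Ω → ℝ≥0∞} (hN : Measurable N)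
    (hN' : ∀ ω, N ω = ∞ ∨ ∃ k : ℕ, N ω = k) (hW : Measurable W) (hW1 : ∀ ω, W ω ≤ 1)
    {r c : ℝ≥0∞} (hr : r ≠ ∞) (hc : c ≤ 1)
    (h : ∀ u, ∫⁻ ω, expNeg (u * N ω) * W ω ∂Pr = expNeg ((1 - expNeg u) * r) * c) (k : ℕ) :
    ∫⁻ ω, {ω | N ω = k}.indicator 1 ω * W ω ∂Pr = poissonMeasure r.toNNReal {k} * c := by
  have hmk : ∀ k : ℕ, MeasurableSet {ω | N ω = k} := fun k =>
    measurableSet_eq_fun hN measurable_const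
  have hm : ∀ k : ℕ, Measurable fun ω => {ω | N ω = k}.indicator (1 : Ω → ℝ≥0∞) ω * W ω :=
    fun k => (measurable_one.indicator (hmk k)).mul hW
  have hpt : ∀ z : ℝ≥0∞, z < 1 → ∀ ω, expNeg (negLog z * N ω) * W ω =
      ∑' k : ℕ, z ^ k * ({ω | N ω = k}.indicator 1 ω * W ω) := fun z hz ω => by
    have hz' := expNeg_negLog hz.le
    rcases hN' ω with h' | ⟨j, hj⟩
    · have h0 : negLog z ≠ 0 := fun h0 => by
        rw [h0, expNeg_zero] at hz'; exact hz.ne hz'.symm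
      rw [h', ENNReal.mul_top h0, expNeg_top, zero_mul]
      refine (ENNReal.tsum_eq_zero.2 fun k => ?_).symm
      rw [indicator_of_notMem, zero_mul, mul_zero]
      rw [mem_ofPred_eq, h']
      exact (ENNReal.natCast_ne_top k).symm
    · rw [tsum_eq_single j]
      · rw [hj, expNeg_mul_natCast, hz', indicator_of_mem (by exact hj), Pi.one_apply, one_mul]
      · intro k hk
        rw [indicator_of_notMem, zero_mul, mul_zero]
        rw [mem_ofPred_eq, hj]
        exact_mod_cast hk.symm
  have hsum : ∑' k : ℕ, ∫⁻ ω, {ω | N ω = k}.indicator 1 ω * W ω ∂Pr ≤ 1 := by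
    rw [← lintegral_tsum fun k => (hm k).aemeasurable]
    calc _ ≤ ∫⁻ ω, 1 ∂Pr := lintegral_mono fun ω => ?_
      _ = 1 := by simp
    rcases hN' ω with h' | ⟨j, hj⟩
    · refine le_of_eq_of_le (ENNReal.tsum_eq_zero.2 fun k => ?_) zero_le
      rw [indicator_of_notMem, zero_mul]
      rw [mem_ofPred_eq, h']
      exact (ENNReal.natCast_ne_top k).symm
    · rw [tsum_eq_single j]
      · rw [indicator_of_mem (by exact hj), Pi.one_apply, one_mul]; exact hW1 ω
      · intro k hk
        rw [indicator_of_notMem, zero_mul]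
        rw [mem_ofPred_eq, hj]
        exact_mod_cast hk.symm
  have hpo : ∑' k : ℕ, poissonMeasure r.toNNReal {k} = 1 := by
    have := lintegral_countable' (μ := poissonMeasure r.toNNReal) fun _ => 1
    simpa using this.symm
  refine powerSeries_ext (q := fun k => poissonMeasure r.toNNReal {k} * c)
    (hsum.trans_lt ENNReal.one_lt_top).ne ?_ (fun z _ hz => ?_) k
  · rw [ENNReal.tsum_mul_right, hpo, one_mul]
    exact (hc.trans_lt ENNReal.one_lt_top).ne
  · have h1 := h (negLog z)
    simp_rw [hpt z hz] at h1
    rw [lintegral_tsum fun k => ((hm k).const_mul _).aemeasurable, expNeg_negLog hz.le] at h1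
    simp_rw [lintegral_const_mul _ (hm _)] at h1
    rw [h1]
    have h2 := lintegral_expNeg_poissonMeasure r.toNNReal (negLog z)
    rw [expNeg_negLog hz.le, ENNReal.coe_toNNReal hr, lintegral_countable'] at h2
    rw [← h2, ← ENNReal.tsum_mul_right]
    refine tsum_congr fun k => ?_
    rw [expNeg_mul_natCast, expNeg_negLog hz.le, mul_assoc]

namespace HasPoissonLaplace

variable {Ω S : Type*} [MeasurableSpace Ω] [MeasurableSpace S] {Y : ℕ → Ω → S} {ν : Measure S}
  {Pr : Measure Ω} [IsProbabilityMeasure Pr] (h : HasPoissonLaplace Y ν Pr)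
include h

omit [IsProbabilityMeasure Pr] in
lemma measurable_count {B : Set S} (hB : MeasurableSet B) :
    Measurable fun ω => cnt (fun i => Y i ω) B := measurable_cnt h.measurable hB

omit [IsProbabilityMeasure Pr] in
lemma measurable_expNeg_tsum {f : S → ℝ≥0∞} (hf : Measurable f) :
    Measurable fun ω => expNeg (∑' i, f (Y i ω)) :=
  measurable_expNeg.comp (Measurable.tsum fun i => hf.comp (h.measurable i))

omit [IsProbabilityMeasure Pr] in
/-- The count in `B` and the points outside `B` enter the Laplace functional through independent
factors. -/
lemma lintegral_expNeg_count_mul {B : Set S} (hB : MeasurableSet B) {f : S → ℝ≥0∞}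
    (hf : Measurable f) (hfB : ∀ s ∈ B, f s = 0) (u : ℝ≥0∞) :
    ∫⁻ ω, expNeg (u * cnt (fun i => Y i ω) B) * expNeg (∑' i, f (Y i ω)) ∂Pr =
      expNeg ((1 - expNeg u) * ν B) * expNeg (∫⁻ s, (1 - expNeg (f s)) ∂ν) := by
  have hi : Measurable (B.indicator (1 : S → ℝ≥0∞)) := measurable_one.indicator hB
  have h1 := h.laplace (fun s => u * B.indicator 1 s + f s) ((hi.const_mul u).add hf)
  have h2 : ∀ s, 1 - expNeg (u * B.indicator 1 s + f s) =
      (1 - expNeg u) * B.indicator 1 s + (1 - expNeg (f s)) := fun s => by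
    by_cases hs : s ∈ B
    · simp [hs, hfB s hs]
    · simp [hs]
  simp_rw [h2] at h1
  rw [lintegral_add_left (hi.const_mul _), lintegral_const_mul _ hi, lintegral_indicator_one hB,
    expNeg_add] at h1
  rw [← h1]
  refine lintegral_congr fun ω => ?_
  rw [ENNReal.tsum_add, ENNReal.tsum_mul_left, expNeg_add]
  rfl

/-- Joint law of the counts in two disjoint sets, weighted by a functional of the points outside
of them. -/
lemma lintegral_two_counts {A B : Set S} (hA : MeasurableSet A) (hB : MeasurableSet B)
    (hAfin : ν A ≠ ∞) (hBfin : ν B ≠ ∞) (hdisj : Disjoint A B)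
    {f : S → ℝ≥0∞} (hf : Measurable f) (hfA : ∀ s ∈ A, f s = 0) (hfB : ∀ s ∈ B, f s = 0) (k l : ℕ) :
    ∫⁻ ω, {ω | cnt (fun i => Y i ω) B = l}.indicator 1 ω *
        ({ω | cnt (fun i => Y i ω) A = k}.indicator 1 ω * expNeg (∑' i, f (Y i ω))) ∂Pr =
      poissonMeasure (ν B).toNNReal {l} *
        (poissonMeasure (ν A).toNNReal {k} * expNeg (∫⁻ s, (1 - expNeg (f s)) ∂ν)) := by
  set Z : Ω → ℝ≥0∞ := fun ω => expNeg (∑' i, f (Y i ω)) with hZ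
  set c := expNeg (∫⁻ s, (1 - expNeg (f s)) ∂ν) with hc
  have hAm : Measurable fun ω => cnt (fun i => Y i ω) A := h.measurable_count hA
  have hBm : Measurable fun ω => cnt (fun i => Y i ω) B := h.measurable_count hB
  have hZm : Measurable Z := h.measurable_expNeg_tsum hf
  have hexp1 : ∀ x : ℝ≥0∞, expNeg x ≤ 1 := expNeg_le_one
  have hi1 : ∀ (A : Set Ω) ω, A.indicator (1 : Ω → ℝ≥0∞) ω ≤ 1 := fun A ω =>
    indicator_le_self' (fun _ _ => zero_le) ω
  have hmA : Measurable fun ω => {ω | cnt (fun i => Y i ω) A = k}.indicator (1 : Ω → ℝ≥0∞) ω :=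
    measurable_one.indicator (measurableSet_eq_fun hAm measurable_const)
  -- invert the generating function in one count after the other
  have hgen : ∀ u v, ∫⁻ ω, expNeg (u * cnt (fun i => Y i ω) A) *
      (expNeg (v * cnt (fun i => Y i ω) B) * Z ω) ∂Pr =
      expNeg ((1 - expNeg u) * ν A) * (expNeg ((1 - expNeg v) * ν B) * c) := by
    intro u v
    have hi : Measurable fun s => v * B.indicator (1 : S → ℝ≥0∞) s :=
      (measurable_one.indicator hB).const_mul _
    have e1 := h.lintegral_expNeg_count_mul hB hf hfB v
    have e2 := h.lintegral_expNeg_count_mul hA (f := fun s => v * B.indicator 1 s + f s)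
      (hi.add hf) (fun s hs => by simp [hfA s hs, disjoint_left.1 hdisj hs]) u
    rw [← e1]
    trans expNeg ((1 - expNeg u) * ν A) *
      expNeg (∫⁻ s, (1 - expNeg (v * B.indicator 1 s + f s)) ∂ν)
    · rw [← e2]
      refine lintegral_congr fun ω => ?_
      simp only [hZ, cnt, ENNReal.tsum_add, ENNReal.tsum_mul_left, expNeg_add]
    · rw [← h.laplace (fun s => v * B.indicator 1 s + f s) (hi.add hf)]
      congr 1
      refine lintegral_congr fun ω => ?_
      simp only [cnt, ENNReal.tsum_add, ENNReal.tsum_mul_left, expNeg_add]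
  have s0 : ∀ v, ∫⁻ ω, {ω | cnt (fun i => Y i ω) A = k}.indicator 1 ω *
      (expNeg (v * cnt (fun i => Y i ω) B) * Z ω) ∂Pr =
      poissonMeasure (ν A).toNNReal {k} * (expNeg ((1 - expNeg v) * ν B) * c) := fun v =>
    lintegral_count_eq_of_generatingFunction hAm (fun ω => cnt_eq_top_or_natCast _ _)
      (W := fun ω => expNeg (v * cnt (fun i => Y i ω) B) * Z ω)
      ((measurable_expNeg.comp (hBm.const_mul v)).mul hZm)
      (fun ω => mul_le_one' (hexp1 _) (hexp1 _)) hAfin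
      (mul_le_one' (hexp1 _) (hexp1 _)) (fun u => hgen u v) k
  exact lintegral_count_eq_of_generatingFunction hBm (fun ω => cnt_eq_top_or_natCast _ _)
    (W := fun ω => {ω | cnt (fun i => Y i ω) A = k}.indicator 1 ω * Z ω) (hmA.mul hZm)
    (fun ω => mul_le_one' (hi1 _ _) (hexp1 _)) hBfin
    (c := poissonMeasure (ν A).toNNReal {k} * c) (mul_le_one' prob_le_one (hexp1 _))
    (fun v => by
      rw [mul_left_comm, ← s0 v]
      exact lintegral_congr fun ω => by ring) l

lemma measure_count_eq {B : Set S} (hB : MeasurableSet B) (hfin : ν B ≠ ∞) (k : ℕ) :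
    Pr {ω | cnt (fun i => Y i ω) B = k} = poissonMeasure (ν B).toNNReal {k} := by
  have hm := h.measurable_count hB
  have := lintegral_count_eq_of_generatingFunction (Pr := Pr) (W := fun _ => 1) hm
    (fun ω => cnt_eq_top_or_natCast _ _) measurable_const (fun _ => le_rfl) (c := 1) hfin le_rfl
    (fun u => by
      have := h.lintegral_expNeg_count_mul hB (f := fun _ => 0) measurable_const (fun _ _ => rfl) u
      simpa using this) k
  rw [mul_one] at this
  rw [← this]
  simp_rw [mul_one]
  rw [lintegral_indicator_one (measurableSet_eq_fun hm measurable_const)]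

lemma ae_count_ne_top {B : Set S} (hB : MeasurableSet B) (hfin : ν B ≠ ∞) :
    ∀ᵐ ω ∂Pr, cnt (fun i => Y i ω) B ≠ ∞ := by
  have hm := h.measurable_count hB
  have hEm : ∀ k : ℕ, MeasurableSet {ω | cnt (fun i => Y i ω) B = k} := fun k =>
    measurableSet_eq_fun hm measurable_const
  have h1 : Pr (⋃ k : ℕ, {ω | cnt (fun i => Y i ω) B = k}) = 1 := by
    rw [measure_iUnion _ hEm]
    · simp_rw [h.measure_count_eq hB hfin]
      have := lintegral_countable' (μ := poissonMeasure (ν B).toNNReal) fun _ => 1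
      simpa using this.symm
    · intro k k' hkk'
      refine disjoint_left.2 fun ω h h' => hkk' ?_
      exact_mod_cast (show cnt _ _ = _ from h).symm.trans h'
  filter_upwards [compl_mem_ae_iff.2 ((prob_compl_eq_zero_iff (MeasurableSet.iUnion hEm)).2 h1)]
    with ω hω
  rw [compl_compl, mem_iUnion] at hω
  obtain ⟨k, hk⟩ := hω
  rw [show cnt _ _ = _ from hk]
  exact ENNReal.natCast_ne_top k

lemma ae_notMem_of_measure_zero {B : Set S} (hB : MeasurableSet B) (h0 : ν B = 0) :
    ∀ᵐ ω ∂Pr, ∀ i, Y i ω ∉ B := by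
  have hm := h.measurable_count hB
  have h1 := h.measure_count_eq hB (by simp [h0]) 0
  rw [h0, poissonMeasure_singleton] at h1
  have h2 : Pr {ω | cnt (fun i => Y i ω) B = (0 : ℕ)} = 1 := by simpa using h1
  filter_upwards [compl_mem_ae_iff.2 ((prob_compl_eq_zero_iff
    (measurableSet_eq_fun hm measurable_const)).2 h2)] with ω hω i hi
  rw [compl_compl, mem_ofPred_eq, Nat.cast_zero, cnt, ENNReal.tsum_eq_zero] at hω
  simpa [hi] using hω i

/-- Two points fall into a small cell with probability of second order in its mass. -/
lemma measure_two_le_count {B : Set S} (hB : MeasurableSet B) (hfin : ν B ≠ ∞) :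
    Pr {ω | 2 ≤ cnt (fun i => Y i ω) B} ≤ ν B ^ 2 := by
  have hm := h.measurable_count hB
  have hEm : ∀ k : ℕ, MeasurableSet {ω | cnt (fun i => Y i ω) B = k} := fun k =>
    measurableSet_eq_fun hm measurable_const
  obtain ⟨r, hr⟩ : ∃ r : ℝ≥0, ν B = r := ⟨_, (ENNReal.coe_toNNReal hfin).symm⟩
  have hsum : Pr {ω | 2 ≤ cnt (fun i => Y i ω) B} +
      (Pr {ω | cnt (fun i => Y i ω) B = (0 : ℕ)} +
        Pr {ω | cnt (fun i => Y i ω) B = (1 : ℕ)}) ≤ 1 := by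
    rw [← measure_union _ (hEm 1), ← measure_union _ ((hEm 0).union (hEm 1))]
    · exact prob_le_one
    · refine disjoint_left.2 fun ω h2 h01 => ?_
      have h2 : (2 : ℝ≥0∞) ≤ cnt (fun i => Y i ω) B := h2
      rcases h01 with h' | h'
      all_goals
        rw [show cnt _ _ = _ from h'] at h2
        norm_num at h2
    · refine disjoint_left.2 fun ω h' h'' => ?_
      have := (show cnt _ _ = _ from h').symm.trans h''
      norm_num at this
  rw [h.measure_count_eq hB hfin, h.measure_count_eq hB hfin, poissonMeasure_singleton,
    poissonMeasure_singleton, hr, ENNReal.toNNReal_coe,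
    ← ENNReal.ofReal_add (by positivity) (by positivity)] at hsum
  have h1 := ENNReal.le_sub_of_add_le_right ENNReal.ofReal_ne_top hsum
  refine h1.trans ?_
  rw [hr, ← ENNReal.ofReal_one, ← ENNReal.ofReal_sub _ (by positivity), ← ENNReal.coe_pow,
    ← ENNReal.ofReal_coe_nnreal]
  refine ENNReal.ofReal_le_ofReal ?_
  have he := Real.one_sub_le_exp_neg (r : ℝ)
  have hr0 := NNReal.coe_nonneg r
  push_cast
  simp only [pow_zero, pow_one, mul_one, Nat.factorial, Nat.cast_one, div_one]
  nlinarith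

end HasPoissonLaplace

/-! ### Poisson processes on the half-line in decreasing order -/

namespace HasTail

variable {ν : Measure ℝ} {Λ ℓ : ℝ → ℝ} (hν : HasTail ν Λ ℓ)
include hν

lemma tail_ne_top {d : ℝ} (hd : 0 < d) : ν (Ioi d) ≠ ∞ := by
  rw [hν.tail d hd]; exact ENNReal.ofReal_ne_top

lemma measure_Iic_zero : ν (Iic 0) = 0 := by
  rw [hν.eq_withDensity, withDensity_apply _ measurableSet_Iic,
    Measure.restrict_restrict measurableSet_Iic, Iic_inter_Ioi, Ioc_self, Measure.restrict_empty,
    lintegral_zero_measure]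

lemma measure_Ioc_le {d b : ℝ} (hd : 0 < d) (hb : ∀ t, d ≤ t → ℓ t ≤ b) {u v : ℝ} (hdu : d ≤ u) :
    ν (Ioc u v) ≤ ENNReal.ofReal b * ENNReal.ofReal (v - u) := by
  rw [hν.eq_withDensity, withDensity_apply _ measurableSet_Ioc,
    Measure.restrict_restrict measurableSet_Ioc,
    inter_eq_left.2 (show Ioc u v ⊆ Ioi 0 from fun t ht => (hd.trans_le hdu).trans ht.1),
    ← Real.volume_Ioc,
    ← setLIntegral_const]
  exact setLIntegral_mono measurable_const fun t ht =>
    ENNReal.ofReal_le_ofReal (hb t (hdu.trans ht.1.le))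

end HasTail

lemma two_le_cnt {S : Type*} {x : ℕ → S} {B : Set S} {i j : ℕ} (hij : i ≠ j) (hi : x i ∈ B)
    (hj : x j ∈ B) : 2 ≤ cnt x B := by
  have := ENNReal.sum_le_tsum (f := fun i => B.indicator (1 : S → ℝ≥0∞) (x i)) {i, j}
  rw [Finset.sum_pair hij, indicator_of_mem hi, indicator_of_mem hj] at this
  calc (2 : ℝ≥0∞) = 1 + 1 := by norm_num
    _ ≤ _ := this

namespace HasPoissonLaplace

variable {Ω : Type*} [MeasurableSpace Ω] {t : ℕ → Ω → ℝ} {ν : Measure ℝ} {Λ ℓ : ℝ → ℝ}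
  {Pr : Measure Ω} [IsProbabilityMeasure Pr] (h : HasPoissonLaplace t ν Pr) (hν : HasTail ν Λ ℓ)
include h hν

/-- No two points above `d` coincide: the cells of a fine partition contain at most one point. -/
lemma ae_injective_above {d : ℝ} (hd : 0 < d) :
    ∀ᵐ ω ∂Pr, ∀ i j, i ≠ j → d < t i ω → t i ω ≠ t j ω := by
  obtain ⟨b, hb⟩ := hν.bounded d hd
  set A : Set Ω := {ω | ¬ ∀ i j, i ≠ j → d < t i ω → t i ω ≠ t j ω} with hA
  suffices h0 : Pr A = 0 from h0
  have hbound : ∀ n : ℕ,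
      Pr A ≤ ENNReal.ofReal b * ENNReal.ofReal (1 / ((n : ℝ) + 1)) * ν (Ioi d) := by
    intro n
    set η : ℝ := 1 / ((n : ℝ) + 1) with hη
    have hη0 : 0 < η := by positivity
    set C : ℕ → Set ℝ := fun j => {x | d < x ∧ ⌈(x - d) / η⌉₊ = j} with hC
    have hCm : ∀ j, MeasurableSet (C j) := fun j => measurableSet_Ioi.inter
      ((Nat.measurable_ceil.comp ((measurable_id.sub_const d).div_const η))
        (measurableSet_singleton j))
    have hCd : ∀ j, C j ⊆ Ioi d := fun j x hx => hx.1
    have hCν : ∀ j, ν (C j) ≤ ENNReal.ofReal b * ENNReal.ofReal η := fun j => by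
      have hsub : C j ⊆ Ioc (d + (j - 1) * η) (d + j * η) := fun x hx => by
        obtain ⟨hx, hxj⟩ := hx
        have h1 : (x - d) / η ≤ j := hxj ▸ Nat.le_ceil _
        have h2 : (j : ℝ) < (x - d) / η + 1 := by
          rw [← hxj]; exact Nat.ceil_lt_add_one (div_nonneg (sub_nonneg.2 hx.le) hη0.le)
        rw [div_le_iff₀ hη0] at h1
        have h3 : ((j : ℝ) - 1) * η < x - d := by rw [← lt_div_iff₀ hη0]; linarith
        exact ⟨by linarith, by linarith⟩
      rcases Nat.eq_zero_or_pos j with rfl | hj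
      · have : C 0 = ∅ := by
          ext x
          simp only [hC, Nat.ceil_eq_zero, mem_ofPred_eq, mem_empty_iff_false, iff_false,
            not_and, not_le]
          exact fun hx => div_pos (sub_pos.2 hx) hη0
        simp [this]
      · have hj1 : (1 : ℝ) ≤ j := by exact_mod_cast hj
        refine (measure_mono hsub).trans ((hν.measure_Ioc_le hd hb ?_).trans (le_of_eq ?_))
        · nlinarith
        · congr 2; ring
    have hsum : ∑' j, ν (C j) ≤ ν (Ioi d) := by
      rw [← measure_iUnion _ hCm]
      · exact measure_mono (iUnion_subset hCd)
      · exact fun j j' hjj' => disjoint_left.2 fun x hx hx' => hjj' (hx.2.symm.trans hx'.2)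
    calc Pr A ≤ Pr (⋃ j, {ω | 2 ≤ cnt (fun i => t i ω) (C j)}) := by
          refine measure_mono fun ω hω => ?_
          simp only [hA, mem_ofPred_eq] at hω
          push Not at hω
          obtain ⟨i, j, hij, hdi, heq⟩ := hω
          refine mem_iUnion.2 ⟨⌈(t i ω - d) / η⌉₊, two_le_cnt hij ⟨hdi, rfl⟩ ?_⟩
          rw [← heq]
          exact ⟨hdi, rfl⟩
      _ ≤ ∑' j, ν (C j) ^ 2 := (measure_iUnion_le _).trans (ENNReal.tsum_le_tsum fun j =>
          h.measure_two_le_count (hCm j) (measure_ne_top_of_subset (hCd j) (hν.tail_ne_top hd)))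
      _ ≤ ∑' j, ENNReal.ofReal b * ENNReal.ofReal η * ν (C j) := ENNReal.tsum_le_tsum fun j => by
          rw [sq]; exact mul_le_mul_left (hCν j) _
      _ ≤ _ := by rw [ENNReal.tsum_mul_left]; gcongr
  have hlim : Tendsto (fun n : ℕ =>
      ENNReal.ofReal b * ENNReal.ofReal (1 / ((n : ℝ) + 1)) * ν (Ioi d))
      atTop (𝓝 (ENNReal.ofReal b * ENNReal.ofReal 0 * ν (Ioi d))) :=
    ENNReal.Tendsto.mul_const (ENNReal.Tendsto.const_mul (ENNReal.tendsto_ofReal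
      tendsto_one_div_add_atTop_nhds_zero_nat) (Or.inr ENNReal.ofReal_ne_top))
      (Or.inr (hν.tail_ne_top hd))
  rw [ENNReal.ofReal_zero, mul_zero, zero_mul] at hlim
  exact le_antisymm (ge_of_tendsto' hlim hbound) zero_le

/-- Almost surely the points can be listed in decreasing order. -/
lemma ae_decreasinglyOrderable : ∀ᵐ ω ∂Pr, DecreasinglyOrderable fun i => t i ω := by
  have hd : ∀ n : ℕ, (0 : ℝ) < 1 / ((n : ℝ) + 1) := fun n => by positivity
  filter_upwards [h.ae_notMem_of_measure_zero measurableSet_Iic hν.measure_Iic_zero,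
    ae_all_iff.2 fun n => h.ae_injective_above hν (hd n),
    ae_all_iff.2 fun n => h.ae_count_ne_top measurableSet_Ioi (hν.tail_ne_top (hd n))]
    with ω h1 h2 h3
  have hpos : ∀ i, 0 < t i ω := fun i => not_le.1 (h1 i)
  refine ⟨hpos, fun i j hij => ?_, h3⟩
  by_contra hne
  obtain ⟨n, hn⟩ := exists_nat_one_div_lt (hpos i)
  exact h2 n i j hne hn hij

omit [IsProbabilityMeasure Pr] hν in
lemma measurable_orderedTerm_comp {K : ℕ} (hK : 1 ≤ K) :
    Measurable fun ω => orderedTerm K fun i => t i ω :=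
  (measurable_orderedTerm hK).comp (measurable_pi_lambda _ h.measurable)

omit [IsProbabilityMeasure Pr] hν in
lemma measurable_orderedTerm_pair {K : ℕ} (hK : 1 ≤ K) :
    Measurable fun ω => (orderedTerm 1 fun i => t i ω, orderedTerm K fun i => t i ω) :=
  (h.measurable_orderedTerm_comp le_rfl).prodMk (h.measurable_orderedTerm_comp hK)

omit hν in
/-- Events on the counts in two disjoint sets are independent of the points outside of them. -/
lemma setLIntegral_counts {A B : Set ℝ} (hA : MeasurableSet A) (hB : MeasurableSet B)
    (hAfin : ν A ≠ ∞) (hBfin : ν B ≠ ∞) (hdisj : Disjoint A B)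
    {f : ℝ → ℝ≥0∞} (hf : Measurable f) (hfA : ∀ s ∈ A, f s = 0) (hfB : ∀ s ∈ B, f s = 0)
    (k : ℕ) (S : Set ℕ) :
    ∫⁻ ω in ⋃ l ∈ S, {ω | cnt (fun i => t i ω) A = k ∧ cnt (fun i => t i ω) B = l},
        expNeg (∑' i, f (t i ω)) ∂Pr =
      poissonMeasure (ν A).toNNReal {k} * poissonMeasure (ν B).toNNReal S *
        expNeg (∫⁻ s, (1 - expNeg (f s)) ∂ν) := by
  have hEm : ∀ l : ℕ,
      MeasurableSet {ω | cnt (fun i => t i ω) A = k ∧ cnt (fun i => t i ω) B = l} := fun l =>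
    (measurableSet_eq_fun (h.measurable_count hA) measurable_const).inter
      (measurableSet_eq_fun (h.measurable_count hB) measurable_const)
  have hd : S.PairwiseDisjoint fun l : ℕ =>
      {ω | cnt (fun i => t i ω) A = k ∧ cnt (fun i => t i ω) B = l} := by
    intro l _ l' _ hll'
    refine disjoint_left.2 fun ω hω hω' => hll' ?_
    exact_mod_cast hω.2.symm.trans hω'.2
  have hS : poissonMeasure (ν B).toNNReal S = ∑' l : S, poissonMeasure (ν B).toNNReal {l.1} := by
    rw [← measure_biUnion S.to_countable (fun l _ l' _ hll' => disjoint_singleton.2 hll')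
      (fun l _ => measurableSet_singleton l), biUnion_of_singleton]
  rw [lintegral_biUnion S.to_countable (fun l _ => hEm l) hd, hS, ← ENNReal.tsum_mul_left,
    ← ENNReal.tsum_mul_right]
  refine tsum_congr fun l => ?_
  rw [mul_comm (poissonMeasure (ν A).toNNReal _), mul_assoc,
    ← h.lintegral_two_counts hA hB hAfin hBfin hdisj hf hfA hfB, ← lintegral_indicator (hEm l)]
  refine lintegral_congr fun ω => ?_
  by_cases h1 : cnt (fun i => t i ω) A = k <;> by_cases h2 : cnt (fun i => t i ω) B = l <;>
    simp [h1, h2]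

/-- The largest point and the `K`-th largest one, when above `y`, are independent of the points
up to `y`. -/
lemma setLIntegral_orderedTerm {K : ℕ} (hK : 1 ≤ K) {x y : ℝ} (hy : 0 < y) (hyx : y < x)
    {f : ℝ → ℝ≥0∞} (hf : Measurable f) (hfy : ∀ s, y < s → f s = 0) :
    ∫⁻ ω in {ω | orderedTerm 1 (fun i => t i ω) ≤ x ∧ y < orderedTerm K (fun i => t i ω)},
        expNeg (∑' i, f (t i ω)) ∂Pr =
      poissonMeasure (ν (Ioi x)).toNNReal {0} * poissonMeasure (ν (Ioc y x)).toNNReal (Ici K) *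
        expNeg (∫⁻ s, (1 - expNeg (f s)) ∂ν) := by
  have hdisj : Disjoint (Ioi x) (Ioc y x) :=
    disjoint_left.2 fun s hs hs' => absurd hs'.2 (not_le.2 hs)
  rw [← h.setLIntegral_counts measurableSet_Ioi measurableSet_Ioc (hν.tail_ne_top (hy.trans hyx))
    (measure_ne_top_of_subset Ioc_subset_Ioi_self (hν.tail_ne_top hy)) hdisj hf
    (fun s hs => hfy s (hyx.trans hs)) (fun s hs => hfy s hs.1) 0 (Ici K)]
  refine setLIntegral_congr ?_
  filter_upwards [h.ae_decreasinglyOrderable hν] with ω hω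
  have hunion : cnt (fun i => t i ω) (Ioi y) =
      cnt (fun i => t i ω) (Ioi x) + cnt (fun i => t i ω) (Ioc y x) := by
    rw [← cnt_union _ hdisj, union_comm, Ioc_union_Ioi_eq_Ioi hyx.le]
  refine propext ?_
  change (orderedTerm 1 (fun i => t i ω) ≤ x ∧ y < orderedTerm K (fun i => t i ω)) ↔
    ω ∈ ⋃ l ∈ Ici K, {ω | cnt (fun i => t i ω) (Ioi x) = (0 : ℕ) ∧
      cnt (fun i => t i ω) (Ioc y x) = l}
  rw [hω.orderedTerm_eq, hω.orderedTerm_eq, hω.lt_kthLargest_iff hK, ← not_lt,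
    hω.lt_kthLargest_iff le_rfl, hunion]
  simp only [mem_iUnion, mem_Ici, mem_ofPred_eq, exists_prop, Nat.cast_one, Nat.cast_zero]
  have h0 : ¬ 1 ≤ cnt (fun i => t i ω) (Ioi x) ↔ cnt (fun i => t i ω) (Ioi x) = 0 := by
    rcases cnt_eq_top_or_natCast (fun i => t i ω) (Ioi x) with h' | ⟨k, hk⟩
    · simp [h']
    · rw [hk]; norm_cast; omega
  rw [h0]
  constructor
  · rintro ⟨h1, h2⟩
    rw [h1, zero_add] at h2
    rcases cnt_eq_top_or_natCast (fun i => t i ω) (Ioc y x) with h' | ⟨k, hk⟩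
    · rw [h1, zero_add] at hunion
      exact absurd (hunion.trans h') (hω.cnt_ne_top hy)
    · exact ⟨k, by rw [hk] at h2; exact_mod_cast h2, h1, hk⟩
  · rintro ⟨l, hl, h1, h2⟩
    rw [h1, h2, zero_add]
    exact ⟨rfl, by exact_mod_cast hl⟩

/-- The joint law of the largest and the `K`-th largest point, on a generating class of events. -/
lemma measure_orderedTerm {K : ℕ} (hK : 1 ≤ K) {x y : ℝ} (hy : 0 < y) (hyx : y < x) :
    Pr {ω | orderedTerm 1 (fun i => t i ω) ≤ x ∧ y < orderedTerm K (fun i => t i ω)} =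
      poissonMeasure (ν (Ioi x)).toNNReal {0} * poissonMeasure (ν (Ioc y x)).toNNReal (Ici K) := by
  have := h.setLIntegral_orderedTerm hν hK hy hyx (f := fun _ => 0) measurable_const fun _ _ => rfl
  simpa using this

end HasPoissonLaplace

/-- Measures on the plane that agree on the quadrants `(-∞, x] × (y, ∞)` are equal. -/
lemma measure_ext_of_Iic_prod_Ioi {μ μ' : Measure (ℝ × ℝ)} [IsFiniteMeasure μ]
    (h : ∀ x y, μ (Iic x ×ˢ Ioi y) = μ' (Iic x ×ˢ Ioi y)) : μ = μ' := by
  refine Measure.ext_of_generateFrom_of_iUnion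
    (image2 (· ×ˢ ·) (range (Iic : ℝ → Set ℝ)) (range (Ioi : ℝ → Set ℝ)))
    (fun n : ℕ => Iic (n : ℝ) ×ˢ Ioi (-(n : ℝ))) ?_ ?_ ?_ ?_ ?_ ?_
  · refine (generateFrom_eq_prod ?_ ?_ ?_ ?_).symm
    · exact (borel_eq_generateFrom_Iic ℝ).symm.trans BorelSpace.measurable_eq.symm
    · exact (borel_eq_generateFrom_Ioi ℝ).symm.trans BorelSpace.measurable_eq.symm
    · exact ⟨fun n : ℕ => Iic (n : ℝ), fun n => ⟨_, rfl⟩,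
        eq_univ_of_forall fun p => mem_iUnion.2 (exists_nat_ge p)⟩
    · refine ⟨fun n : ℕ => Ioi (-(n : ℝ)), fun n => ⟨_, rfl⟩,
        eq_univ_of_forall fun p => mem_iUnion.2 ?_⟩
      obtain ⟨n, hn⟩ := exists_nat_gt (-p)
      exact ⟨n, neg_lt.1 hn⟩
  · exact isPiSystem_Iic.prod isPiSystem_Ioi
  · refine eq_univ_of_forall fun p => mem_iUnion.2 ?_
    obtain ⟨n, hn⟩ := exists_nat_gt (max p.1 (-p.2))
    exact ⟨n, ((le_max_left _ _).trans_lt hn).le, neg_lt.1 ((le_max_right _ _).trans_lt hn)⟩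
  · exact fun n => ⟨_, ⟨n, rfl⟩, _, ⟨-n, rfl⟩, rfl⟩
  · exact fun n => measure_ne_top _ _
  · rintro _ ⟨_, ⟨x, rfl⟩, _, ⟨y, rfl⟩, rfl⟩
    exact h x y

/-! ### The points below the `K`-th largest one -/

/-- The largest point of the dyadic grid of mesh `2⁻ⁿ` strictly below `τ > 0`. -/
noncomputable def dyadicBelow (n : ℕ) (τ : ℝ) : ℝ := ((⌈τ * 2 ^ n⌉₊ : ℝ) - 1) / 2 ^ n

lemma dyadicBelow_lt (n : ℕ) {τ : ℝ} (hτ : 0 < τ) : dyadicBelow n τ < τ := by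
  rw [dyadicBelow, div_lt_iff₀ (by positivity)]
  linarith [Nat.ceil_lt_add_one (show 0 ≤ τ * 2 ^ n by positivity)]

lemma le_dyadicBelow (n : ℕ) (τ : ℝ) : τ - 1 / 2 ^ n ≤ dyadicBelow n τ := by
  rw [dyadicBelow, le_div_iff₀ (by positivity), sub_mul, one_div_mul_cancel (by positivity)]
  linarith [Nat.le_ceil (τ * 2 ^ n)]

lemma dyadicBelow_mono {τ : ℝ} (hτ : 0 < τ) : Monotone fun n => dyadicBelow n τ := by
  refine monotone_nat_of_le_succ fun n => ?_
  have h1 : 0 < ⌈τ * 2 ^ n⌉₊ := Nat.ceil_pos.2 (by positivity)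
  obtain ⟨j, hj⟩ : ∃ j, ⌈τ * 2 ^ n⌉₊ = j + 1 := ⟨_, (Nat.succ_pred_eq_of_pos h1).symm⟩
  have h2 : (j : ℝ) < τ * 2 ^ n := Nat.lt_ceil.1 (by omega)
  have h3 : 2 * j < ⌈τ * 2 ^ (n + 1)⌉₊ := Nat.lt_ceil.2 (by push_cast; rw [pow_succ]; linarith)
  have h4 : (2 * j + 1 : ℝ) ≤ ⌈τ * 2 ^ (n + 1)⌉₊ := by exact_mod_cast h3
  have h5 : (0 : ℝ) < 2 ^ n := by positivity
  rw [dyadicBelow, dyadicBelow, hj, div_le_div_iff₀ h5 (by positivity)]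
  generalize (⌈τ * 2 ^ (n + 1)⌉₊ : ℝ) = c at h4
  rw [pow_succ]
  push_cast
  nlinarith

lemma tendsto_dyadicBelow {τ : ℝ} (hτ : 0 < τ) :
    Tendsto (fun n => dyadicBelow n τ) atTop (𝓝 τ) := by
  have h : Tendsto (fun n : ℕ => τ - (1 / 2 : ℝ) ^ n) atTop (𝓝 (τ - 0)) :=
    tendsto_const_nhds.sub (tendsto_pow_atTop_nhds_zero_of_lt_one (by norm_num) (by norm_num))
  rw [sub_zero] at h
  refine tendsto_of_tendsto_of_tendsto_of_le_of_le h tendsto_const_nhds (fun n => ?_)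
    fun n => (dyadicBelow_lt n hτ).le
  simpa using le_dyadicBelow n τ

lemma measurable_dyadicBelow (n : ℕ) : Measurable (dyadicBelow n) := by
  unfold dyadicBelow
  exact ((measurable_from_nat.comp (Nat.measurable_ceil.comp (measurable_id.mul_const _))).sub_const
    1).div_const _

/-- `f` cut off above the dyadic approximations of `τ` increases to `f` cut off at `τ`. -/
lemma tendsto_indicator_dyadicBelow (f : ℝ → ℝ≥0∞) {τ : ℝ} (hτ : 0 < τ) (s : ℝ) :
    Tendsto (fun n => (Iic (dyadicBelow n τ)).indicator f s) atTop (𝓝 ((Iio τ).indicator f s)) := by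
  by_cases hs : s < τ
  · rw [indicator_of_mem (show s ∈ Iio τ from hs)]
    refine tendsto_const_nhds.congr' ?_
    filter_upwards [(tendsto_dyadicBelow hτ).eventually (eventually_gt_nhds hs)] with n hn
    exact (indicator_of_mem (show s ∈ Iic _ from hn.le) _).symm
  · rw [indicator_of_notMem (show s ∉ Iio τ from hs)]
    refine tendsto_const_nhds.congr fun n => (indicator_of_notMem ?_ _).symm
    exact fun h => hs (lt_of_le_of_lt h (dyadicBelow_lt n hτ))

lemma monotone_indicator_dyadicBelow (f : ℝ → ℝ≥0∞) {τ : ℝ} (hτ : 0 < τ) (s : ℝ) :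
    Monotone fun n => (Iic (dyadicBelow n τ)).indicator f s := fun _ _ hnm =>
  indicator_le_indicator_of_subset (Iic_subset_Iic.2 (dyadicBelow_mono hτ hnm)) (fun _ => zero_le) s

namespace HasPoissonLaplace

variable {Ω : Type*} [MeasurableSpace Ω] {t : ℕ → Ω → ℝ} {ν : Measure ℝ} {Λ ℓ : ℝ → ℝ}
  {Pr : Measure Ω} [IsProbabilityMeasure Pr] (h : HasPoissonLaplace t ν Pr) (hν : HasTail ν Λ ℓ)
include h hν

/-- On the event that the `K`-th largest point exceeds `d`, the largest point and the `K`-th largest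
one are independent of the points up to `d`. -/
lemma setLIntegral_above {K : ℕ} (hK : 1 ≤ K) {d : ℝ} (hd : 0 ≤ d) {f : ℝ → ℝ≥0∞}
    (hf : Measurable f) (hfd : ∀ s, d < s → f s = 0) {E : Set (ℝ × ℝ)} (hE : MeasurableSet E) :
    ∫⁻ ω in {ω | (orderedTerm 1 (fun i => t i ω), orderedTerm K (fun i => t i ω)) ∈ E ∧
        d < orderedTerm K (fun i => t i ω)}, expNeg (∑' i, f (t i ω)) ∂Pr =
      Pr {ω | (orderedTerm 1 (fun i => t i ω), orderedTerm K (fun i => t i ω)) ∈ E ∧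
        d < orderedTerm K (fun i => t i ω)} * expNeg (∫⁻ s, (1 - expNeg (f s)) ∂ν) := by
  have hT := h.measurable_orderedTerm_pair hK
  have hTK := h.measurable_orderedTerm_comp hK
  rcases hd.eq_or_lt with rfl | hd
  · have e1 : ∫⁻ s, (1 - expNeg (f s)) ∂ν = 0 := by
      rw [lintegral_eq_zero_iff (f := fun s => 1 - expNeg (f s))
          (measurable_const.sub (measurable_expNeg.comp hf))]
      have : ∀ᵐ s ∂ν, s ∉ Iic (0 : ℝ) := measure_eq_zero_iff_ae_notMem.1 hν.measure_Iic_zero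
      filter_upwards [this] with s hs
      rw [hfd s (not_le.1 hs)]
      simp
    rw [e1, expNeg_zero, mul_one, ← setLIntegral_one]
    refine lintegral_congr_ae (ae_restrict_of_ae ?_)
    filter_upwards [h.ae_decreasinglyOrderable hν] with ω hω
    have : ∀ i, f (t i ω) = 0 := fun i => hfd _ (hω.1 i)
    simp [this]
  · set A : Set Ω := {ω | d < orderedTerm K (fun i => t i ω)} with hA
    have hAm : MeasurableSet A := measurableSet_lt measurable_const hTK
    set P : Ω → ℝ × ℝ := fun ω => (orderedTerm 1 (fun i => t i ω), orderedTerm K (fun i => t i ω))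
      with hP
    set Z : Ω → ℝ≥0∞ := fun ω => expNeg (∑' i, f (t i ω)) with hZ
    set c := expNeg (∫⁻ s, (1 - expNeg (f s)) ∂ν) with hc
    have hZm : Measurable Z := h.measurable_expNeg_tsum hf
    have hZfin : ∫⁻ ω, Z ω ∂(Pr.restrict A) ≠ ∞ := by
      refine ((lintegral_mono fun ω => expNeg_le_one _).trans_lt (?_ : ∫⁻ _, 1 ∂_ < ∞)).ne
      simp
    have : IsFiniteMeasure ((Pr.restrict A).withDensity Z) := isFiniteMeasure_withDensity hZfin
    have key : ((Pr.restrict A).withDensity Z).map P = c • (Pr.restrict A).map P := by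
      refine measure_ext_of_Iic_prod_Ioi fun x y => ?_
      have hR : MeasurableSet (Iic x ×ˢ Ioi y : Set (ℝ × ℝ)) :=
          measurableSet_Iic.prod measurableSet_Ioi
      rw [Measure.map_apply hT hR, withDensity_apply _ (hT hR), Measure.smul_apply,
        Measure.map_apply hT hR, Measure.restrict_restrict (hT hR), Measure.restrict_apply (hT hR),
        smul_eq_mul, mul_comm c]
      have e1 : P ⁻¹' (Iic x ×ˢ Ioi y) ∩ A = {ω | orderedTerm 1 (fun i => t i ω) ≤ x ∧
          max y d < orderedTerm K (fun i => t i ω)} := by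
        ext ω; simp [hP, hA, and_assoc]
      rw [e1]
      by_cases hyx : max y d < x
      · have hpos : 0 < max y d := lt_max_of_lt_right hd
        rw [h.measure_orderedTerm hν hK hpos hyx]
        exact h.setLIntegral_orderedTerm hν hK hpos hyx hf fun s hs =>
          hfd s ((le_max_right _ _).trans_lt hs)
      · have h0 : Pr {ω | orderedTerm 1 (fun i => t i ω) ≤ x ∧
            max y d < orderedTerm K (fun i => t i ω)} = 0 := by
          refine measure_eq_zero_iff_ae_notMem.2 ?_
          filter_upwards [h.ae_decreasinglyOrderable hν] with ω hω hω'
          have h1 := hω.kthLargest_le_one hK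
          rw [hω.orderedTerm_eq, hω.orderedTerm_eq] at hω'
          exact hyx (hω'.2.trans_le (h1.trans hω'.1))
        rw [h0, zero_mul, setLIntegral_measure_zero _ _ h0]
    have h2 := congrArg (fun m : Measure (ℝ × ℝ) => m E) key
    simp only [Measure.smul_apply, smul_eq_mul] at h2
    rw [Measure.map_apply hT hE, withDensity_apply _ (hT hE), Measure.map_apply hT hE,
      Measure.restrict_restrict (hT hE), Measure.restrict_apply (hT hE), mul_comm c] at h2
    exact h2

/-- Conditional Laplace functional of the points below the `K`-th largest one, on a grid
approximation from below of the `K`-th largest point. -/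
lemma setLIntegral_dyadicBelow {K : ℕ} (hK : 1 ≤ K) {f : ℝ → ℝ≥0∞} (hf : Measurable f)
    {E : Set (ℝ × ℝ)} (hE : MeasurableSet E) (n : ℕ) :
    ∫⁻ ω in {ω | (orderedTerm 1 (fun i => t i ω), orderedTerm K (fun i => t i ω)) ∈ E},
        expNeg (∑' i,
          (Iic (dyadicBelow n (orderedTerm K fun i => t i ω))).indicator f (t i ω)) ∂Pr =
      ∫⁻ ω in {ω | (orderedTerm 1 (fun i => t i ω), orderedTerm K (fun i => t i ω)) ∈ E},
        expNeg (∫⁻ s, (1 - expNeg ((Iic (dyadicBelow n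
          (orderedTerm K fun i => t i ω))).indicator f s)) ∂ν) ∂Pr := by
  have hT := h.measurable_orderedTerm_pair hK
  have hTK := h.measurable_orderedTerm_comp hK
  set P : Ω → ℝ × ℝ := fun ω => (orderedTerm 1 (fun i => t i ω), orderedTerm K (fun i => t i ω))
    with hP
  set d : ℕ → ℝ := fun j => (j : ℝ) / 2 ^ n with hd
  -- the events that the grid point below the `K`-th largest point is `d j`
  set E' : ℕ → Set (ℝ × ℝ) := fun j => E ∩ {p | ⌈p.2 * 2 ^ n⌉₊ = j + 1} with hE'
  have hE'm : ∀ j, MeasurableSet (E' j) := fun j => hE.inter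
    ((Nat.measurable_ceil.comp (measurable_snd.mul_const _)) (measurableSet_singleton (j + 1)))
  have hE'd : ∀ j, ∀ p ∈ E' j, dyadicBelow n p.2 = d j ∧ d j < p.2 := fun j p hp => by
    have h1 : ⌈p.2 * 2 ^ n⌉₊ = j + 1 := hp.2
    refine ⟨by rw [dyadicBelow, h1]; push_cast; ring, ?_⟩
    rw [hd, div_lt_iff₀ (by positivity)]
    exact Nat.lt_ceil.1 (by omega)
  have hcover : P ⁻¹' E =ᵐ[Pr] ⋃ j, P ⁻¹' (E' j) := by
    filter_upwards [h.ae_decreasinglyOrderable hν] with ω hω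
    refine propext ⟨fun hω' => mem_iUnion.2 ?_, fun hω' => ?_⟩
    · have hpos : 0 < (P ω).2 * 2 ^ n := by
        have := hω.kthLargest_pos hK
        change 0 < (orderedTerm K fun i => t i ω) * 2 ^ n
        rw [hω.orderedTerm_eq K]
        positivity
      exact ⟨⌈(P ω).2 * 2 ^ n⌉₊ - 1, hω', (Nat.succ_pred_eq_of_pos (Nat.ceil_pos.2 hpos)).symm⟩
    · obtain ⟨j, hj⟩ := mem_iUnion.1 hω'
      exact hj.1
  have hdisj : Pairwise (Function.onFun Disjoint fun j => P ⁻¹' (E' j)) := fun j j' hjj' =>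
    disjoint_left.2 fun ω hω hω' => hjj' (by simpa using hω.2.symm.trans hω'.2)
  change ∫⁻ ω in P ⁻¹' E, _ ∂Pr = ∫⁻ ω in P ⁻¹' E, _ ∂Pr
  rw [setLIntegral_congr hcover, setLIntegral_congr hcover,
    lintegral_iUnion (fun j => hT (hE'm j)) hdisj, lintegral_iUnion (fun j => hT (hE'm j)) hdisj]
  refine tsum_congr fun j => ?_
  have hset : P ⁻¹' (E' j) = {ω | P ω ∈ E' j ∧ d j < orderedTerm K (fun i => t i ω)} := by
    ext ω
    exact ⟨fun hω => ⟨hω, (hE'd j _ hω).2⟩, fun hω => hω.1⟩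
  have key := h.setLIntegral_above hν hK (d := d j) (by positivity)
    (hf.indicator measurableSet_Iic)
    (fun s hs => indicator_of_notMem (s := Iic (d j)) (not_le.2 hs) f) (hE'm j)
  rw [← hset] at key
  rw [setLIntegral_congr_fun (hT (hE'm j)) fun ω hω => by rw [(hE'd j _ hω).1],
    key,
    setLIntegral_congr_fun
      (g := fun _ => expNeg (∫⁻ s, (1 - expNeg ((Iic (d j)).indicator f s)) ∂ν))
      (hT (hE'm j)) fun ω hω => by rw [(hE'd j _ hω).1], setLIntegral_const, mul_comm]

omit [IsProbabilityMeasure Pr] hν in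
lemma measurable_expNeg_below {K : ℕ} (hK : 1 ≤ K) {f : ℝ → ℝ≥0∞} (hf : Measurable f) :
    Measurable fun ω =>
      expNeg (∑' i, (Iio (orderedTerm K fun i => t i ω)).indicator f (t i ω)) := by
  refine measurable_expNeg.comp (Measurable.tsum fun i => ?_)
  have : (fun ω => (Iio (orderedTerm K fun i => t i ω)).indicator f (t i ω)) =
      {ω | t i ω < orderedTerm K fun i => t i ω}.indicator fun ω => f (t i ω) := by
    ext ω; simp [indicator_apply]
  rw [this]
  exact (hf.comp (h.measurable i)).indicator
    (measurableSet_lt (h.measurable i) (h.measurable_orderedTerm_comp hK))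

end HasPoissonLaplace

lemma measurable_expNeg_lintegral_Iio (ν : Measure ℝ) (F : ℝ → ℝ≥0∞) :
    Measurable fun τ => expNeg (∫⁻ s in Iio τ, F s ∂ν) :=
  measurable_expNeg.comp (Monotone.measurable fun _ _ hab =>
    lintegral_mono_set (Iio_subset_Iio hab))

/-- The points below the `K`-th largest one form, conditionally on the largest point and the `K`-th
largest one, a Poisson process. -/
theorem HasPoissonLaplace.lintegral_below {Ω : Type*} [MeasurableSpace Ω] {t : ℕ → Ω → ℝ}
    {ν : Measure ℝ} {Λ ℓ : ℝ → ℝ} {Pr : Measure Ω} [IsProbabilityMeasure Pr]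
    (h : HasPoissonLaplace t ν Pr) (hν : HasTail ν Λ ℓ) {K : ℕ} (hK : 1 ≤ K)
    {f : ℝ → ℝ≥0∞} (hf : Measurable f) {F : ℝ × ℝ → ℝ≥0∞} (hF : Measurable F) :
    ∫⁻ ω, F (orderedTerm 1 (fun i => t i ω), orderedTerm K (fun i => t i ω)) *
        expNeg (∑' i, (Iio (orderedTerm K fun i => t i ω)).indicator f (t i ω)) ∂Pr =
      ∫⁻ ω, F (orderedTerm 1 (fun i => t i ω), orderedTerm K (fun i => t i ω)) *
        expNeg (∫⁻ s in Iio (orderedTerm K fun i => t i ω), (1 - expNeg (f s)) ∂ν) ∂Pr := by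
  have hT := h.measurable_orderedTerm_pair hK
  have hTK := h.measurable_orderedTerm_comp hK
  set P : Ω → ℝ × ℝ := fun ω => (orderedTerm 1 (fun i => t i ω), orderedTerm K (fun i => t i ω))
    with hP
  set Z : Ω → ℝ≥0∞ := fun ω =>
    expNeg (∑' i, (Iio (orderedTerm K fun i => t i ω)).indicator f (t i ω)) with hZ
  set C : Ω → ℝ≥0∞ := fun ω =>
    expNeg (∫⁻ s in Iio (orderedTerm K fun i => t i ω), (1 - expNeg (f s)) ∂ν) with hC
  have hZm : Measurable Z := h.measurable_expNeg_below hK hf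
  have hCm : Measurable C := (measurable_expNeg_lintegral_Iio ν _).comp hTK
  have hpos : ∀ᵐ ω ∂Pr, 0 < orderedTerm K fun i => t i ω := by
    filter_upwards [h.ae_decreasinglyOrderable hν] with ω hω
    rw [hω.orderedTerm_eq]; exact hω.kthLargest_pos hK
  have key : (Pr.withDensity Z).map P = (Pr.withDensity C).map P := by
    ext E hE
    rw [Measure.map_apply hT hE, Measure.map_apply hT hE, withDensity_apply _ (hT hE),
      withDensity_apply _ (hT hE)]
    have l1 : Tendsto (fun n => ∫⁻ ω in P ⁻¹' E, expNeg (∑' i, (Iic (dyadicBelow n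
        (orderedTerm K fun i => t i ω))).indicator f (t i ω)) ∂Pr) atTop
        (𝓝 (∫⁻ ω in P ⁻¹' E, Z ω ∂Pr)) := by
      refine tendsto_lintegral_of_dominated_convergence (fun _ => 1) (fun n => ?_)
        (fun n => ae_of_all _ fun ω => expNeg_le_one _) (by simp) (ae_restrict_of_ae ?_)
      · refine measurable_expNeg.comp (Measurable.tsum fun i => ?_)
        have : (fun ω => (Iic (dyadicBelow n (orderedTerm K fun i => t i ω))).indicator f (t i ω)) =
            {ω | t i ω ≤ dyadicBelow n (orderedTerm K fun i => t i ω)}.indicator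
              fun ω => f (t i ω) := by
          ext ω; simp [indicator_apply]
        rw [this]
        exact (hf.comp (h.measurable i)).indicator
          (measurableSet_le (h.measurable i) ((measurable_dyadicBelow n).comp hTK))
      · filter_upwards [hpos] with ω hω
        exact tendsto_expNeg_tsum_of_monotone (fun i => monotone_indicator_dyadicBelow f hω _)
          fun i => tendsto_indicator_dyadicBelow f hω _
    have l2 : Tendsto (fun n => ∫⁻ ω in P ⁻¹' E, expNeg (∫⁻ s, (1 - expNeg ((Iic (dyadicBelow n
        (orderedTerm K fun i => t i ω))).indicator f s)) ∂ν) ∂Pr) atTop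
        (𝓝 (∫⁻ ω in P ⁻¹' E, C ω ∂Pr)) := by
      have hmon : ∀ s, Monotone fun d : ℝ => 1 - expNeg ((Iic d).indicator f s) :=
        fun s a b hab => tsub_le_tsub_left (expNeg_antitone (indicator_le_indicator_of_subset
          (Iic_subset_Iic.2 hab) (fun _ => zero_le) s)) _
      refine tendsto_lintegral_of_dominated_convergence (fun _ => 1) (fun n => ?_)
        (fun n => ae_of_all _ fun ω => expNeg_le_one _) (by simp) (ae_restrict_of_ae ?_)
      · exact measurable_expNeg.comp ((Monotone.measurable (f := fun d : ℝ =>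
          ∫⁻ s, (1 - expNeg ((Iic d).indicator f s)) ∂ν) fun a b hab =>
          lintegral_mono fun s => hmon s hab).comp ((measurable_dyadicBelow n).comp hTK))
      · filter_upwards [hpos] with ω hω
        refine (continuous_expNeg.tendsto _).comp ?_
        rw [← lintegral_indicator measurableSet_Iio]
        refine lintegral_tendsto_of_tendsto_of_monotone (fun n => ?_) (ae_of_all _ fun s n m hnm =>
          hmon s (dyadicBelow_mono hω hnm)) (ae_of_all _ fun s => ?_)
        · exact (measurable_const.sub (measurable_expNeg.comp
            (hf.indicator measurableSet_Iic))).aemeasurable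
        · have e1 : (Iio (orderedTerm K fun i => t i ω)).indicator (fun s => 1 - expNeg (f s)) s =
              1 - expNeg ((Iio (orderedTerm K fun i => t i ω)).indicator f s) := by
            by_cases hs : s ∈ Iio (orderedTerm K fun i => t i ω)
            · rw [indicator_of_mem hs, indicator_of_mem hs]
            · rw [indicator_of_notMem hs, indicator_of_notMem hs]; simp
          rw [e1]
          exact ENNReal.Tendsto.sub tendsto_const_nhds ((continuous_expNeg.tendsto _).comp
            (tendsto_indicator_dyadicBelow f hω s)) (Or.inl ENNReal.one_ne_top)
    exact tendsto_nhds_unique (l1.congr fun n => h.setLIntegral_dyadicBelow hν hK hf hE n) l2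
  have e : ∫⁻ p, F p ∂(Pr.withDensity Z).map P = ∫⁻ p, F p ∂(Pr.withDensity C).map P := by rw [key]
  rw [lintegral_map hF hT, lintegral_map hF hT,
    lintegral_withDensity_eq_lintegral_mul _ hZm (g := fun ω => F (P ω)) (hF.comp hT),
    lintegral_withDensity_eq_lintegral_mul _ hCm (g := fun ω => F (P ω)) (hF.comp hT)] at e
  simp_rw [mul_comm (F _)]
  exact e

/-! ### Laws of the ordered points -/

/-- The probability that a Poisson variable of mean `r` is less than `K`. -/
noncomputable def poissonBelow (K : ℕ) (r : ℝ) : ℝ :=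
  Real.exp (-r) * ∑ k ∈ Finset.range K, r ^ k / (k ! : ℝ)

lemma hasDerivAt_pow_div_factorial (k : ℕ) (r : ℝ) :
    HasDerivAt (fun r : ℝ => r ^ (k + 1) / ((k + 1)! : ℝ)) (r ^ k / (k ! : ℝ)) r := by
  convert! (hasDerivAt_pow (k + 1) r).div_const ((k + 1)! : ℝ) using 1
  rw [Nat.factorial_succ]
  push_cast
  have : (k ! : ℝ) ≠ 0 := by positivity
  have : (k + 1 : ℝ) ≠ 0 := by positivity
  field_simp

lemma hasDerivAt_poissonBelow (k : ℕ) (r : ℝ) :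
    HasDerivAt (poissonBelow (k + 1)) (-(Real.exp (-r) * (r ^ k / (k ! : ℝ)))) r := by
  have hexp : HasDerivAt (fun r : ℝ => Real.exp (-r)) (-Real.exp (-r)) r := by
    simpa using (hasDerivAt_neg r).exp
  induction k with
  | zero =>
    have : poissonBelow (0 + 1) = fun r => Real.exp (-r) := by ext; simp [poissonBelow]
    rw [this]
    simpa using hexp
  | succ k ih =>
    have : poissonBelow (k + 1 + 1) = fun r =>
        poissonBelow (k + 1) r + Real.exp (-r) * (r ^ (k + 1) / ((k + 1)! : ℝ)) := by
      ext r; rw [poissonBelow, Finset.sum_range_succ, mul_add]; rfl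
    rw [this]
    convert! ih.add (hexp.mul (hasDerivAt_pow_div_factorial k r)) using 1
    ring

lemma poissonBelow_zero {K : ℕ} (hK : 1 ≤ K) : poissonBelow K 0 = 1 := by
  obtain ⟨k, rfl⟩ := Nat.exists_eq_add_of_le' hK
  simp [poissonBelow, Finset.sum_range_succ']

lemma poissonBelow_nonneg (K : ℕ) {r : ℝ} (hr : 0 ≤ r) : 0 ≤ poissonBelow K r := by
  unfold poissonBelow; positivity

/-- The probability that a Poisson variable of mean `r` is at least `K`. -/
lemma poissonMeasure_Ici (K : ℕ) {r : ℝ} (hr : 0 ≤ r) :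
    poissonMeasure r.toNNReal (Ici K) = ENNReal.ofReal (1 - poissonBelow K r) := by
  have h1 : poissonMeasure r.toNNReal (Finset.range K : Set ℕ) =
      ENNReal.ofReal (poissonBelow K r) := by
    rw [← sum_measure_singleton, poissonBelow, Finset.mul_sum, ENNReal.ofReal_sum_of_nonneg
      (fun k _ => by positivity)]
    refine Finset.sum_congr rfl fun k _ => ?_
    rw [poissonMeasure_singleton, Real.coe_toNNReal _ hr]
    congr 1
    ring
  have h2 : Ici K = (Finset.range K : Set ℕ)ᶜ := by ext; simp
  rw [h2, prob_compl_eq_one_sub (Finset.measurableSet _), h1,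
    ENNReal.ofReal_sub _ (poissonBelow_nonneg K hr), ENNReal.ofReal_one]

/-- The fundamental theorem of calculus for a nonnegative derivative. -/
lemma lintegral_Ioc_of_hasDerivAt {F f : ℝ → ℝ} {a b : ℝ} (hab : a ≤ b)
    (hF : ∀ t ∈ Icc a b, HasDerivAt F (f t) t) (hf : ContinuousOn f (Icc a b))
    (h0 : ∀ t ∈ Icc a b, 0 ≤ f t) :
    ∫⁻ t in Ioc a b, ENNReal.ofReal (f t) = ENNReal.ofReal (F b - F a) := by
  have hint : IntervalIntegrable f volume a b := by
    apply ContinuousOn.intervalIntegrable; rwa [uIcc_of_le hab]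
  rw [← intervalIntegral.integral_eq_sub_of_hasDerivAt (by rwa [uIcc_of_le hab]) hint,
    intervalIntegral.integral_of_le hab, ofReal_integral_eq_lintegral_ofReal
      ((intervalIntegrable_iff_integrableOn_Ioc_of_le hab).1 hint)]
  exact (ae_restrict_iff' measurableSet_Ioc).2 (ae_of_all _ fun t ht => h0 t ⟨ht.1.le, ht.2⟩)

/-- The density of the `K`-th largest point of a Poisson process with tail `Λ` and density `ℓ`. -/
noncomputable def kthDensity (Λ ℓ : ℝ → ℝ) (K : ℕ) : ℝ → ℝ :=
  (Ioi 0).indicator fun t => Real.exp (-Λ t) * ℓ t * (Λ t ^ (K - 1) / ((K - 1)! : ℝ))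

/-- The joint density of the largest and the `K`-th largest point of a Poisson process with tail
`Λ` and density `ℓ`. -/
noncomputable def jointDensity (Λ ℓ : ℝ → ℝ) (K : ℕ) : ℝ × ℝ → ℝ :=
  {p | 0 < p.2 ∧ p.2 < p.1}.indicator fun p =>
    ℓ p.2 * ℓ p.1 * Real.exp (-Λ p.2) * ((Λ p.2 - Λ p.1) ^ (K - 2) / ((K - 2)! : ℝ))

namespace HasTail

variable {ν : Measure ℝ} {Λ ℓ : ℝ → ℝ} (hν : HasTail ν Λ ℓ)
include hν

lemma continuousOn_tail : ContinuousOn Λ (Ioi 0) := fun t ht =>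
  (hν.hasDerivAt t ht).continuousAt.continuousWithinAt

lemma tail_antitone {x y : ℝ} (hy : 0 < y) (hyx : y ≤ x) : Λ x ≤ Λ y := by
  have := measure_mono (μ := ν) (Ioi_subset_Ioi hyx)
  rwa [hν.tail x (hy.trans_le hyx), hν.tail y hy,
    ENNReal.ofReal_le_ofReal_iff (hν.tail_nonneg y hy)] at this

lemma measure_Ioc {x y : ℝ} (hy : 0 < y) (hyx : y ≤ x) :
    ν (Ioc y x) = ENNReal.ofReal (Λ y - Λ x) := by
  have hx := hy.trans_le hyx
  have h1 : ν (Ioi y) = ν (Ioc y x) + ν (Ioi x) := by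
    have hdisj : Disjoint (Ioc y x) (Ioi x) :=
      disjoint_left.2 fun s hs hs' => absurd hs.2 (not_le.2 hs')
    rw [← measure_union hdisj measurableSet_Ioi, Ioc_union_Ioi_eq_Ioi hyx]
  rw [hν.tail y hy, hν.tail x hx] at h1
  rw [ENNReal.ofReal_sub _ (hν.tail_nonneg x hx), h1,
    ENNReal.add_sub_cancel_right ENNReal.ofReal_ne_top]

lemma measurable_kthDensity (K : ℕ) : Measurable (kthDensity Λ ℓ K) := by
  classical
  have hc := hν.continuousOn_tail
  have hl := hν.continuousOn
  have : ContinuousOn (fun t => Real.exp (-Λ t) * ℓ t * (Λ t ^ (K - 1) / ((K - 1)! : ℝ)))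
      (Ioi 0) := by
    fun_prop
  rw [kthDensity, ← piecewise_eq_indicator]
  exact this.measurable_piecewise continuousOn_const measurableSet_Ioi

lemma measurable_jointDensity (K : ℕ) : Measurable (jointDensity Λ ℓ K) := by
  classical
  have hS : MeasurableSet {p : ℝ × ℝ | 0 < p.2 ∧ p.2 < p.1} :=
    (measurableSet_lt measurable_const measurable_snd).inter
      (measurableSet_lt measurable_snd measurable_fst)
  have c1 : ContinuousOn (fun p : ℝ × ℝ => Λ p.1) {p | 0 < p.2 ∧ p.2 < p.1} :=
    hν.continuousOn_tail.comp continuousOn_fst fun p hp => hp.1.trans hp.2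
  have c2 : ContinuousOn (fun p : ℝ × ℝ => Λ p.2) {p | 0 < p.2 ∧ p.2 < p.1} :=
    hν.continuousOn_tail.comp continuousOn_snd fun p hp => hp.1
  have c3 : ContinuousOn (fun p : ℝ × ℝ => ℓ p.1) {p | 0 < p.2 ∧ p.2 < p.1} :=
    hν.continuousOn.comp continuousOn_fst fun p hp => hp.1.trans hp.2
  have c4 : ContinuousOn (fun p : ℝ × ℝ => ℓ p.2) {p | 0 < p.2 ∧ p.2 < p.1} :=
    hν.continuousOn.comp continuousOn_snd fun p hp => hp.1
  have : ContinuousOn (fun p : ℝ × ℝ => ℓ p.2 * ℓ p.1 * Real.exp (-Λ p.2) *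
      ((Λ p.2 - Λ p.1) ^ (K - 2) / ((K - 2)! : ℝ))) {p | 0 < p.2 ∧ p.2 < p.1} :=
    ((c4.mul c3).mul (Real.continuous_exp.comp_continuousOn c2.neg)).mul
      (((c2.sub c1).pow _).div_const _)
  rw [jointDensity, ← piecewise_eq_indicator]
  exact this.measurable_piecewise continuousOn_const hS

lemma lintegral_kthDensity {K : ℕ} (hK : 1 ≤ K) {x y : ℝ} (hy : 0 < y) (hyx : y ≤ x) :
    ∫⁻ t in Ioc y x, ENNReal.ofReal (kthDensity Λ ℓ K t) =
      ENNReal.ofReal (poissonBelow K (Λ x) - poissonBelow K (Λ y)) := by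
  obtain ⟨k, rfl⟩ := Nat.exists_eq_add_of_le' hK
  have hsub : Icc y x ⊆ Ioi 0 := fun t ht => hy.trans_le ht.1
  have hc := hν.continuousOn_tail.mono hsub
  have hl := hν.continuousOn.mono hsub
  refine lintegral_Ioc_of_hasDerivAt (F := fun t => poissonBelow (k + 1) (Λ t)) hyx
    (fun t ht => ?_) ?_ fun t ht => ?_
  · rw [kthDensity, indicator_of_mem (hsub ht)]
    convert! (hasDerivAt_poissonBelow k (Λ t)).comp t (hν.hasDerivAt t (hsub ht)) using 1
    rw [Nat.add_sub_cancel]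
    ring
  · exact ContinuousOn.congr (f := fun t => Real.exp (-Λ t) * ℓ t * (Λ t ^ k / (k ! : ℝ)))
      (by fun_prop) fun t ht => by rw [kthDensity, indicator_of_mem (hsub ht)]; rfl
  · have h1 := hν.nonneg t (hsub ht)
    have h2 := hν.tail_nonneg t (hsub ht)
    rw [kthDensity, indicator_of_mem (hsub ht)]
    positivity

lemma lintegral_jointDensity {K : ℕ} (hK : 2 ≤ K) {x y : ℝ} (hy : 0 < y) (hyx : y ≤ x) :
    ∫⁻ p in Iic x ×ˢ Ioi y, ENNReal.ofReal (jointDensity Λ ℓ K p) =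
      ENNReal.ofReal (Real.exp (-Λ x)) * ENNReal.ofReal (1 - poissonBelow K (Λ y - Λ x)) := by
  obtain ⟨k, rfl⟩ := Nat.exists_eq_add_of_le' hK
  have hx := hy.trans_le hyx
  have hm := (hν.measurable_jointDensity (k + 2)).ennreal_ofReal
  -- the integral over the largest point
  have inner : ∀ u ∈ Ioc y x, ∫⁻ v in Iic x, ENNReal.ofReal (jointDensity Λ ℓ (k + 2) (v, u)) =
      ENNReal.ofReal (ℓ u * Real.exp (-Λ u) * ((Λ u - Λ x) ^ (k + 1) / ((k + 1)! : ℝ))) := by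
    intro u hu
    have hu0 : 0 < u := hy.trans hu.1
    have hsub : Icc u x ⊆ Ioi 0 := fun t ht => hu0.trans_le ht.1
    have hc := hν.continuousOn_tail.mono hsub
    have hl := hν.continuousOn.mono hsub
    have hlu := hν.nonneg u hu0
    have e1 : ∫⁻ v in Iic x, ENNReal.ofReal (jointDensity Λ ℓ (k + 2) (v, u)) =
        ∫⁻ v in Ioc u x, ENNReal.ofReal
          (ℓ u * ℓ v * Real.exp (-Λ u) * ((Λ u - Λ v) ^ k / (k ! : ℝ))) := by
      rw [← lintegral_indicator measurableSet_Iic, ← lintegral_indicator measurableSet_Ioc]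
      refine lintegral_congr fun v => ?_
      by_cases h1 : u < v <;> by_cases h2 : v ≤ x <;>
        simp [indicator_apply, jointDensity, h1, h2, hu0]
    have e2 := lintegral_Ioc_of_hasDerivAt
      (F := fun v => ℓ u * Real.exp (-Λ u) * ((Λ u - Λ v) ^ (k + 1) / ((k + 1)! : ℝ)))
      (f := fun v => ℓ u * ℓ v * Real.exp (-Λ u) * ((Λ u - Λ v) ^ k / (k ! : ℝ))) hu.2
      (fun v hv => by
        convert! ((hasDerivAt_pow_div_factorial k (Λ u - Λ v)).comp v
          ((hν.hasDerivAt v (hsub hv)).const_sub (Λ u))).const_mul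
            (ℓ u * Real.exp (-Λ u)) using 1
        ring) (by fun_prop) (fun v hv => by
          have := hν.nonneg v (hsub hv)
          have := sub_nonneg.2 (hν.tail_antitone hu0 hv.1)
          positivity)
    rw [e1, e2]
    congr 1
    simp
  have hsub : Icc y x ⊆ Ioi 0 := fun t ht => hy.trans_le ht.1
  have hc := hν.continuousOn_tail.mono hsub
  have hl := hν.continuousOn.mono hsub
  have outer : ∫⁻ u in Ioc y x, ENNReal.ofReal
      (ℓ u * Real.exp (-Λ u) * ((Λ u - Λ x) ^ (k + 1) / ((k + 1)! : ℝ))) =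
      ENNReal.ofReal (Real.exp (-Λ x) * (1 - poissonBelow (k + 2) (Λ y - Λ x))) := by
    rw [lintegral_Ioc_of_hasDerivAt
      (F := fun u => Real.exp (-Λ x) * poissonBelow (k + 2) (Λ u - Λ x)) hyx
      (fun u hu => by
        convert! ((hasDerivAt_poissonBelow (k + 1) (Λ u - Λ x)).comp u
          ((hν.hasDerivAt u (hsub hu)).sub_const (Λ x))).const_mul (Real.exp (-Λ x)) using 1
        have : Real.exp (-Λ u) = Real.exp (-Λ x) * Real.exp (-(Λ u - Λ x)) := by
          rw [← Real.exp_add]; congr 1; ring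
        rw [this]
        ring) (by fun_prop) fun u hu => by
          have := hν.nonneg u (hsub hu)
          have := sub_nonneg.2 (hν.tail_antitone (hsub hu) hu.2)
          positivity]
    rw [sub_self, poissonBelow_zero (by omega), mul_sub]
  rw [← ENNReal.ofReal_mul (Real.exp_pos _).le, ← outer,
    ← lintegral_indicator (measurableSet_Iic.prod measurableSet_Ioi), Measure.volume_eq_prod,
    lintegral_prod_symm _ (hm.indicator (measurableSet_Iic.prod measurableSet_Ioi)).aemeasurable,
    ← lintegral_indicator measurableSet_Ioc]
  refine lintegral_congr fun u => ?_
  by_cases hu : u ∈ Ioc y x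
  · rw [indicator_of_mem hu, ← inner u hu, ← lintegral_indicator measurableSet_Iic]
    refine lintegral_congr fun v => ?_
    by_cases hv : v ≤ x <;> simp [hv, hu.1]
  · rw [indicator_of_notMem hu]
    refine (lintegral_congr fun v => ?_).trans lintegral_zero
    simp only [indicator_apply, jointDensity, mem_prod, mem_Iic, mem_Ioi,
      mem_ofPred_eq]
    split_ifs with h1 h2
    · exact absurd ⟨h1.2, h2.2.le.trans h1.1⟩ hu
    · exact ENNReal.ofReal_zero
    · rfl

end HasTail

/-- For an almost surely positive `f`, levels of `f` near zero may be cut off. -/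
lemma tendsto_measure_inter_Ioi_zero {S : Type*} [MeasurableSpace S] (μ : Measure S) (A : Set S)
    (f : S → ℝ) (hf : μ {s | f s ≤ 0} = 0) :
    Tendsto (fun n : ℕ => μ (A ∩ {s | 1 / ((n : ℝ) + 1) < f s})) atTop (𝓝 (μ A)) := by
  have h1 : μ A = μ (⋃ n : ℕ, A ∩ {s | 1 / ((n : ℝ) + 1) < f s}) := by
    refine measure_congr ?_
    filter_upwards [measure_eq_zero_iff_ae_notMem.1 hf] with s hs
    refine propext ⟨fun hA => ?_, fun hs => ?_⟩
    · obtain ⟨n, hn⟩ := exists_nat_one_div_lt (not_le.1 hs)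
      exact mem_iUnion.2 ⟨n, hA, hn⟩
    · obtain ⟨n, hn⟩ := mem_iUnion.1 hs
      exact hn.1
  rw [h1]
  exact tendsto_measure_iUnion_atTop fun n m hnm s hs =>
    ⟨hs.1, show 1 / ((m : ℝ) + 1) < f s from (Nat.one_div_le_one_div hnm).trans_lt hs.2⟩

namespace HasPoissonLaplace

variable {Ω : Type*} [MeasurableSpace Ω] {t : ℕ → Ω → ℝ} {ν : Measure ℝ} {Λ ℓ : ℝ → ℝ}
  {Pr : Measure Ω} [IsProbabilityMeasure Pr] (h : HasPoissonLaplace t ν Pr) (hν : HasTail ν Λ ℓ)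
include h hν

lemma measure_lt_orderedTerm {K : ℕ} (hK : 1 ≤ K) {y : ℝ} (hy : 0 < y) :
    Pr {ω | y < orderedTerm K (fun i => t i ω)} = ENNReal.ofReal (1 - poissonBelow K (Λ y)) := by
  have h1 := h.setLIntegral_counts (A := ∅) MeasurableSet.empty measurableSet_Ioi (by simp)
    (hν.tail_ne_top hy) (empty_disjoint _) (f := fun _ => 0) measurable_const (fun _ _ => rfl)
    (fun _ _ => rfl) 0 (Ici K)
  simp only [tsum_zero, expNeg_zero, setLIntegral_one, tsub_self, lintegral_zero, measure_empty,
    ENNReal.toNNReal_zero, mul_one] at h1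
  have h2 : (ν (Ioi y)).toNNReal = (Λ y).toNNReal := by rw [hν.tail y hy]; rfl
  rw [h2, poissonMeasure_Ici K (hν.tail_nonneg y hy), poissonMeasure_singleton] at h1
  simp only [NNReal.coe_zero, neg_zero, Real.exp_zero, pow_zero, Nat.factorial_zero, Nat.cast_one,
    mul_one, div_one, ENNReal.ofReal_one, one_mul] at h1
  rw [← h1]
  refine measure_congr ?_
  filter_upwards [h.ae_decreasinglyOrderable hν] with ω hω
  refine propext ?_
  change y < orderedTerm K (fun i => t i ω) ↔
    ω ∈ ⋃ l ∈ Ici K, {ω | cnt (fun i => t i ω) ∅ = (0 : ℕ) ∧ cnt (fun i => t i ω) (Ioi y) = l}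
  rw [hω.orderedTerm_eq, hω.lt_kthLargest_iff hK]
  have h0 : cnt (fun i => t i ω) ∅ = 0 := by simp [cnt]
  simp only [mem_iUnion, mem_Ici, mem_ofPred_eq, exists_prop, Nat.cast_zero, h0, true_and]
  rcases cnt_eq_top_or_natCast (fun i => t i ω) (Ioi y) with h' | ⟨k, hk⟩
  · exact absurd h' (hω.cnt_ne_top hy)
  · rw [hk]
    norm_cast
    simp

/-- The law of the `K`-th largest point. -/
theorem map_orderedTerm {K : ℕ} (hK : 1 ≤ K) :
    Pr.map (fun ω => orderedTerm K fun i => t i ω) =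
      volume.withDensity fun u => ENNReal.ofReal (kthDensity Λ ℓ K u) := by
  have hT := h.measurable_orderedTerm_comp hK
  have : IsProbabilityMeasure (Pr.map fun ω => orderedTerm K fun i => t i ω) :=
    Measure.isProbabilityMeasure_map hT.aemeasurable
  have pos : ∀ a b : ℝ, 0 < a → a < b → Pr.map (fun ω => orderedTerm K fun i => t i ω) (Ioc a b) =
      (volume.withDensity fun u => ENNReal.ofReal (kthDensity Λ ℓ K u)) (Ioc a b) := by
    intro a b ha hab
    have hb := ha.trans hab
    rw [withDensity_apply _ measurableSet_Ioc, hν.lintegral_kthDensity hK ha hab.le,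
      Measure.map_apply hT measurableSet_Ioc]
    have e1 : (fun ω => orderedTerm K fun i => t i ω) ⁻¹' Ioc a b =
        {ω | a < orderedTerm K (fun i => t i ω)} \ {ω | b < orderedTerm K (fun i => t i ω)} := by
      ext ω; simp
    have hsub : {ω | b < orderedTerm K (fun i => t i ω)} ⊆
        {ω | a < orderedTerm K (fun i => t i ω)} :=
      fun ω hω => hab.trans hω
    rw [e1, measure_sdiff hsub
      (measurableSet_lt measurable_const hT).nullMeasurableSet (measure_ne_top _ _),
      h.measure_lt_orderedTerm hν hK ha, h.measure_lt_orderedTerm hν hK hb]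
    have hle : 0 ≤ 1 - poissonBelow K (Λ b) := by
      obtain ⟨k, rfl⟩ := Nat.exists_eq_add_of_le' hK
      have := poissonMeasure_Ici (k + 1) (hν.tail_nonneg b hb)
      rw [sub_nonneg, ← poissonBelow_zero hK]
      refine (antitoneOn_of_deriv_nonpos (convex_Ici 0)
        (fun r _ => (hasDerivAt_poissonBelow k r).continuousAt.continuousWithinAt)
        (fun r _ => (hasDerivAt_poissonBelow k r).differentiableAt.differentiableWithinAt)
        fun r hr => ?_) self_mem_Ici (hν.tail_nonneg b hb) (hν.tail_nonneg b hb)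
      rw [interior_Ici] at hr
      rw [(hasDerivAt_poissonBelow k r).deriv, neg_nonpos]
      have : 0 < r := hr
      positivity
    rw [← ENNReal.ofReal_sub _ hle]
    congr 1
    ring
  have z1 : Pr.map (fun ω => orderedTerm K fun i => t i ω) {s : ℝ | id s ≤ 0} = 0 := by
    rw [Measure.map_apply hT (measurableSet_le measurable_id measurable_const)]
    refine measure_eq_zero_iff_ae_notMem.2 ?_
    filter_upwards [h.ae_decreasinglyOrderable hν] with ω hω
    rw [mem_preimage, hω.orderedTerm_eq]
    exact not_le.2 (hω.kthLargest_pos hK)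
  have z2 : (volume.withDensity fun u => ENNReal.ofReal (kthDensity Λ ℓ K u))
        {s : ℝ | id s ≤ 0} = 0 := by
    rw [withDensity_apply _ (measurableSet_le measurable_id measurable_const),
      setLIntegral_congr_fun (g := fun _ => 0) (measurableSet_le measurable_id measurable_const)
      fun u (hu : u ≤ 0) => by simp [kthDensity, hu], lintegral_zero]
  refine Measure.ext_of_Ioc _ _ fun a b hab => ?_
  refine tendsto_nhds_unique_of_eventuallyEq
    (tendsto_measure_inter_Ioi_zero _ (Ioc a b) id z1)
    (tendsto_measure_inter_Ioi_zero _ (Ioc a b) id z2) (Eventually.of_forall fun n => ?_)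
  have e1 : Ioc a b ∩ {s : ℝ | 1 / ((n : ℝ) + 1) < id s} = Ioc (max a (1 / ((n : ℝ) + 1))) b := by
    ext s; simp only [mem_inter_iff, mem_Ioc, mem_ofPred_eq, id, max_lt_iff]; tauto
  beta_reduce
  rw [e1]
  rcases lt_or_ge (max a (1 / ((n : ℝ) + 1))) b with hlt | hge
  · exact pos _ _ (lt_max_of_lt_right (by positivity)) hlt
  · rw [Ioc_eq_empty (not_lt.2 hge), measure_empty, measure_empty]

/-- The joint law of the largest and the `K`-th largest point. -/
theorem map_orderedTerm_pair {K : ℕ} (hK : 2 ≤ K) :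
    Pr.map (fun ω => (orderedTerm 1 fun i => t i ω, orderedTerm K fun i => t i ω)) =
      volume.withDensity fun p => ENNReal.ofReal (jointDensity Λ ℓ K p) := by
  have hK1 : 1 ≤ K := by omega
  have hT := h.measurable_orderedTerm_pair hK1
  have : IsProbabilityMeasure
      (Pr.map fun ω => (orderedTerm 1 fun i => t i ω, orderedTerm K fun i => t i ω)) :=
    Measure.isProbabilityMeasure_map hT.aemeasurable
  have hR : ∀ x y : ℝ, MeasurableSet (Iic x ×ˢ Ioi y : Set (ℝ × ℝ)) := fun x y =>
    measurableSet_Iic.prod measurableSet_Ioi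
  have pos : ∀ x y : ℝ, 0 < y →
      Pr.map (fun ω => (orderedTerm 1 fun i => t i ω, orderedTerm K fun i => t i ω))
        (Iic x ×ˢ Ioi y) =
      (volume.withDensity fun p => ENNReal.ofReal (jointDensity Λ ℓ K p)) (Iic x ×ˢ Ioi y) := by
    intro x y hy
    rw [withDensity_apply _ (hR x y), Measure.map_apply hT (hR x y)]
    rcases lt_or_ge y x with hyx | hxy
    · have hx := hy.trans hyx
      rw [hν.lintegral_jointDensity hK hy hyx.le]
      refine (h.measure_orderedTerm hν hK1 hy hyx).trans ?_
      have e1 : (ν (Ioi x)).toNNReal = (Λ x).toNNReal := by rw [hν.tail x hx]; rfl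
      have e2 : (ν (Ioc y x)).toNNReal = (Λ y - Λ x).toNNReal := by
        rw [hν.measure_Ioc hy hyx.le]; rfl
      rw [e1, e2, poissonMeasure_Ici K (sub_nonneg.2 (hν.tail_antitone hy hyx.le)),
        poissonMeasure_singleton, Real.coe_toNNReal _ (hν.tail_nonneg x hx)]
      simp
    · rw [setLIntegral_congr_fun (g := fun _ => 0) (hR x y), lintegral_zero]
      · refine measure_eq_zero_iff_ae_notMem.2 ?_
        filter_upwards [h.ae_decreasinglyOrderable hν] with ω hω
        rw [mem_preimage, hω.orderedTerm_eq, hω.orderedTerm_eq]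
        exact fun hm => not_lt.2 ((hω.kthLargest_le_one hK1).trans (hm.1.trans hxy)) hm.2
      · rintro ⟨v, u⟩ ⟨hv, hu⟩
        have : ¬ u < v := not_lt.2 ((le_trans hv hxy).trans (le_of_lt hu))
        simp [jointDensity, this]
  have z1 : Pr.map (fun ω => (orderedTerm 1 fun i => t i ω, orderedTerm K fun i => t i ω))
      {p | p.2 ≤ 0} = 0 := by
    rw [Measure.map_apply hT (measurableSet_le measurable_snd measurable_const)]
    refine measure_eq_zero_iff_ae_notMem.2 ?_
    filter_upwards [h.ae_decreasinglyOrderable hν] with ω hω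
    rw [mem_preimage, hω.orderedTerm_eq, hω.orderedTerm_eq]
    exact not_le.2 (hω.kthLargest_pos hK1)
  have z2 : (volume.withDensity fun p => ENNReal.ofReal (jointDensity Λ ℓ K p))
      {p | p.2 ≤ 0} = 0 := by
    rw [withDensity_apply _ (measurableSet_le measurable_snd measurable_const),
      setLIntegral_congr_fun (g := fun _ => 0) (measurableSet_le measurable_snd measurable_const)
      fun p (hp : p.2 ≤ 0) => by simp [jointDensity, hp.not_gt], lintegral_zero]
  refine measure_ext_of_Iic_prod_Ioi fun x y => ?_
  refine tendsto_nhds_unique_of_eventuallyEq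
    (tendsto_measure_inter_Ioi_zero _ (Iic x ×ˢ Ioi y) Prod.snd z1)
    (tendsto_measure_inter_Ioi_zero _ (Iic x ×ˢ Ioi y) Prod.snd z2)
    (Eventually.of_forall fun n => ?_)
  have e1 : (Iic x ×ˢ Ioi y : Set (ℝ × ℝ)) ∩ {s | 1 / ((n : ℝ) + 1) < s.2} =
      Iic x ×ˢ Ioi (max y (1 / ((n : ℝ) + 1))) := by
    ext s; simp [and_assoc]
  beta_reduce
  rw [e1]
  exact pos _ _ (lt_max_of_lt_right (by positivity))

end HasPoissonLaplace

namespace Params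

variable {M : ℕ} [NeZero M] (a : Params M)

/-- The derivatives in the definition of the density are evaluated: `-Λ'` is the density of the link
powers. -/
lemma kthPdf_eq (m : Fin M) (K : ℕ) : a.kthPdf (a.density m) K =
    kthDensity (a.intensity (a.density m)) (a.linkDensity m) K := by
  ext t
  by_cases ht : 0 < t
  · rw [kthPdf, if_pos ht, kthDensity, indicator_of_mem (show t ∈ Ioi 0 from ht),
      (a.hasDerivAt_intensityL m ht).deriv, (a.hasDerivAt_intensityN m ht).deriv, linkDensity_eq,
      intensity, neg_add, Real.exp_add]
    ring
  · rw [kthPdf, if_neg ht, kthDensity, indicator_of_notMem (show t ∉ Ioi 0 from ht)]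

lemma jointPdf_eq (m : Fin M) (K : ℕ) (t₁ tK : ℝ) : a.jointPdf (a.density m) K t₁ tK =
    jointDensity (a.intensity (a.density m)) (a.linkDensity m) K (t₁, tK) := by
  by_cases ht : 0 < tK ∧ tK < t₁
  · have ht1 := ht.1.trans ht.2
    rw [jointPdf, if_pos ht, jointDensity,
      indicator_of_mem (show (t₁, tK) ∈ {p : ℝ × ℝ | 0 < p.2 ∧ p.2 < p.1} from ht),
      (a.hasDerivAt_intensityL m ht.1).deriv, (a.hasDerivAt_intensityN m ht.1).deriv,
      (a.hasDerivAt_intensityL m ht1).deriv, (a.hasDerivAt_intensityN m ht1).deriv]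
    simp only [linkDensity_eq, intensity]
    rw [neg_add (a.intensityL _ tK), Real.exp_add, add_sub_add_comm]
    ring
  · rw [jointPdf, if_neg ht, jointDensity,
      indicator_of_notMem (show (t₁, tK) ∉ {p : ℝ × ℝ | 0 < p.2 ∧ p.2 < p.1} from ht)]

end Params

/-! ### Fading powers and antenna gains -/

/-- Independent variables can be integrated one after the other. -/
lemma _root_.ProbabilityTheory.IndepFun.lintegral_comp_prod {Ω S S' : Type*} [MeasurableSpace Ω]
    [MeasurableSpace S] [MeasurableSpace S'] {Pr : Measure Ω} [IsFiniteMeasure Pr] {U : Ω → S}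
    {V : Ω → S'} (h : IndepFun U V Pr) (hU : Measurable U) (hV : Measurable V)
    {f : S × S' → ℝ≥0∞} (hf : Measurable f) :
    ∫⁻ ω, f (U ω, V ω) ∂Pr = ∫⁻ ω, ∫⁻ ω', f (U ω, V ω') ∂Pr ∂Pr := by
  have h1 := (indepFun_iff_map_prod_eq_prod_map_map hU.aemeasurable hV.aemeasurable).1 h
  have h2 : ∀ u, ∫⁻ v, f (u, v) ∂(Pr.map V) = ∫⁻ ω', f (u, V ω') ∂Pr := fun u =>
    lintegral_map (hf.comp measurable_prodMk_left) hV
  rw [← lintegral_map hf (hU.prodMk hV), h1, lintegral_prod _ hf.aemeasurable,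
    lintegral_map (f := fun u => ∫⁻ v, f (u, v) ∂(Pr.map V)) hf.lintegral_prod_right' hU]
  simp_rw [h2]

/-- Disjoint, possibly infinite, subfamilies of an independent family are independent. -/
lemma _root_.ProbabilityTheory.iIndepFun.indepFun_of_disjoint {Ω ι : Type*} [MeasurableSpace Ω]
    {S : ι → Type*} [∀ i, MeasurableSpace (S i)] {Pr : Measure Ω} {X : ∀ i, Ω → S i}
    (h : iIndepFun X Pr) (hX : ∀ i, Measurable (X i)) {A B : Set ι} (hAB : Disjoint A B) :
    IndepFun (fun ω (i : A) => X i ω) (fun ω (i : B) => X i ω) Pr := by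
  have key := indep_iSup_of_disjoint (fun i => (hX i).comap_le) h hAB
  have aux : ∀ C : Set ι, MeasurableSpace.comap (fun ω (i : C) => X i ω) inferInstance ≤
      ⨆ i ∈ C, MeasurableSpace.comap (X i) inferInstance := by
    intro C
    refine Measurable.comap_le (m₁ := ⨆ i ∈ C, MeasurableSpace.comap (X i) inferInstance) ?_
    refine @measurable_pi_lambda _ _ _ (_) _ _ fun i => ?_
    refine Measurable.mono (comap_measurable (X i)) ?_ le_rfl
    exact le_iSup₂ (f := fun i (_ : i ∈ C) => MeasurableSpace.comap (X i) inferInstance) i.1 i.2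
  exact indep_of_indep_of_le_left (indep_of_indep_of_le_right key (aux B)) (aux A)

lemma expMeasure_eq (r : ℝ) : expMeasure r = volume.withDensity (exponentialPDF r) := rfl

lemma measurable_exponentialPDF (r : ℝ) : Measurable (exponentialPDF r) :=
  (measurable_exponentialPDFReal r).ennreal_ofReal

/-- The Laplace transform of the exponential distribution. -/
lemma lintegral_expNeg_expMeasure {c : ℝ} (hc : 0 ≤ c) :
    ∫⁻ x, expNeg (ENNReal.ofReal (c * x)) ∂expMeasure 1 = ENNReal.ofReal (1 / (1 + c)) := by
  have hm : Measurable fun x : ℝ => expNeg (ENNReal.ofReal (c * x)) := by fun_prop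
  rw [expMeasure_eq, lintegral_withDensity_eq_lintegral_mul _ (measurable_exponentialPDF 1) hm]
  have h1 : ∀ x, (exponentialPDF 1 * fun x : ℝ => expNeg (ENNReal.ofReal (c * x))) x =
      ENNReal.ofReal (1 / (1 + c)) * exponentialPDF (1 + c) x := by
    intro x
    rcases lt_or_ge x 0 with hx | hx
    · simp [exponentialPDF_of_neg hx]
    · rw [Pi.mul_apply, exponentialPDF_of_nonneg hx, exponentialPDF_of_nonneg hx,
        expNeg_ofReal (mul_nonneg hc hx), ← ENNReal.ofReal_mul (by positivity),
        ← ENNReal.ofReal_mul (by positivity)]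
      congr 1
      have : (1 + c) ≠ 0 := by positivity
      rw [one_mul, ← Real.exp_add]
      field_simp
      ring_nf
  rw [lintegral_congr h1, lintegral_const_mul _ (measurable_exponentialPDF _),
    lintegral_exponentialPDF_eq_one (by positivity), mul_one]

/-- The tail of the exponential distribution. -/
lemma expMeasure_lt (z : ℝ≥0∞) : expMeasure 1 {x | z < ENNReal.ofReal x} = expNeg z := by
  have hP : IsProbabilityMeasure (expMeasure 1) := isProbabilityMeasure_expMeasure one_pos
  induction z with
  | top => simp
  | coe z =>
    have h1 : {x : ℝ | (z : ℝ≥0∞) < ENNReal.ofReal x} = (Iic (z : ℝ))ᶜ := by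
      ext x
      rw [mem_ofPred_eq, ← ENNReal.ofReal_coe_nnreal, compl_Iic, mem_Ioi]
      exact ENNReal.ofReal_lt_ofReal_iff_of_nonneg z.2
    rw [h1, prob_compl_eq_one_sub measurableSet_Iic, ← ofReal_cdf, cdf_expMeasure_eq one_pos,
      if_pos (NNReal.coe_nonneg z), expNeg_coe, one_mul, ENNReal.ofReal_sub _ (Real.exp_pos _).le,
      ENNReal.ofReal_one]
    exact ENNReal.sub_sub_cancel ENNReal.one_ne_top
      (ENNReal.ofReal_le_one.2 (Real.exp_le_one_iff.2 (neg_nonpos.2 z.2)))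

/-- The probability that an exponential variable exceeds an independent one. -/
lemma measure_lt_exp {Ω : Type*} [MeasurableSpace Ω] {Pr : Measure Ω} [IsProbabilityMeasure Pr]
    {H : ℕ → Ω → ℝ} (hH : ∀ i, Measurable (H i)) (hlaw : ∀ i, HasLaw (H i) (expMeasure 1) Pr)
    (hind : iIndepFun H Pr) (i : ℕ) {Z : (ℕ → ℝ) → ℝ≥0∞} (hZ : Measurable Z)
    (hZi : ∀ x y : ℕ → ℝ, (∀ j, j ≠ i → x j = y j) → Z x = Z y) :
    Pr {ω | Z (fun j => H j ω) < ENNReal.ofReal (H i ω)} =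
      ∫⁻ ω, expNeg (Z fun j => H j ω) ∂Pr := by
  set e : (({i}ᶜ : Set ℕ) → ℝ) → ℕ → ℝ := fun y j => if h : j ∈ ({i}ᶜ : Set ℕ) then y ⟨j, h⟩ else 0
    with he
  have hem : Measurable e := by
    refine measurable_pi_lambda _ fun j => ?_
    by_cases hj : j ∈ ({i}ᶜ : Set ℕ)
    · simp only [he, dif_pos hj]; exact measurable_pi_apply _
    · simp only [he, dif_neg hj]; exact measurable_const
  set Y : Ω → ({i}ᶜ : Set ℕ) → ℝ := fun ω j => H j ω with hY
  have hYm : Measurable Y := measurable_pi_lambda _ fun j => hH j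
  have hYZ : ∀ ω, Z (fun j => H j ω) = Z (e (Y ω)) := fun ω => hZi _ _ fun j hj => by
    simp [he, hY, hj]
  have hXm : Measurable fun ω (j : ({i} : Set ℕ)) => H j ω := measurable_pi_lambda _ fun j => hH j
  have hI : IndepFun Y (H i) Pr := ((hind.indepFun_of_disjoint hH
    (A := {i}ᶜ) (B := {i}) (disjoint_compl_left)).comp measurable_id
      (measurable_pi_apply (⟨i, rfl⟩ : ({i} : Set ℕ))))
  have hSm : MeasurableSet {p : (({i}ᶜ : Set ℕ) → ℝ) × ℝ | Z (e p.1) < ENNReal.ofReal p.2} :=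
    measurableSet_lt (hZ.comp (hem.comp measurable_fst)) measurable_snd.ennreal_ofReal
  have hE : Pr {ω | Z (fun j => H j ω) < ENNReal.ofReal (H i ω)} =
      ∫⁻ ω, {p : (({i}ᶜ : Set ℕ) → ℝ) × ℝ | Z (e p.1) < ENNReal.ofReal p.2}.indicator 1
        (Y ω, H i ω) ∂Pr := by
    rw [← lintegral_indicator_one]
    · refine lintegral_congr fun ω => ?_
      simp [indicator_apply, hYZ]
    · simp_rw [hYZ]
      exact measurableSet_lt (hZ.comp (hem.comp hYm)) (hH i).ennreal_ofReal
  rw [hE, hI.lintegral_comp_prod hYm (hH i) (measurable_one.indicator hSm)]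
  refine lintegral_congr fun ω => ?_
  rw [hYZ, ← expMeasure_lt, ← (hlaw i).map_eq, Measure.map_apply (hH i)
    (measurableSet_lt measurable_const ENNReal.measurable_ofReal), ← lintegral_indicator_one
      (hH i (measurableSet_lt measurable_const ENNReal.measurable_ofReal))]
  rfl

/-- The main lobe has probability `1 / N` for a uniform angle. -/
lemma cond_volume_abs_le {N : ℕ} (hN : 1 ≤ N) :
    (cond volume (Ioc (-Real.pi) Real.pi) : Measure ℝ) {θ | |θ| ≤ Real.pi / N} =
      ENNReal.ofReal (1 / N) := by
  have hpi := Real.pi_pos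
  have hN' : (1 : ℝ) ≤ N := by exact_mod_cast hN
  have hle : Real.pi / N ≤ Real.pi := div_le_self hpi.le hN'
  have h0 : 0 < Real.pi / N := by positivity
  have h1 : (volume (Ioc (-Real.pi) Real.pi ∩ {θ : ℝ | |θ| ≤ Real.pi / N})) =
      ENNReal.ofReal (2 * (Real.pi / N)) := by
    have e1 : (Ioc (-(Real.pi / N)) (Real.pi / N) : Set ℝ) ⊆
        Ioc (-Real.pi) Real.pi ∩ {θ : ℝ | |θ| ≤ Real.pi / N} := fun θ hθ =>
      ⟨⟨by linarith [hθ.1], hθ.2.trans hle⟩, abs_le.2 ⟨hθ.1.le, hθ.2⟩⟩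
    have e2 : Ioc (-Real.pi) Real.pi ∩ {θ : ℝ | |θ| ≤ Real.pi / N} ⊆
        Icc (-(Real.pi / N)) (Real.pi / N) := fun θ hθ => abs_le.1 hθ.2
    refine le_antisymm ((measure_mono e2).trans_eq ?_) (Eq.trans_le ?_ (measure_mono e1))
    · rw [Real.volume_Icc]; congr 1; ring
    · rw [Real.volume_Ioc]; congr 1; ring
  rw [cond_apply measurableSet_Ioc, h1, Real.volume_Ioc, ← ENNReal.ofReal_inv_of_pos (by linarith),
    ← ENNReal.ofReal_mul (inv_nonneg.2 (by linarith))]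
  congr 1
  field_simp
  ring

namespace Params

variable {M : ℕ} [NeZero M] (a : Params M)

lemma G_pos : 0 < a.G := a.mainLobeGain_pos

lemma g_nonneg : 0 ≤ a.g := a.ε_nonneg

lemma sectorGain_nonneg (θ : ℝ) : 0 ≤ a.sectorGain θ := by
  unfold sectorGain
  split_ifs
  exacts [a.G_pos.le, a.g_nonneg]

lemma measurableSet_mainLobe : MeasurableSet {θ : ℝ | |θ| ≤ Real.pi / a.N} :=
  measurableSet_le continuous_abs.measurable measurable_const

lemma measurable_sectorGain : Measurable a.sectorGain :=
  Measurable.ite a.measurableSet_mainLobe measurable_const measurable_const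

lemma lintegral_comp_sectorGain (F : ℝ → ℝ≥0∞) :
    ∫⁻ θ, F (a.sectorGain θ) ∂(cond volume (Ioc (-Real.pi) Real.pi)) =
      ENNReal.ofReal (1 / a.N) * F a.G + ENNReal.ofReal (1 - 1 / a.N) * F a.g := by
  have hP : IsProbabilityMeasure (cond volume (Ioc (-Real.pi) Real.pi) : Measure ℝ) := by
    refine cond_isProbabilityMeasure_of_finite ?_ ?_ <;> rw [Real.volume_Ioc] <;> simp [Real.pi_pos]
  have hm := a.measurableSet_mainLobe
  rw [← lintegral_add_compl _ hm,
    setLIntegral_congr_fun (g := fun _ => F a.G) hm fun θ (hθ : |θ| ≤ _) => by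
      simp only [sectorGain, if_pos hθ],
    setLIntegral_congr_fun (g := fun _ => F a.g) hm.compl fun θ (hθ : ¬ |θ| ≤ _) => by
      simp only [sectorGain, if_neg hθ],
    setLIntegral_const, setLIntegral_const, prob_compl_eq_one_sub hm, cond_volume_abs_le a.one_le_N,
    mul_comm, mul_comm (F a.g), ENNReal.ofReal_sub _ (div_nonneg zero_le_one (Nat.cast_nonneg a.N)),
    ENNReal.ofReal_one]

/-- The Laplace transform at `c` of the product of antenna gain and fading power of a link. -/
noncomputable def gainLaplace (c : ℝ) : ℝ :=
  1 / a.N * (1 / (1 + c * a.G)) + (1 - 1 / a.N) * (1 / (1 + c * a.g))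

lemma one_div_N_le_one : 1 / (a.N : ℝ) ≤ 1 := by
  have : (1 : ℝ) ≤ a.N := by exact_mod_cast a.one_le_N
  exact div_le_one_of_le₀ this (by positivity)

lemma one_sub_gainLaplace {c : ℝ} (hc : 0 ≤ c) : 1 - a.gainLaplace c =
    1 / a.N * (c * a.G / (1 + c * a.G)) + (1 - 1 / a.N) * (c * a.g / (1 + c * a.g)) := by
  have h1 : 1 + c * a.G ≠ 0 := by have := a.G_pos; positivity
  have h2 : 1 + c * a.g ≠ 0 := by have := a.g_nonneg; positivity
  have e1 : c * a.G / (1 + c * a.G) = 1 - 1 / (1 + c * a.G) := by field_simp; ring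
  have e2 : c * a.g / (1 + c * a.g) = 1 - 1 / (1 + c * a.g) := by field_simp; ring
  rw [e1, e2, gainLaplace]
  ring

lemma gainLaplace_nonneg {c : ℝ} (hc : 0 ≤ c) : 0 ≤ a.gainLaplace c := by
  have h1 := a.G_pos
  have h2 := a.g_nonneg
  have h3 := sub_nonneg.2 a.one_div_N_le_one
  unfold gainLaplace
  positivity

lemma gainLaplace_le_one {c : ℝ} (hc : 0 ≤ c) : a.gainLaplace c ≤ 1 := by
  have h1 := a.G_pos
  have h2 := a.g_nonneg
  have h3 := sub_nonneg.2 a.one_div_N_le_one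
  rw [← sub_nonneg, a.one_sub_gainLaplace hc]
  positivity

lemma measurable_gainLaplace : Measurable a.gainLaplace := by
  unfold gainLaplace; fun_prop

end Params

namespace Network

variable {M : ℕ} [NeZero M] {a : Params M} {Ω : Type*} [MeasurableSpace Ω] {Pr : Measure Ω}
  [IsProbabilityMeasure Pr] (net : Network a Pr)

/-- Averaging over the fading powers and the angles of departure replaces them by an additive
functional of the link powers. -/
lemma lintegral_expNeg_marks (m : Fin M) {c : ℕ → ℝ} (hc : ∀ i, 0 ≤ c i) :
    ∫⁻ ω, expNeg (∑' i, ENNReal.ofReal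
        (c i * (a.sectorGain (net.angle m i ω) * net.fading m i ω))) ∂Pr =
      expNeg (∑' i, negLog (ENNReal.ofReal (a.gainLaplace (c i)))) := by
  have hH := net.fading_measurable m
  have hθ := net.angle_measurable m
  have hg := a.measurable_sectorGain
  refine lintegral_expNeg_tsum_of_prod Pr (fun i => ?_)
    (fun i => ENNReal.ofReal_le_one.2 (a.gainLaplace_le_one (hc i))) fun n => ?_
  · exact (((hg.comp (hθ i)).mul (hH i)).const_mul _).ennreal_ofReal
  have hHm : Measurable fun ω i => net.fading m i ω := measurable_pi_lambda _ hH
  have hθm : Measurable fun ω i => net.angle m i ω := measurable_pi_lambda _ hθ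
  have hΦ : Measurable fun p : (ℕ → ℝ) × (ℕ → ℝ) => ∏ i ∈ Finset.range n,
      expNeg (ENNReal.ofReal (c i * (a.sectorGain (p.1 i) * p.2 i))) := by fun_prop
  have h1 := (net.fading_angle_indep m).symm.lintegral_comp_prod hθm hHm hΦ
  refine h1.trans ?_
  -- for given angles, the fading powers are independent exponential variables
  have h2 : ∀ θ : ℕ → ℝ, ∫⁻ ω, ∏ i ∈ Finset.range n, expNeg (ENNReal.ofReal
      (c i * (a.sectorGain (θ i) * net.fading m i ω))) ∂Pr =
      ∏ i ∈ Finset.range n, ENNReal.ofReal (1 / (1 + c i * a.sectorGain (θ i))) := by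
    intro θ
    have hind := (net.fading_indep m).comp
      (fun i (x : ℝ) => expNeg (ENNReal.ofReal (c i * (a.sectorGain (θ i) * x))))
      fun i => by fun_prop
    refine (lintegral_prod_eq_prod_lintegral_of_indepFun (Finset.range n) _ hind
      fun i => by fun_prop).trans (Finset.prod_congr rfl fun i _ => ?_)
    have hnn : 0 ≤ c i * a.sectorGain (θ i) := mul_nonneg (hc i) (a.sectorGain_nonneg _)
    rw [← lintegral_expNeg_expMeasure hnn, ← (net.fading_law m i).map_eq,
      lintegral_map (by fun_prop) (hH i)]
    simp only [Function.comp, mul_assoc]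
  simp_rw [h2]
  have hind := (net.angle_indep m).comp
    (fun i (x : ℝ) => ENNReal.ofReal (1 / (1 + c i * a.sectorGain x))) fun i => by fun_prop
  refine (lintegral_prod_eq_prod_lintegral_of_indepFun (Finset.range n) _ hind
    fun i => by fun_prop).trans (Finset.prod_congr rfl fun i _ => ?_)
  have h3 := sub_nonneg.2 a.one_div_N_le_one
  have h4 := a.G_pos
  have h5 := a.g_nonneg
  have h6 := hc i
  have e1 := lintegral_map (μ := Pr) (f := fun x => ENNReal.ofReal (1 / (1 + c i * a.sectorGain x)))
    (by fun_prop) (hθ i)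
  rw [(net.angle_law m i).map_eq,
    a.lintegral_comp_sectorGain fun y => ENNReal.ofReal (1 / (1 + c i * y)),
    ← ENNReal.ofReal_mul (by positivity), ← ENNReal.ofReal_mul h3,
    ← ENNReal.ofReal_add (by positivity) (by positivity)] at e1
  exact e1.symm

end Network

/-! ### Laplace transform of the interference -/

/-- The positions, link states, fading powers and angles of one operator. -/
abbrev OperatorData : Type := (ℕ → Plane) × (ℕ → Bool) × (ℕ → ℝ) × (ℕ → ℝ)

namespace Params

variable {M : ℕ} [NeZero M] (a : Params M)

lemma pathLoss_nonneg (l : Bool) {r : ℝ} (hr : 0 ≤ r) : 0 ≤ a.pathLoss l r := by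
  have h1 := a.CL_pos
  have h2 := a.CN_pos
  unfold pathLoss
  split_ifs <;> positivity

/-- The link powers, as a function of positions and link states. -/
noncomputable def powers (u : (ℕ → Plane) × (ℕ → Bool)) (i : ℕ) : ℝ := a.pathLoss (u.2 i) ‖u.1 i‖

lemma powers_nonneg (u : (ℕ → Plane) × (ℕ → Bool)) (i : ℕ) : 0 ≤ a.powers u i :=
  a.pathLoss_nonneg _ (norm_nonneg _)

lemma measurable_powers : Measurable a.powers := by
  refine measurable_pi_lambda _ fun i => ?_
  unfold powers pathLoss
  refine Measurable.ite ?_ (by fun_prop) (by fun_prop)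
  exact (measurableSet_singleton true).preimage ((measurable_pi_apply i).comp measurable_snd)

/-- The interference of operator `m`, expressed measurably through the numbers of stronger
links. -/
noncomputable def interf (m : Fin M) (d : OperatorData) : ℝ≥0∞ :=
  ∑' i, {x : ℕ → ℝ | (a.K m : ℝ≥0∞) ≤ cnt x (Ioi (x i))}.indicator (fun x => ENNReal.ofReal
    (a.power m * a.sectorGain (d.2.2.2 i) * d.2.2.1 i * x i)) (a.powers (d.1, d.2.1))

lemma measurableSet_le_cnt (K i : ℕ) :
    MeasurableSet {x : ℕ → ℝ | (K : ℝ≥0∞) ≤ cnt x (Ioi (x i))} :=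
  measurableSet_le measurable_const (measurable_cnt_Ioi_self i)

lemma measurable_interf (m : Fin M) : Measurable (a.interf m) := by
  classical
  have hp : Measurable fun d : OperatorData => a.powers (d.1, d.2.1) :=
    a.measurable_powers.comp (by fun_prop)
  have hg := a.measurable_sectorGain
  refine Measurable.tsum fun i => ?_
  simp only [indicator_apply]
  refine Measurable.ite (hp (measurableSet_le_cnt (a.K m) i)) ?_ measurable_const
  have := (measurable_pi_apply i).comp hp
  have h2 : Measurable fun d : OperatorData => a.powers (d.1, d.2.1) i := this
  fun_prop

/-- The contribution of a link of power `t` to the logarithm of the Laplace transform at `s` of the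
interference of operator `m`, given the link powers. -/
noncomputable def linkExponent (m : Fin M) (s t : ℝ) : ℝ≥0∞ :=
  negLog (ENNReal.ofReal (a.gainLaplace (s * a.power m * t)))

lemma measurable_linkExponent (m : Fin M) (s : ℝ) : Measurable (a.linkExponent m s) := by
  unfold linkExponent
  exact measurable_negLog.comp (a.measurable_gainLaplace.comp (by fun_prop)).ennreal_ofReal

lemma negLog_gainLaplace_zero : negLog (ENNReal.ofReal (a.gainLaplace 0)) = 0 := by
  simp [gainLaplace, negLog]

lemma one_sub_expNeg_linkExponent (m : Fin M) {s t : ℝ} (hs : 0 ≤ s) (ht : 0 ≤ t) :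
    1 - expNeg (a.linkExponent m s t) =
      ENNReal.ofReal (s * a.power m * a.G * t / (1 + s * a.power m * a.G * t) * (1 / a.N)) +
        ENNReal.ofReal (s * a.power m * a.g * t / (1 + s * a.power m * a.g * t) *
          (1 - 1 / a.N)) := by
  have h1 := a.G_pos
  have h2 := a.g_nonneg
  have h3 := sub_nonneg.2 a.one_div_N_le_one
  have h4 := a.power_pos m
  have hc : 0 ≤ s * a.power m * t := by positivity
  rw [linkExponent, expNeg_negLog (ENNReal.ofReal_le_one.2 (a.gainLaplace_le_one hc)),
    ← ENNReal.ofReal_one, ← ENNReal.ofReal_sub _ (a.gainLaplace_nonneg hc),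
    a.one_sub_gainLaplace hc, ← ENNReal.ofReal_add (by positivity) (by positivity)]
  congr 1
  rw [mul_right_comm _ t a.G, mul_right_comm _ t a.g]
  ring

/-- The Laplace functional of the link powers at `linkExponent` is the explicit transform. -/
lemma regionLaplace_eq (m : Fin M) {R : Set ℝ} (hR : MeasurableSet R) {s : ℝ} (hs : 0 ≤ s) :
    expNeg (∫⁻ t in R, (1 - expNeg (a.linkExponent m s t)) ∂a.linkMeasure m) =
      a.regionLaplace m (R ∩ Ioi 0) s := by
  have hm : Measurable fun t => 1 - expNeg (a.linkExponent m s t) :=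
    measurable_const.sub (measurable_expNeg.comp (a.measurable_linkExponent m s))
  have hl := a.measurable_linkDensity m
  have h1 := a.G_pos
  have h2 := a.g_nonneg
  have h3 := sub_nonneg.2 a.one_div_N_le_one
  have h4 := a.power_pos m
  rw [regionLaplace, ← lintegral_indicator hR, a.lintegral_linkMeasure m (hm.indicator hR),
    ← lintegral_add_left (by fun_prop), ← setLIntegral_indicator hR]
  refine congrArg expNeg (setLIntegral_congr_fun measurableSet_Ioi fun t (ht : 0 < t) => ?_)
  have hl0 := a.linkDensity_nonneg m ht
  by_cases htR : t ∈ R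
  · rw [indicator_of_mem htR, indicator_of_mem htR, a.one_sub_expNeg_linkExponent m hs ht.le,
      mul_add, ← ENNReal.ofReal_mul hl0, ← ENNReal.ofReal_mul hl0]
    congr 2 <;> ring
  · rw [indicator_of_notMem htR, indicator_of_notMem htR, mul_zero]

lemma regionLaplace_Iio (m : Fin M) (T : ℝ) {s : ℝ} (hs : 0 ≤ s) :
    expNeg (∫⁻ t in Iio T, (1 - expNeg (a.linkExponent m s t)) ∂a.linkMeasure m) =
      a.regionLaplace m (Ioo 0 T) s := by
  rw [a.regionLaplace_eq m measurableSet_Iio hs, inter_comm, Ioi_inter_Iio]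

lemma measurable_regionLaplace_prod (m : Fin M) :
    Measurable fun p : ℝ × ℝ => a.regionLaplace m (Ioo 0 p.2) p.1 := by
  have hl := a.measurable_linkDensity m
  have key : ∀ F : ℝ × ℝ → ℝ≥0∞, Measurable F →
      Measurable fun p : ℝ × ℝ => ∫⁻ t in Ioo 0 p.2, F (p.1, t) := by
    intro F hF
    have hS : MeasurableSet {q : (ℝ × ℝ) × ℝ | q.2 ∈ Ioo 0 q.1.2} :=
      (measurableSet_lt measurable_const measurable_snd).inter
        (measurableSet_lt measurable_snd measurable_fst.snd)
    have h1 : Measurable fun q : (ℝ × ℝ) × ℝ => F (q.1.1, q.2) := by fun_prop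
    have h2 := (h1.indicator hS).lintegral_prod_right' (ν := volume)
    convert! h2 using 2 with p
    rw [← lintegral_indicator measurableSet_Ioo]
    rfl
  unfold regionLaplace
  refine measurable_expNeg.comp (Measurable.add ?_ ?_)
  · exact key (fun q => ENNReal.ofReal (q.1 * a.power m * a.G * q.2 /
      (1 + q.1 * a.power m * a.G * q.2) * (1 / a.N * a.linkDensity m q.2))) (by fun_prop)
  · exact key (fun q => ENNReal.ofReal (q.1 * a.power m * a.g * q.2 /
      (1 + q.1 * a.power m * a.g * q.2) * ((1 - 1 / a.N) * a.linkDensity m q.2))) (by fun_prop)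

lemma measurable_regionLaplace (m : Fin M) (R : Set ℝ) :
    Measurable fun s : ℝ => a.regionLaplace m R s := by
  have hl := a.measurable_linkDensity m
  unfold regionLaplace
  refine measurable_expNeg.comp (Measurable.add ?_ ?_)
  · have h : Measurable fun q : ℝ × ℝ => ENNReal.ofReal (q.1 * a.power m * a.G * q.2 /
      (1 + q.1 * a.power m * a.G * q.2) * (1 / a.N * a.linkDensity m q.2)) := by fun_prop
    exact h.lintegral_prod_right'
  · have h : Measurable fun q : ℝ × ℝ => ENNReal.ofReal (q.1 * a.power m * a.g * q.2 /
      (1 + q.1 * a.power m * a.g * q.2) * ((1 - 1 / a.N) * a.linkDensity m q.2)) := by fun_prop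
    exact h.lintegral_prod_right'

lemma measurable_kthPdf (m : Fin M) (K : ℕ) : Measurable (a.kthPdf (a.density m) K) := by
  rw [a.kthPdf_eq m K]
  exact (a.hasTail m).measurable_kthDensity K

lemma measurable_laplace (m : Fin M) : Measurable (a.laplace m) := by
  unfold laplace
  split_ifs
  · exact a.measurable_regionLaplace m _
  · have h : Measurable fun p : ℝ × ℝ => a.regionLaplace m (Ioo 0 p.2) p.1 *
        ENNReal.ofReal (a.kthPdf (a.density m) (a.K m) p.2) :=
      (a.measurable_regionLaplace_prod m).mul
        ((a.measurable_kthPdf m (a.K m)).comp measurable_snd).ennreal_ofReal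
    exact h.lintegral_prod_right'

end Params

namespace Network

variable {M : ℕ} [NeZero M] {a : Params M} {Ω : Type*} [MeasurableSpace Ω] {Pr : Measure Ω}
  [IsProbabilityMeasure Pr] (net : Network a Pr)

/-- The random data of operator `m`. -/
def data (m : Fin M) (ω : Ω) : OperatorData :=
  (fun i => net.pos m i ω, fun i => net.los m i ω, fun i => net.fading m i ω,
    fun i => net.angle m i ω)

/-- The positions and link states of operator `m`. -/
def links (m : Fin M) (ω : Ω) : (ℕ → Plane) × (ℕ → Bool) :=
  (fun i => net.pos m i ω, fun i => net.los m i ω)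

omit [IsProbabilityMeasure Pr] in
lemma measurable_links (m : Fin M) : Measurable (net.links m) :=
  (measurable_pi_lambda _ (net.poisson m).measurable).prodMk
    (measurable_pi_lambda _ (net.los_measurable m))

omit [IsProbabilityMeasure Pr] in
lemma measurable_data (m : Fin M) : Measurable (net.data m) :=
  (measurable_pi_lambda _ (net.poisson m).measurable).prodMk
    ((measurable_pi_lambda _ (net.los_measurable m)).prodMk
      ((measurable_pi_lambda _ (net.fading_measurable m)).prodMk
        (measurable_pi_lambda _ (net.angle_measurable m))))

lemma ae_decreasinglyOrderable (m : Fin M) :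
    ∀ᵐ ω ∂Pr, DecreasinglyOrderable (net.linkPower m ω) :=
  (net.linkPower_hasPoissonLaplace m).ae_decreasinglyOrderable (a.hasTail m)

omit [IsProbabilityMeasure Pr] in
lemma interference_eq {m : Fin M} {ω : Ω} (h : DecreasinglyOrderable (net.linkPower m ω)) :
    net.interference m ω = a.interf m (net.data m ω) := by
  classical
  refine (tsum_subtype {i | i ∉ net.coordinationSet m ω} fun i =>
    ENNReal.ofReal (a.power m * a.sectorGain (net.angle m i ω) * net.fading m i ω *
      net.linkPower m ω i)).trans (tsum_congr fun i => ?_)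
  rw [indicator_apply, indicator_apply]
  refine if_congr ?_ rfl rfl
  change i ∉ strongestSet (net.linkPower m ω) (a.K m) ↔
    (a.K m : ℝ≥0∞) ≤ cnt (net.linkPower m ω) (Ioi (net.linkPower m ω i))
  rw [h.mem_strongestSet, not_lt]

lemma ae_interference_eq : ∀ᵐ ω ∂Pr, ∀ m, net.interference m ω = a.interf m (net.data m ω) :=
  ae_all_iff.2 fun m => (net.ae_decreasinglyOrderable m).mono fun _ h => net.interference_eq h

/-- Averaging over the fading powers and angles given the links. -/
lemma lintegral_interf_links (m : Fin M) {s : ℝ} (hs : 0 ≤ s)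
    {h : (ℕ → Plane) × (ℕ → Bool) → ℝ≥0∞} (hh : Measurable h) :
    ∫⁻ ω, h (net.links m ω) * expNeg (ENNReal.ofReal s * a.interf m (net.data m ω)) ∂Pr =
      ∫⁻ ω, h (net.links m ω) * expNeg (∑' i,
        {x : ℕ → ℝ | (a.K m : ℝ≥0∞) ≤ cnt x (Ioi (x i))}.indicator
          (fun x => a.linkExponent m s (x i)) (net.linkPower m ω)) ∂Pr := by
  classical
  have hVm : Measurable fun ω => ((fun i => net.fading m i ω), (fun i => net.angle m i ω)) :=
    (measurable_pi_lambda _ (net.fading_measurable m)).prodMk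
      (measurable_pi_lambda _ (net.angle_measurable m))
  have hf : Measurable fun p : ((ℕ → Plane) × (ℕ → Bool)) × ((ℕ → ℝ) × (ℕ → ℝ)) =>
      h p.1 * expNeg (ENNReal.ofReal s * a.interf m (p.1.1, p.1.2, p.2.1, p.2.2)) := by
    have := a.measurable_interf m
    fun_prop
  refine ((net.marks_indep m).lintegral_comp_prod (net.measurable_links m) hVm hf).trans
    (lintegral_congr fun ω => ?_)
  set x := net.linkPower m ω with hx
  have hx0 : ∀ i, 0 ≤ x i := a.powers_nonneg (net.links m ω)
  have hP := a.power_pos m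
  -- the coefficients of the marks
  set c : ℕ → ℝ := fun i => if (a.K m : ℝ≥0∞) ≤ cnt x (Ioi (x i)) then s * a.power m * x i else 0
    with hc
  have hc0 : ∀ i, 0 ≤ c i := fun i => by
    have := hx0 i
    simp only [hc]
    split_ifs <;> positivity
  have e1 : ∀ ω', ENNReal.ofReal s * a.interf m ((net.links m ω).1, (net.links m ω).2,
      (fun i => net.fading m i ω'), (fun i => net.angle m i ω')) =
      ∑' i, ENNReal.ofReal (c i * (a.sectorGain (net.angle m i ω') * net.fading m i ω')) := by
    intro ω'
    rw [Params.interf, ← ENNReal.tsum_mul_left]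
    refine tsum_congr fun i => ?_
    change ENNReal.ofReal s * indicator _ _ x = _
    rw [indicator_apply]
    simp only [hc, mem_ofPred_eq]
    split_ifs
    · rw [← ENNReal.ofReal_mul hs]
      congr 1
      ring
    · simp
  have e2 : ∀ i, negLog (ENNReal.ofReal (a.gainLaplace (c i))) =
      {x : ℕ → ℝ | (a.K m : ℝ≥0∞) ≤ cnt x (Ioi (x i))}.indicator
          (fun x => a.linkExponent m s (x i)) x := by
    intro i
    rw [indicator_apply]
    simp only [hc, mem_ofPred_eq]
    split_ifs
    · rfl
    · exact a.negLog_gainLaplace_zero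
  change ∫⁻ ω', h (net.links m ω) * expNeg (ENNReal.ofReal s * a.interf m ((net.links m ω).1,
    (net.links m ω).2, (fun i => net.fading m i ω'), (fun i => net.angle m i ω'))) ∂Pr = _
  have hI : Measurable fun ω' => expNeg (∑' i, ENNReal.ofReal
      (c i * (a.sectorGain (net.angle m i ω') * net.fading m i ω'))) :=
    measurable_expNeg.comp (Measurable.tsum fun i =>
      (((a.measurable_sectorGain.comp (net.angle_measurable m i)).mul
        (net.fading_measurable m i)).const_mul _).ennreal_ofReal)
  simp_rw [e1]
  rw [lintegral_const_mul _ hI, net.lintegral_expNeg_marks m hc0]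
  simp_rw [e2]

/-- The conditional Laplace transform of the interference of a coordinated operator, given its
strongest and its `K`-th strongest link power. -/
theorem lintegral_interf_of_coordinated {m : Fin M} (hK : 1 ≤ a.K m) {s : ℝ} (hs : 0 ≤ s)
    {F : ℝ × ℝ → ℝ≥0∞} (hF : Measurable F) :
    ∫⁻ ω, F (orderedTerm 1 (net.linkPower m ω), orderedTerm (a.K m) (net.linkPower m ω)) *
        expNeg (ENNReal.ofReal s * a.interf m (net.data m ω)) ∂Pr =
      ∫⁻ ω, F (orderedTerm 1 (net.linkPower m ω), orderedTerm (a.K m) (net.linkPower m ω)) *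
        a.regionLaplace m (Ioo 0 (orderedTerm (a.K m) (net.linkPower m ω))) s ∂Pr := by
  have hL := net.linkPower_hasPoissonLaplace m
  have h1 := net.lintegral_interf_links m hs
    (h := fun u => F (orderedTerm 1 (a.powers u), orderedTerm (a.K m) (a.powers u)))
    (hF.comp (((measurable_orderedTerm le_rfl).comp a.measurable_powers).prodMk
      ((measurable_orderedTerm hK).comp a.measurable_powers)))
  have h2 := hL.lintegral_below (a.hasTail m) hK (a.measurable_linkExponent m s) hF
  refine h1.trans (Eq.trans (lintegral_congr_ae ?_) (h2.trans (lintegral_congr fun ω => ?_)))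
  · filter_upwards [net.ae_decreasinglyOrderable m] with ω hω
    change F (orderedTerm 1 (net.linkPower m ω), orderedTerm (a.K m) (net.linkPower m ω)) * _ =
      F (orderedTerm 1 (net.linkPower m ω), orderedTerm (a.K m) (net.linkPower m ω)) * _
    congr 2
    refine tsum_congr fun i => ?_
    change _ = (Iio (orderedTerm (a.K m) (net.linkPower m ω))).indicator _ _
    rw [indicator_apply, indicator_apply, hω.orderedTerm_eq]
    refine if_congr ?_ rfl rfl
    rw [mem_Iio, hω.lt_kthLargest_iff hK]
    rfl
  · rw [a.regionLaplace_Iio m _ hs]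

/-- The Laplace transform of the interference of an operator. -/
theorem lintegral_interf (m : Fin M) {s : ℝ} (hs : 0 ≤ s) :
    ∫⁻ ω, expNeg (ENNReal.ofReal s * a.interf m (net.data m ω)) ∂Pr = a.laplace m s := by
  have hL := net.linkPower_hasPoissonLaplace m
  rw [Params.laplace]
  split_ifs with hK
  · have h1 := net.lintegral_interf_links m hs (h := fun _ => 1) measurable_const
    simp only [one_mul, hK, Nat.cast_zero, zero_le, ofPred_true, indicator_univ] at h1
    have h2 := a.regionLaplace_eq m MeasurableSet.univ hs
    rw [Measure.restrict_univ, univ_inter] at h2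
    rw [h1, ← h2]
    exact hL.laplace _ (a.measurable_linkExponent m s)
  · have hK1 : 1 ≤ a.K m := Nat.one_le_iff_ne_zero.2 hK
    have h1 := net.lintegral_interf_of_coordinated hK1 hs (F := fun _ => 1) measurable_const
    simp only [one_mul] at h1
    have hR : Measurable fun T => a.regionLaplace m (Ioo 0 T) s :=
      (a.measurable_regionLaplace_prod m).comp measurable_prodMk_left
    have hk := ((a.hasTail m).measurable_kthDensity (a.K m)).ennreal_ofReal
    have h2 := lintegral_map (μ := Pr) hR (hL.measurable_orderedTerm_comp hK1)
    rw [hL.map_orderedTerm (a.hasTail m) hK1,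
      lintegral_withDensity_eq_lintegral_mul _ hk hR] at h2
    rw [h1]
    refine h2.symm.trans ?_
    rw [← lintegral_indicator measurableSet_Ioi]
    refine lintegral_congr fun T => ?_
    rw [Pi.mul_apply, mul_comm, indicator_apply, a.kthPdf_eq m]
    split_ifs with hT
    · rfl
    · rw [kthDensity, indicator_of_notMem hT, ENNReal.ofReal_zero, mul_zero]

lemma laplace_le_one (net : Network a Pr) (m : Fin M) {s : ℝ} (hs : 0 ≤ s) : a.laplace m s ≤ 1 := by
  rw [← net.lintegral_interf m hs]
  refine (lintegral_mono fun ω => expNeg_le_one _).trans_eq ?_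
  simp

end Network

/-! ### Laplace transforms at a random argument -/

lemma dyadicBelow_nonneg (n : ℕ) {τ : ℝ} (hτ : 0 < τ) : 0 ≤ dyadicBelow n τ := by
  have h : 1 ≤ ⌈τ * 2 ^ n⌉₊ := Nat.ceil_pos.2 (by positivity)
  have h' : (1 : ℝ) ≤ ⌈τ * 2 ^ n⌉₊ := by exact_mod_cast h
  exact div_nonneg (sub_nonneg.2 h') (by positivity)

/-- An identity between conditional transforms at constant arguments `s ≥ 0` extends to arguments
that are functions of the conditioning variable. -/
lemma lintegral_comp_eq_of_forall_const {Ω S : Type*} [MeasurableSpace Ω] [MeasurableSpace S]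
    {Pr : Measure Ω} [IsFiniteMeasure Pr] {X : Ω → S} (hX : Measurable X)
    {u v : ℝ → Ω → ℝ≥0∞} (hu : Measurable fun p : ℝ × Ω => u p.1 p.2)
    (hv : Measurable fun p : ℝ × Ω => v p.1 p.2)
    (hu1 : ∀ s ω, u s ω ≤ 1) (hv1 : ∀ s ω, v s ω ≤ 1)
    (hulim : ∀ ω (σ : ℕ → ℝ) (s : ℝ), 0 < s → Monotone σ → (∀ n, 0 ≤ σ n) →
      Tendsto σ atTop (𝓝 s) → Tendsto (fun n => u (σ n) ω) atTop (𝓝 (u s ω)))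
    (hvlim : ∀ ω (σ : ℕ → ℝ) (s : ℝ), 0 < s → Monotone σ → (∀ n, 0 ≤ σ n) →
      Tendsto σ atTop (𝓝 s) → Tendsto (fun n => v (σ n) ω) atTop (𝓝 (v s ω)))
    (h : ∀ s, 0 ≤ s → ∀ F : S → ℝ≥0∞, Measurable F →
      ∫⁻ ω, F (X ω) * u s ω ∂Pr = ∫⁻ ω, F (X ω) * v s ω ∂Pr)
    {τ : S → ℝ} (hτ : Measurable τ) (hτ0 : ∀ᵐ ω ∂Pr, 0 < τ (X ω))
    {F : S → ℝ≥0∞} (hF : Measurable F) (hF1 : ∀ᵐ ω ∂Pr, F (X ω) ≤ 1) :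
    ∫⁻ ω, F (X ω) * u (τ (X ω)) ω ∂Pr = ∫⁻ ω, F (X ω) * v (τ (X ω)) ω ∂Pr := by
  have hFX : Measurable fun ω => F (X ω) := hF.comp hX
  -- measurability of the approximations
  have hm : ∀ {w : ℝ → Ω → ℝ≥0∞}, (Measurable fun p : ℝ × Ω => w p.1 p.2) → ∀ n,
      Measurable fun ω => F (X ω) * w (dyadicBelow n (τ (X ω))) ω := fun {w} hw n =>
    hFX.mul (hw.comp (((measurable_dyadicBelow n).comp (hτ.comp hX)).prodMk measurable_id))
  have lim : ∀ {w : ℝ → Ω → ℝ≥0∞}, (Measurable fun p : ℝ × Ω => w p.1 p.2) →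
      (∀ s ω, w s ω ≤ 1) → (∀ ω (σ : ℕ → ℝ) (s : ℝ), 0 < s → Monotone σ → (∀ n, 0 ≤ σ n) →
      Tendsto σ atTop (𝓝 s) → Tendsto (fun n => w (σ n) ω) atTop (𝓝 (w s ω))) →
      Tendsto (fun n => ∫⁻ ω, F (X ω) * w (dyadicBelow n (τ (X ω))) ω ∂Pr) atTop
        (𝓝 (∫⁻ ω, F (X ω) * w (τ (X ω)) ω ∂Pr)) := by
    intro w hw hw1 hwlim
    refine tendsto_lintegral_of_dominated_convergence (fun _ => 1) (hm hw) (fun n => ?_)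
      (by simp) ?_
    · filter_upwards [hF1] with ω h1
      exact mul_le_one' h1 (hw1 _ _)
    · filter_upwards [hτ0, hF1] with ω h0 h1
      refine ENNReal.Tendsto.const_mul (hwlim ω _ _ h0 (dyadicBelow_mono h0)
        (fun n => dyadicBelow_nonneg n h0) (tendsto_dyadicBelow h0)) (Or.inr ?_)
      exact ne_top_of_le_ne_top ENNReal.one_ne_top h1
  -- the approximations take countably many values
  have expand : ∀ {w : ℝ → Ω → ℝ≥0∞}, (Measurable fun p : ℝ × Ω => w p.1 p.2) → ∀ n,
      ∫⁻ ω, F (X ω) * w (dyadicBelow n (τ (X ω))) ω ∂Pr =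
        ∑' j : ℕ, ∫⁻ ω, {x | ⌈τ x * 2 ^ n⌉₊ = j + 1}.indicator F (X ω) *
          w ((j : ℝ) / 2 ^ n) ω ∂Pr := by
    intro w hw n
    have hS : ∀ j : ℕ, MeasurableSet {x | ⌈τ x * 2 ^ n⌉₊ = j + 1} := fun j =>
      (Nat.measurable_ceil.comp (hτ.mul_const _)) (measurableSet_singleton (j + 1))
    rw [← lintegral_tsum (f := fun (j : ℕ) ω =>
      {x | ⌈τ x * 2 ^ n⌉₊ = j + 1}.indicator F (X ω) * w ((j : ℝ) / 2 ^ n) ω) fun j =>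
      (((hF.indicator (hS j)).comp hX).mul
      (hw.comp measurable_prodMk_left)).aemeasurable]
    refine lintegral_congr_ae ?_
    filter_upwards [hτ0] with ω h0
    obtain ⟨j, hj⟩ : ∃ j, ⌈τ (X ω) * 2 ^ n⌉₊ = j + 1 :=
      ⟨_, (Nat.succ_pred_eq_of_pos (Nat.ceil_pos.2 (by positivity))).symm⟩
    have hd : dyadicBelow n (τ (X ω)) = (j : ℝ) / 2 ^ n := by
      rw [dyadicBelow, hj]; push_cast; ring
    rw [tsum_eq_single j, hd]
    · rw [indicator_of_mem (show X ω ∈ {x | ⌈τ x * 2 ^ n⌉₊ = j + 1} from hj)]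
    · intro j' hj'
      rw [indicator_of_notMem, zero_mul]
      intro hmem
      have : j + 1 = j' + 1 := hj.symm.trans hmem
      omega
  refine tendsto_nhds_unique (lim hu hu1 hulim) ((lim hv hv1 hvlim).congr fun n => ?_)
  rw [expand hu, expand hv]
  refine tsum_congr fun j => (h _ (by positivity) _ (hF.indicator ?_)).symm
  exact (Nat.measurable_ceil.comp (hτ.mul_const _)) (measurableSet_singleton (j + 1))

namespace Params

variable {M : ℕ} [NeZero M] (a : Params M)

lemma tendsto_regionLaplace (m : Fin M) (T : ℝ) {σ : ℕ → ℝ} {s : ℝ} (hσ : Monotone σ)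
    (hσ0 : ∀ n, 0 ≤ σ n) (hs : Tendsto σ atTop (𝓝 s)) :
    Tendsto (fun n => a.regionLaplace m (Ioo 0 T) (σ n)) atTop
      (𝓝 (a.regionLaplace m (Ioo 0 T) s)) := by
  have hl := a.measurable_linkDensity m
  have hs0 : 0 ≤ s := ge_of_tendsto' hs hσ0
  have hP := a.power_pos m
  have key : ∀ (γ b : ℝ), 0 ≤ γ → 0 ≤ b → Tendsto (fun n => ∫⁻ t in Ioo 0 T, ENNReal.ofReal
      (σ n * a.power m * γ * t / (1 + σ n * a.power m * γ * t) * (b * a.linkDensity m t))) atTop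
      (𝓝 (∫⁻ t in Ioo 0 T, ENNReal.ofReal
        (s * a.power m * γ * t / (1 + s * a.power m * γ * t) * (b * a.linkDensity m t)))) := by
    intro γ b hγ hb
    refine lintegral_tendsto_of_tendsto_of_monotone (fun n => by fun_prop) ?_ ?_
    · refine (ae_restrict_iff' measurableSet_Ioo).2 (ae_of_all _ fun t ht n k hnk => ?_)
      have ht0 : 0 < t := ht.1
      have h1 := a.linkDensity_nonneg m ht0
      have h2 := hσ0 n
      have h3 := hσ0 k
      refine ENNReal.ofReal_le_ofReal (mul_le_mul_of_nonneg_right ?_ (by positivity))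
      rw [div_le_div_iff₀ (by positivity) (by positivity)]
      have : σ n * a.power m * γ * t ≤ σ k * a.power m * γ * t := by
        have := hσ hnk
        gcongr
      linarith
    · refine (ae_restrict_iff' measurableSet_Ioo).2 (ae_of_all _ fun t ht => ?_)
      have ht0 : 0 < t := ht.1
      have h1 : Tendsto (fun n => σ n * a.power m * γ * t) atTop (𝓝 (s * a.power m * γ * t)) :=
        ((hs.mul_const _).mul_const _).mul_const _
      have h2 : 1 + s * a.power m * γ * t ≠ 0 := by positivity
      exact ENNReal.tendsto_ofReal ((h1.div (h1.const_add 1) h2).mul_const _)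
  exact (continuous_expNeg.tendsto _).comp ((key a.G _ a.G_pos.le (by positivity)).add
    (key a.g _ a.g_nonneg (sub_nonneg.2 a.one_div_N_le_one)))

end Params

namespace Network

variable {M : ℕ} [NeZero M] {a : Params M} {Ω : Type*} [MeasurableSpace Ω] {Pr : Measure Ω}
  [IsProbabilityMeasure Pr] (net : Network a Pr)

omit [IsProbabilityMeasure Pr] in
lemma measurable_orderedTerm (m : Fin M) {K : ℕ} (hK : 1 ≤ K) :
    Measurable fun ω => orderedTerm K (net.linkPower m ω) :=
  (SpectrumSharing.measurable_orderedTerm hK).comp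
    (a.measurable_powers.comp (net.measurable_links m))

lemma ae_orderedTerm_pos (m : Fin M) {K : ℕ} (hK : 1 ≤ K) :
    ∀ᵐ ω ∂Pr, 0 < orderedTerm K (net.linkPower m ω) := by
  filter_upwards [net.ae_decreasinglyOrderable m] with ω hω
  rw [hω.orderedTerm_eq]
  exact hω.kthLargest_pos hK

/-- The conditional Laplace transform of the interference of a coordinated operator at an argument
that depends on its strongest link power. -/
theorem lintegral_interf_comp {m : Fin M} (hK : 1 ≤ a.K m) {τ : ℝ → ℝ} (hτ : Measurable τ)
    (hτ0 : ∀ t, 0 < t → 0 < τ t) {F : ℝ → ℝ≥0∞} (hF : Measurable F) (hF1 : ∀ t, 0 < t → F t ≤ 1) :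
    ∫⁻ ω, F (orderedTerm 1 (net.linkPower m ω)) *
        expNeg (ENNReal.ofReal (τ (orderedTerm 1 (net.linkPower m ω))) *
          a.interf m (net.data m ω)) ∂Pr =
      ∫⁻ ω, F (orderedTerm 1 (net.linkPower m ω)) *
        a.regionLaplace m (Ioo 0 (orderedTerm (a.K m) (net.linkPower m ω)))
          (τ (orderedTerm 1 (net.linkPower m ω))) ∂Pr := by
  have h1 := net.measurable_orderedTerm m le_rfl
  have hKm := net.measurable_orderedTerm m hK
  have hI := (a.measurable_interf m).comp (net.measurable_data m)
  refine lintegral_comp_eq_of_forall_const (X := fun ω =>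
    (orderedTerm 1 (net.linkPower m ω), orderedTerm (a.K m) (net.linkPower m ω)))
    (u := fun s ω => expNeg (ENNReal.ofReal s * a.interf m (net.data m ω)))
    (v := fun s ω => a.regionLaplace m (Ioo 0 (orderedTerm (a.K m) (net.linkPower m ω))) s)
    (τ := fun p => τ p.1) (F := fun p => F p.1)
    (h1.prodMk hKm) ?_ ?_ (fun _ _ => expNeg_le_one _) (fun _ _ => expNeg_le_one _) ?_
    (fun ω σ s _ hσ hσ0 hs => a.tendsto_regionLaplace m _ hσ hσ0 hs)
    (fun s hs F hF => net.lintegral_interf_of_coordinated hK hs hF)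
    (hτ.comp measurable_fst) ?_ (hF.comp measurable_fst) ?_
  · exact measurable_expNeg.comp (measurable_fst.ennreal_ofReal.mul (hI.comp measurable_snd))
  · exact Measurable.comp (g := fun p : ℝ × ℝ => a.regionLaplace m (Ioo 0 p.2) p.1)
      (f := fun p : ℝ × Ω => (p.1, orderedTerm (a.K m) (net.linkPower m p.2)))
      (a.measurable_regionLaplace_prod m) (measurable_fst.prodMk (hKm.comp measurable_snd))
  · intro ω σ s hs _ _ hlim
    refine (continuous_expNeg.tendsto _).comp (ENNReal.Tendsto.mul_const
      (ENNReal.tendsto_ofReal hlim) (Or.inl ?_))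
    simpa using hs
  · exact (net.ae_orderedTerm_pos m le_rfl).mono fun ω hω => hτ0 _ hω
  · exact (net.ae_orderedTerm_pos m le_rfl).mono fun ω hω => hF1 _ hω

end Network

/-! ### The coverage event -/

namespace Params

variable {M : ℕ} [NeZero M] (a : Params M)

/-- The received signal power, expressed measurably: the serving base station is the one without
stronger links. -/
noncomputable def signal (d : OperatorData) : ℝ≥0∞ :=
  ∑' i, {x : ℕ → ℝ | cnt x (Ioi (x i)) = 0}.indicator (fun x => ENNReal.ofReal
    (a.power 0 * (a.p * a.G) * d.2.2.1 i * x i)) (a.powers (d.1, d.2.1))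

lemma measurable_signal : Measurable a.signal := by
  classical
  have hp : Measurable fun d : OperatorData => a.powers (d.1, d.2.1) :=
    a.measurable_powers.comp (by fun_prop)
  refine Measurable.tsum fun i => ?_
  simp only [indicator_apply]
  refine Measurable.ite (hp (measurableSet_eq_fun (measurable_cnt_Ioi_self i) measurable_const)) ?_
    measurable_const
  have h2 : Measurable fun d : OperatorData => a.powers (d.1, d.2.1) i :=
    (measurable_pi_apply i).comp hp
  fun_prop

lemma signal_eq {d : OperatorData} (h : DecreasinglyOrderable (a.powers (d.1, d.2.1))) :
    a.signal d = ENNReal.ofReal (a.power 0 * (a.p * a.G) *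
      d.2.2.1 (argmax (a.powers (d.1, d.2.1))) * a.powers (d.1, d.2.1)
        (argmax (a.powers (d.1, d.2.1)))) := by
  rw [signal, tsum_eq_single (argmax (a.powers (d.1, d.2.1))), indicator_of_mem]
  · exact h.cnt_Ioi_eq_zero_iff.2 rfl
  · exact fun i hi => indicator_of_notMem (s := {x : ℕ → ℝ | cnt x (Ioi (x i)) = 0})
      (fun hmem => hi (h.cnt_Ioi_eq_zero_iff.1 hmem)) _

/-- The product of transmit power and beamforming gain of the serving base station. -/
noncomputable def servingPower : ℝ := a.power 0 * (a.p * a.G)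

lemma servingPower_pos : 0 < a.servingPower :=
  mul_pos (a.power_pos 0) (mul_pos a.p_pos a.G_pos)

/-- The serving base station does not interfere: the interference of the serving operator does not
depend on its fading power. -/
lemma interf_congr_fading {p : ℕ → Plane} {l : ℕ → Bool}
    (h : DecreasinglyOrderable (a.powers (p, l))) (θ : ℕ → ℝ) {x y : ℕ → ℝ}
    (hxy : ∀ j, j ≠ argmax (a.powers (p, l)) → x j = y j) :
    a.interf 0 (p, l, x, θ) = a.interf 0 (p, l, y, θ) := by
  refine tsum_congr fun j => ?_
  by_cases hj : j = argmax (a.powers (p, l))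
  · have hz : cnt (a.powers (p, l)) (Ioi (a.powers (p, l) j)) = 0 := h.cnt_Ioi_eq_zero_iff.2 hj
    have hK : (0 : ℝ≥0∞) < a.K 0 := by exact_mod_cast a.one_le_K
    have hn : a.powers (p, l) ∉ {x : ℕ → ℝ | (a.K 0 : ℝ≥0∞) ≤ cnt x (Ioi (x j))} := by
      rw [mem_ofPred_eq, hz]
      exact not_le.2 hK
    rw [indicator_of_notMem hn, indicator_of_notMem hn]
  · simp only [hxy j hj]

end Params

namespace Network

variable {M : ℕ} [NeZero M] {a : Params M} {Ω : Type*} [MeasurableSpace Ω] {Pr : Measure Ω}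
  [IsProbabilityMeasure Pr] (net : Network a Pr)

/-- Links, angles and fading powers of an operator are independent. -/
lemma lintegral_data (m : Fin M) {f : OperatorData → ℝ≥0∞} (hf : Measurable f) :
    ∫⁻ ω, f (net.data m ω) ∂Pr = ∫⁻ ω, ∫⁻ ω', ∫⁻ ω'', f ((net.links m ω).1, (net.links m ω).2,
      fun i => net.fading m i ω'', fun i => net.angle m i ω') ∂Pr ∂Pr ∂Pr := by
  have hHm : Measurable fun ω i => net.fading m i ω :=
    measurable_pi_lambda _ (net.fading_measurable m)
  have hθm : Measurable fun ω i => net.angle m i ω :=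
    measurable_pi_lambda _ (net.angle_measurable m)
  have h1 := (net.marks_indep m).lintegral_comp_prod (net.measurable_links m) (hHm.prodMk hθm)
    (f := fun p => f (p.1.1, p.1.2, p.2.1, p.2.2)) (hf.comp (by fun_prop))
  refine h1.trans (lintegral_congr fun ω => ?_)
  exact (net.fading_angle_indep m).symm.lintegral_comp_prod hθm hHm
    (f := fun p => f ((net.links m ω).1, (net.links m ω).2, p.2, p.1)) (hf.comp (by fun_prop))

/-- As the fading power of the serving base station is exponential and independent of everything
else, the conditional probability that the signal exceeds a threshold times noise and
interference is a Laplace transform. -/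
lemma lintegral_signal_gt (κ : ℝ) (z : ℝ≥0∞) :
    ∫⁻ ω, {d | ENNReal.ofReal κ * (z + a.interf 0 d) < a.signal d}.indicator 1 (net.data 0 ω) ∂Pr =
      ∫⁻ ω, expNeg (ENNReal.ofReal (κ / (a.servingPower * orderedTerm 1 (net.linkPower 0 ω))) *
        (z + a.interf 0 (net.data 0 ω))) ∂Pr := by
  have hI := a.measurable_interf 0
  have hp : Measurable fun d : OperatorData => a.powers (d.1, d.2.1) :=
    a.measurable_powers.comp (by fun_prop)
  have hT : Measurable fun d : OperatorData => orderedTerm 1 (a.powers (d.1, d.2.1)) :=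
    (SpectrumSharing.measurable_orderedTerm le_rfl).comp hp
  rw [net.lintegral_data 0 (measurable_one.indicator
    (measurableSet_lt ((hI.const_add z).const_mul _) a.measurable_signal))]
  refine Eq.trans ?_ (net.lintegral_data 0 (f := fun d =>
    expNeg (ENNReal.ofReal (κ / (a.servingPower * orderedTerm 1 (a.powers (d.1, d.2.1)))) *
      (z + a.interf 0 d))) (measurable_expNeg.comp
        ((measurable_const.div (hT.const_mul _)).ennreal_ofReal.mul (hI.const_add z)))).symm
  refine lintegral_congr_ae ?_
  filter_upwards [net.ae_decreasinglyOrderable 0] with ω hω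
  refine lintegral_congr fun ω' => ?_
  rcases hlinks : net.links 0 ω with ⟨p, l⟩
  have hx : net.linkPower 0 ω = a.powers (p, l) := by rw [← hlinks]; rfl
  rw [hx] at hω
  set i := argmax (a.powers (p, l)) with hi
  set θ : ℕ → ℝ := fun i => net.angle 0 i ω' with hθ
  have hA : 0 < a.servingPower * a.powers (p, l) i := mul_pos a.servingPower_pos (hω.1 i)
  have hT1 : orderedTerm 1 (a.powers (p, l)) = a.powers (p, l) i := by
    rw [hω.orderedTerm_eq, hω.kthLargest_one]
  have key := measure_lt_exp (net.fading_measurable 0) (net.fading_law 0) (net.fading_indep 0) i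
    (Z := fun h => ENNReal.ofReal (κ / (a.servingPower * a.powers (p, l) i)) *
      (z + a.interf 0 (p, l, h, θ)))
    (((hI.comp (by fun_prop)).const_add z).const_mul _)
    (fun x y hxy => by simp only [a.interf_congr_fading hω θ hxy])
  simp only [hT1]
  rw [← key, ← lintegral_indicator_one]
  · refine lintegral_congr fun ω'' => ?_
    simp only [indicator_apply, mem_ofPred_eq]
    refine if_congr ?_ rfl rfl
    rw [a.signal_eq hω]
    have e1 : ENNReal.ofReal κ = ENNReal.ofReal (a.servingPower * a.powers (p, l) i) *
        ENNReal.ofReal (κ / (a.servingPower * a.powers (p, l) i)) := by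
      rw [← ENNReal.ofReal_mul hA.le, mul_div_cancel₀ _ hA.ne']
    have e2 : ENNReal.ofReal (a.power 0 * (a.p * a.G) * net.fading 0 i ω'' * a.powers (p, l) i) =
        ENNReal.ofReal (a.servingPower * a.powers (p, l) i) *
          ENNReal.ofReal (net.fading 0 i ω'') := by
      rw [← ENNReal.ofReal_mul hA.le, Params.servingPower]
      congr 1
      ring
    change _ < ENNReal.ofReal (a.power 0 * (a.p * a.G) * net.fading 0 i ω'' * a.powers (p, l) i) ↔ _
    rw [e1, e2, mul_assoc]
    exact ENNReal.mul_lt_mul_iff_right (ENNReal.ofReal_pos.2 hA).ne' ENNReal.ofReal_ne_top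
  · refine measurableSet_lt ?_ (net.fading_measurable 0 i).ennreal_ofReal
    have hHm : Measurable fun ω i => net.fading 0 i ω :=
      measurable_pi_lambda _ (net.fading_measurable 0)
    have : Measurable fun ω'' => a.interf 0 (p, l, (fun j => net.fading 0 j ω''), θ) :=
      hI.comp (measurable_const.prodMk (measurable_const.prodMk (hHm.prodMk measurable_const)))
    exact (this.const_add z).const_mul _

/-- The interference of the other operators. -/
noncomputable def otherInterf (net : Network a Pr) (ω : Ω) : ℝ≥0∞ :=
  ∑ m ∈ Finset.univ.erase (0 : Fin M), a.interf m (net.data m ω)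

omit [IsProbabilityMeasure Pr] in
lemma measurable_otherInterf : Measurable net.otherInterf :=
  Finset.measurable_sum _ fun m _ => (a.measurable_interf m).comp (net.measurable_data m)

omit [IsProbabilityMeasure Pr] in
lemma data_indepFun_otherInterf : IndepFun (net.data 0) net.otherInterf Pr := by
  have h := net.operators_indep.indepFun_of_disjoint (fun m => net.measurable_data m)
    (A := {0}) (B := {0}ᶜ) disjoint_compl_right
  have hm : Measurable fun x : ({0}ᶜ : Set (Fin M)) → OperatorData =>
      ∑ m : ({0}ᶜ : Set (Fin M)), a.interf m (x m) :=
    Finset.measurable_sum _ fun m _ => (a.measurable_interf m).comp (measurable_pi_apply m)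
  have h' := h.comp (measurable_pi_apply (⟨0, rfl⟩ : ({0} : Set (Fin M)))) hm
  convert! h' using 1
  ext ω
  rw [otherInterf, Finset.sum_subtype (p := (· ∈ ({0}ᶜ : Set (Fin M)))) _ (by simp)]
  rfl

/-- The Laplace transform of the interference of the other operators. -/
lemma lintegral_otherInterf {s : ℝ} (hs : 0 ≤ s) :
    ∫⁻ ω, expNeg (ENNReal.ofReal s * net.otherInterf ω) ∂Pr =
      ∏ m ∈ Finset.univ.erase (0 : Fin M), a.laplace m s := by
  have hind := net.operators_indep.comp (fun m d => expNeg (ENNReal.ofReal s * a.interf m d))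
    fun m => measurable_expNeg.comp ((a.measurable_interf m).const_mul _)
  simp_rw [otherInterf, Finset.mul_sum, expNeg_sum]
  refine (lintegral_prod_eq_prod_lintegral_of_indepFun _ _ hind fun m => ?_).trans
    (Finset.prod_congr rfl fun m _ => net.lintegral_interf m hs)
  exact (measurable_expNeg.comp ((a.measurable_interf m).const_mul _)).comp (net.measurable_data m)

end Network

namespace Params

variable {M : ℕ} [NeZero M] (a : Params M)

lemma totalBandwidth_pos : 0 < a.totalBandwidth :=
  Finset.sum_pos (fun m _ => a.bandwidth_pos m) Finset.univ_nonempty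

lemma noisePower_pos : 0 < a.noisePower := mul_pos a.N₀_pos a.totalBandwidth_pos

lemma sinrThreshold_pos {γ : ℝ} (hγ : 0 < γ) : 0 < a.sinrThreshold γ :=
  sub_pos.2 (Real.one_lt_rpow one_lt_two (div_pos hγ a.totalBandwidth_pos))

lemma laplaceArg_pos {γ T : ℝ} (hγ : 0 < γ) (hT : 0 < T) : 0 < a.laplaceArg γ T :=
  div_pos (a.sinrThreshold_pos hγ) (mul_pos a.servingPower_pos hT)

lemma measurable_laplaceArg (γ : ℝ) : Measurable (a.laplaceArg γ) :=
  measurable_const.div (measurable_id.const_mul _)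

/-- The rate exceeds `γ` if and only if the SINR exceeds `γ̃`. -/
lemma lt_rate_iff {γ : ℝ} (hγ : 0 < γ) {b c : ℝ≥0∞} (hb : b ≠ ∞) :
    γ < a.totalBandwidth * Real.logb 2 (1 + (b / (ENNReal.ofReal a.noisePower + c)).toReal) ↔
      ENNReal.ofReal (a.sinrThreshold γ) * (ENNReal.ofReal a.noisePower + c) < b := by
  have hW := a.totalBandwidth_pos
  have hn : ENNReal.ofReal a.noisePower + c ≠ 0 := by
    have := ENNReal.ofReal_pos.2 a.noisePower_pos
    exact (this.trans_le le_self_add).ne'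
  have hfin : b / (ENNReal.ofReal a.noisePower + c) ≠ ∞ := ENNReal.div_ne_top hb hn
  rw [← div_lt_iff₀' hW, Real.lt_logb_iff_rpow_lt one_lt_two (by positivity), ← sub_lt_iff_lt_add',
    ← ENNReal.lt_div_iff_mul_lt (Or.inl hn)
      (Or.inr (ENNReal.ofReal_pos.2 (a.sinrThreshold_pos hγ)).ne'),
    ENNReal.ofReal_lt_iff_lt_toReal (a.sinrThreshold_pos hγ).le hfin]
  rfl

end Params

/-! ### The rate coverage probability -/

namespace Params

variable {M : ℕ} [NeZero M] (a : Params M)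

/-- The part of the integrand that depends only on the strongest link power: the noise and the
interference of the other operators. -/
noncomputable def noiseFactor (γ T : ℝ) : ℝ≥0∞ :=
  expNeg (ENNReal.ofReal (a.laplaceArg γ T) * ENNReal.ofReal a.noisePower) *
    ∏ m ∈ Finset.univ.erase (0 : Fin M), a.laplace m (a.laplaceArg γ T)

lemma measurable_noiseFactor (γ : ℝ) : Measurable (a.noiseFactor γ) := by
  have h := a.measurable_laplaceArg γ
  exact (measurable_expNeg.comp (h.ennreal_ofReal.mul_const _)).mul
    (Finset.measurable_prod _ fun m _ => (a.measurable_laplace m).comp h)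

lemma integrand_eq {γ T₁ TK : ℝ} (hγ : 0 < γ) (hT : 0 < T₁) :
    a.integrand γ T₁ TK =
      a.noiseFactor γ T₁ * a.regionLaplace 0 (Ioo 0 TK) (a.laplaceArg γ T₁) := by
  have h1 := (a.laplaceArg_pos hγ hT).le
  rw [integrand, noiseFactor, condLaplace, ← ENNReal.ofReal_mul h1,
    expNeg_ofReal (mul_nonneg h1 a.noisePower_pos.le), laplaceArg, div_mul_eq_mul_div]
  ring

lemma measurable_integrand (γ : ℝ) : Measurable fun p : ℝ × ℝ => a.integrand γ p.1 p.2 := by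
  have h := (a.measurable_laplaceArg γ).comp (measurable_fst : Measurable (Prod.fst : ℝ × ℝ → ℝ))
  have h2 : Measurable fun p : ℝ × ℝ => a.regionLaplace 0 (Ioo 0 p.2) (a.laplaceArg γ p.1) :=
    Measurable.comp (g := fun p : ℝ × ℝ => a.regionLaplace 0 (Ioo 0 p.2) p.1)
      (f := fun p : ℝ × ℝ => (a.laplaceArg γ p.1, p.2))
      (a.measurable_regionLaplace_prod 0) (h.prodMk measurable_snd)
  unfold integrand
  refine (Measurable.mul ?_ h2).mul
    (Finset.measurable_prod _ fun m _ => (a.measurable_laplace m).comp h)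
  exact (Real.measurable_exp.comp
    (measurable_const.div (measurable_fst.const_mul _)).neg).ennreal_ofReal

/-- The coverage event in terms of the data of the serving operator and the interference of the
other ones. -/
def coverageSet (γ : ℝ) : Set (OperatorData × ℝ≥0∞) :=
  {p | ENNReal.ofReal (a.sinrThreshold γ) * (ENNReal.ofReal a.noisePower + p.2 + a.interf 0 p.1) <
    a.signal p.1}

/-- The conditional probability of coverage given everything but the fading power of the serving
base station. -/
noncomputable def coverageWeight (γ : ℝ) (p : OperatorData × ℝ≥0∞) : ℝ≥0∞ :=
  expNeg (ENNReal.ofReal (a.laplaceArg γ (orderedTerm 1 (a.powers (p.1.1, p.1.2.1)))) *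
    (ENNReal.ofReal a.noisePower + p.2 + a.interf 0 p.1))

lemma measurable_noise_add_interf : Measurable fun p : OperatorData × ℝ≥0∞ =>
    ENNReal.ofReal a.noisePower + p.2 + a.interf 0 p.1 :=
  (measurable_snd.const_add _).add ((a.measurable_interf 0).comp measurable_fst)

lemma measurableSet_coverageSet (γ : ℝ) : MeasurableSet (a.coverageSet γ) :=
  measurableSet_lt (a.measurable_noise_add_interf.const_mul _)
    (a.measurable_signal.comp measurable_fst)

lemma measurable_coverageWeight (γ : ℝ) : Measurable (a.coverageWeight γ) := by
  have h1 : Measurable fun p : OperatorData × ℝ≥0∞ => a.powers (p.1.1, p.1.2.1) :=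
    a.measurable_powers.comp (by fun_prop)
  have h2 := (a.measurable_laplaceArg γ).comp ((measurable_orderedTerm (le_refl 1)).comp h1)
  exact measurable_expNeg.comp (h2.ennreal_ofReal.mul a.measurable_noise_add_interf)

end Params

namespace Network

variable {M : ℕ} [NeZero M] {a : Params M} {Ω : Type*} [MeasurableSpace Ω] {Pr : Measure Ω}
  [IsProbabilityMeasure Pr] (net : Network a Pr)

omit [IsProbabilityMeasure Pr] in
/-- Almost surely, coverage means that the signal exceeds a multiple of noise and interference. -/
lemma lt_rate_iff {γ : ℝ} (hγ : 0 < γ) {ω : Ω}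
    (h0 : DecreasinglyOrderable (net.linkPower 0 ω))
    (hI : ∀ m, net.interference m ω = a.interf m (net.data m ω)) :
    γ < a.totalBandwidth * Real.logb 2 (1 + (net.sinr ω).toReal) ↔
      ENNReal.ofReal (a.sinrThreshold γ) * (ENNReal.ofReal a.noisePower + net.otherInterf ω +
        a.interf 0 (net.data 0 ω)) < a.signal (net.data 0 ω) := by
  have hsum : ∑ m, net.interference m ω = net.otherInterf ω + a.interf 0 (net.data 0 ω) := by
    simp_rw [hI]
    rw [otherInterf, add_comm]
    exact (Finset.add_sum_erase Finset.univ (fun m => a.interf m (net.data m ω))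
      (Finset.mem_univ 0)).symm
  rw [sinr, hsum, a.lt_rate_iff hγ ENNReal.ofReal_ne_top, add_assoc]
  rw [a.signal_eq (d := net.data 0 ω) h0]
  rfl

/-- The rate coverage probability is the probability that the signal exceeds a multiple of noise
and interference. -/
lemma rateCoverage_eq_coverageSet {γ : ℝ} (hγ : 0 < γ) :
    net.rateCoverage γ =
      ∫⁻ ω, (a.coverageSet γ).indicator 1 (net.data 0 ω, net.otherInterf ω) ∂Pr := by
  have hpre : MeasurableSet ((fun ω => (net.data 0 ω, net.otherInterf ω)) ⁻¹' a.coverageSet γ) :=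
    ((net.measurable_data 0).prodMk net.measurable_otherInterf) (a.measurableSet_coverageSet γ)
  refine Eq.trans (measure_congr ?_) (lintegral_indicator_one hpre).symm
  filter_upwards [net.ae_decreasinglyOrderable 0, net.ae_interference_eq] with ω h0 hI
  exact propext (net.lt_rate_iff hγ h0 hI)

/-- Averaging over the fading power of the serving base station. -/
lemma lintegral_coverageSet (γ : ℝ) :
    ∫⁻ ω, (a.coverageSet γ).indicator 1 (net.data 0 ω, net.otherInterf ω) ∂Pr =
      ∫⁻ ω, a.coverageWeight γ (net.data 0 ω, net.otherInterf ω) ∂Pr := by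
  have hD := net.measurable_data 0
  have hO := net.measurable_otherInterf
  have hind := net.data_indepFun_otherInterf.symm
  have h1 := hind.lintegral_comp_prod hO hD
    (f := fun p => (a.coverageSet γ).indicator 1 (p.2, p.1))
    ((measurable_one.indicator (a.measurableSet_coverageSet γ)).comp measurable_swap)
  have h2 := hind.lintegral_comp_prod hO hD (f := fun p => a.coverageWeight γ (p.2, p.1))
    ((a.measurable_coverageWeight γ).comp measurable_swap)
  refine h1.trans (Eq.trans (lintegral_congr fun ω => ?_) h2.symm)
  exact net.lintegral_signal_gt (a.sinrThreshold γ)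
    (ENNReal.ofReal a.noisePower + net.otherInterf ω)

/-- Averaging over the interference of the other operators. -/
lemma lintegral_coverageWeight {γ : ℝ} (hγ : 0 < γ) :
    ∫⁻ ω, a.coverageWeight γ (net.data 0 ω, net.otherInterf ω) ∂Pr =
      ∫⁻ ω, a.noiseFactor γ (orderedTerm 1 (net.linkPower 0 ω)) *
        expNeg (ENNReal.ofReal (a.laplaceArg γ (orderedTerm 1 (net.linkPower 0 ω))) *
          a.interf 0 (net.data 0 ω)) ∂Pr := by
  have hO := net.measurable_otherInterf
  refine (net.data_indepFun_otherInterf.lintegral_comp_prod (net.measurable_data 0) hO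
    (a.measurable_coverageWeight γ)).trans (lintegral_congr_ae ?_)
  filter_upwards [net.ae_orderedTerm_pos 0 le_rfl] with ω hω
  have hs := a.laplaceArg_pos hγ hω
  set s := a.laplaceArg γ (orderedTerm 1 (net.linkPower 0 ω)) with hsdef
  have hm : Measurable fun ω' => expNeg (ENNReal.ofReal s * net.otherInterf ω') :=
    measurable_expNeg.comp (hO.const_mul _)
  have e1 : ∀ ω', a.coverageWeight γ (net.data 0 ω, net.otherInterf ω') =
      expNeg (ENNReal.ofReal s * ENNReal.ofReal a.noisePower) *
        expNeg (ENNReal.ofReal s * net.otherInterf ω') *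
        expNeg (ENNReal.ofReal s * a.interf 0 (net.data 0 ω)) := by
    intro ω'
    rw [← expNeg_add, ← expNeg_add, ← mul_add, ← mul_add]
    rfl
  simp_rw [e1]
  rw [lintegral_mul_const _ (hm.const_mul _), lintegral_const_mul _ hm,
    net.lintegral_otherInterf hs.le, Params.noiseFactor]

/-- The rate coverage probability as an expectation over the strongest and the `K`-th strongest
link power of the serving operator. -/
theorem rateCoverage_eq_lintegral {γ : ℝ} (hγ : 0 < γ) :
    net.rateCoverage γ = ∫⁻ ω, a.integrand γ (orderedTerm 1 (net.linkPower 0 ω))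
      (orderedTerm (a.K 0) (net.linkPower 0 ω)) ∂Pr := by
  rw [net.rateCoverage_eq_coverageSet hγ, net.lintegral_coverageSet,
    net.lintegral_coverageWeight hγ,
    net.lintegral_interf_comp a.one_le_K (a.measurable_laplaceArg γ)
      (fun t ht => a.laplaceArg_pos hγ ht) (a.measurable_noiseFactor γ) fun t ht =>
        mul_le_one' (expNeg_le_one _) (Finset.prod_le_one' fun m _ =>
          net.laplace_le_one m (a.laplaceArg_pos hγ ht).le)]
  refine lintegral_congr_ae ?_
  filter_upwards [net.ae_orderedTerm_pos 0 le_rfl] with ω hω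
  exact (a.integrand_eq hγ hω).symm

lemma ae_T_eq : ∀ᵐ ω ∂Pr, ∀ K, net.T K ω = orderedTerm K (net.linkPower 0 ω) := by
  filter_upwards [net.ae_decreasinglyOrderable 0] with ω hω K
  exact (hω.orderedTerm_eq K).symm

/-- The joint law of the strongest and the `K`-th strongest link power. -/
theorem hasLaw_T_pair {K : ℕ} (hK : 2 ≤ K) :
    HasLaw (fun ω => (net.T 1 ω, net.T K ω)) ((volume : Measure (ℝ × ℝ)).withDensity
      fun t => ENNReal.ofReal (a.jointPdf (a.density 0) K t.1 t.2)) Pr := by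
  have h1 : (fun ω => (net.T 1 ω, net.T K ω)) =ᵐ[Pr] fun ω =>
      (orderedTerm 1 (net.linkPower 0 ω), orderedTerm K (net.linkPower 0 ω)) := by
    filter_upwards [net.ae_T_eq] with ω hω
    rw [hω, hω]
  refine HasLaw.congr ⟨((net.measurable_orderedTerm 0 le_rfl).prodMk
    (net.measurable_orderedTerm 0 (by omega))).aemeasurable, ?_⟩ h1
  simp_rw [a.jointPdf_eq]
  exact (net.linkPower_hasPoissonLaplace 0).map_orderedTerm_pair (a.hasTail 0) hK

/-- The law of the `K`-th strongest link power. -/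
theorem hasLaw_T {K : ℕ} (hK : 1 ≤ K) :
    HasLaw (net.T K) ((volume : Measure ℝ).withDensity
      fun t => ENNReal.ofReal (a.kthPdf (a.density 0) K t)) Pr := by
  have h1 : net.T K =ᵐ[Pr] fun ω => orderedTerm K (net.linkPower 0 ω) := by
    filter_upwards [net.ae_T_eq] with ω hω
    rw [hω]
  refine HasLaw.congr ⟨(net.measurable_orderedTerm 0 hK).aemeasurable, ?_⟩ h1
  simp_rw [a.kthPdf_eq]
  exact (net.linkPower_hasPoissonLaplace 0).map_orderedTerm (a.hasTail 0) hK

lemma rateCoverage_eq_lintegral_T {γ : ℝ} (hγ : 0 < γ) :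
    net.rateCoverage γ = ∫⁻ ω, a.integrand γ (net.T 1 ω) (net.T (a.K 0) ω) ∂Pr := by
  rw [net.rateCoverage_eq_lintegral hγ]
  refine lintegral_congr_ae ?_
  filter_upwards [net.ae_T_eq] with ω hω
  rw [hω, hω]

/-- The expectation over `(T₁, T_K)` as an iterated integral against their joint density. -/
theorem rateCoverage_of_one_lt_K (hK : 1 < a.K 0) {γ : ℝ} (hγ : 0 < γ) :
    net.rateCoverage γ = ∫⁻ T₁ in Ioi (0 : ℝ), ∫⁻ TK in Ioo (0 : ℝ) T₁,
      a.integrand γ T₁ TK * ENNReal.ofReal (a.jointPdf (a.density 0) (a.K 0) T₁ TK) := by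
  have hm := a.measurable_integrand γ
  have hj : Measurable fun t : ℝ × ℝ =>
      ENNReal.ofReal (a.jointPdf (a.density 0) (a.K 0) t.1 t.2) := by
    simp_rw [a.jointPdf_eq]
    exact ((a.hasTail 0).measurable_jointDensity _).ennreal_ofReal
  rw [net.rateCoverage_eq_lintegral_T hγ]
  refine ((net.hasLaw_T_pair hK).lintegral_comp (f := fun p => a.integrand γ p.1 p.2)
    hm.aemeasurable).trans ?_
  rw [lintegral_withDensity_eq_lintegral_mul _ hj hm, Measure.volume_eq_prod,
    lintegral_prod _ (hj.mul hm).aemeasurable, ← lintegral_indicator measurableSet_Ioi]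
  -- the joint density vanishes outside of `0 < TK < T₁`
  have hzero : ∀ T₁ TK, ¬ (0 < TK ∧ TK < T₁) → a.jointPdf (a.density 0) (a.K 0) T₁ TK = 0 :=
    fun T₁ TK h => if_neg h
  refine lintegral_congr fun T₁ => ?_
  by_cases h1 : 0 < T₁
  · rw [indicator_of_mem (show T₁ ∈ Ioi 0 from h1), ← lintegral_indicator measurableSet_Ioo]
    refine lintegral_congr fun TK => ?_
    rw [Pi.mul_apply, mul_comm, indicator_apply]
    split_ifs with h2
    · rfl
    · rw [hzero T₁ TK h2, ENNReal.ofReal_zero, mul_zero]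
  · rw [indicator_of_notMem (show T₁ ∉ Ioi 0 from h1)]
    refine (lintegral_congr fun TK => ?_).trans lintegral_zero
    rw [Pi.mul_apply, hzero T₁ TK fun h2 => h1 (h2.1.trans h2.2), ENNReal.ofReal_zero, zero_mul]

/-- The expectation over `T₁` as an integral against its density. -/
theorem rateCoverage_of_K_eq_one (hK : a.K 0 = 1) {γ : ℝ} (hγ : 0 < γ) :
    net.rateCoverage γ = ∫⁻ T₁ in Ioi (0 : ℝ),
      a.integrand γ T₁ T₁ * ENNReal.ofReal (a.kthPdf (a.density 0) 1 T₁) := by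
  have hm : Measurable fun t => a.integrand γ t t :=
    Measurable.comp (g := fun p : ℝ × ℝ => a.integrand γ p.1 p.2) (f := fun t => (t, t))
      (a.measurable_integrand γ) (measurable_id.prodMk measurable_id)
  have hk : Measurable fun t => ENNReal.ofReal (a.kthPdf (a.density 0) 1 t) :=
    (a.measurable_kthPdf 0 1).ennreal_ofReal
  rw [net.rateCoverage_eq_lintegral_T hγ, hK]
  refine ((net.hasLaw_T le_rfl).lintegral_comp (f := fun t => a.integrand γ t t)
    hm.aemeasurable).trans ?_
  rw [lintegral_withDensity_eq_lintegral_mul _ hk hm, ← lintegral_indicator measurableSet_Ioi]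
  refine lintegral_congr fun t => ?_
  rw [Pi.mul_apply, mul_comm, indicator_apply]
  split_ifs with ht
  · rfl
  · have h0 : a.kthPdf (a.density 0) 1 t = 0 := if_neg ht
    rw [h0, ENNReal.ofReal_zero, mul_zero]

end Network

end SpectrumSharing

theorem theorem1 {M : ℕ} [NeZero M] (a : SpectrumSharing.Params M)
    {Ω : Type*} [MeasurableSpace Ω] (Pr : Measure Ω) [IsProbabilityMeasure Pr]
    (net : SpectrumSharing.Network a Pr) :
    -- the case of at least two coordinated base stations of the serving operator
    (1 < a.K 0 →
      HasLaw (fun ω => (net.T 1 ω, net.T (a.K 0) ω))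
        ((volume : Measure (ℝ × ℝ)).withDensity
          fun t => ENNReal.ofReal (a.jointPdf (a.density 0) (a.K 0) t.1 t.2)) Pr ∧
      ∀ γ : ℝ, 0 < γ →
        net.rateCoverage γ =
          ∫⁻ T₁ in Ioi (0 : ℝ), ∫⁻ TK in Ioo (0 : ℝ) T₁,
            a.integrand γ T₁ TK *
              ENNReal.ofReal (a.jointPdf (a.density 0) (a.K 0) T₁ TK)) ∧
    -- the case of no coordination within the serving operator
    (a.K 0 = 1 →
      HasLaw (net.T 1)
        ((volume : Measure ℝ).withDensity
          fun t => ENNReal.ofReal (a.kthPdf (a.density 0) 1 t)) Pr ∧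
      ∀ γ : ℝ, 0 < γ →
        net.rateCoverage γ =
          ∫⁻ T₁ in Ioi (0 : ℝ),
            a.integrand γ T₁ T₁ * ENNReal.ofReal (a.kthPdf (a.density 0) 1 T₁)) ∧
    -- conditional Laplace transform of the interference of the serving operator
    (∀ s : ℝ, 0 < s → ∀ h : ℝ × ℝ → ℝ≥0∞, Measurable h →
      ∫⁻ ω, h (net.T 1 ω, net.T (a.K 0) ω) *
          SpectrumSharing.expNeg (ENNReal.ofReal s * net.interference 0 ω) ∂Pr =
        ∫⁻ ω, h (net.T 1 ω, net.T (a.K 0) ω) * a.condLaplace s (net.T (a.K 0) ω) ∂Pr) ∧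
    -- Laplace transforms of the interferences of the other operators
    (∀ m : Fin M, m ≠ 0 → ∀ s : ℝ, 0 < s →
      ∫⁻ ω, SpectrumSharing.expNeg (ENNReal.ofReal s * net.interference m ω) ∂Pr =
        a.laplace m s) := by
  refine ⟨fun hK => ⟨net.hasLaw_T_pair hK, fun γ hγ => net.rateCoverage_of_one_lt_K hK hγ⟩,
    fun hK => ⟨net.hasLaw_T le_rfl, fun γ hγ => net.rateCoverage_of_K_eq_one hK hγ⟩,
    fun s hs h hh => ?_, fun m _ s hs => ?_⟩
  -- the definitions by choice agree almost surely with their measurable versions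
  · refine Eq.trans (lintegral_congr_ae ?_)
      ((net.lintegral_interf_of_coordinated a.one_le_K hs.le hh).trans (lintegral_congr_ae ?_))
    · filter_upwards [net.ae_T_eq, net.ae_interference_eq] with ω hT hI
      rw [hT, hT, hI]
    · filter_upwards [net.ae_T_eq] with ω hT
      rw [hT, hT]
      rfl
  · rw [← net.lintegral_interf m hs.le]
    refine lintegral_congr_ae ?_
    filter_upwards [net.ae_interference_eq] with ω hI
    rw [hI]
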